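/- **Setting.** Let $\Omega\subseteq\mathbb R^d$ be closed and convex, $\mathbf x_1\in\Omega$, $D,G>0$, with $\|\mathbf x-\mathbf y\|\le D$ for all $\mathbf x,\mathbf y\in\Omega$. Let $f_1,\dots,f_T$ be loss functions on $\Omega$ with gradients satisfying $\|\nabla f_t(\mathbf w)\|\le G$ for $\mathbf w\in\Omega$. A function $f$ is *$\alpha$-exp-concave* if $\exp(-\alpha f)$ is concave on $\Omega$, and *$\lambda$-strongly convex* if $f(\mathbf y)\ge f(\mathbf x)+\langle\nabla f(\mathbf x),\mathbf y-\mathbf x\rangle+\frac\lambda2\|\mathbf y-\mathbf x\|^2$ for all $\mathbf x,\mathbf y\in\Omega$. For a positive definite $A$, $\Pi^A_\Omega(\mathbf x)$ denotes the point $\mathbf y \in\Omega$ minimizing $(\mathbf y-\mathbf x)^\top A(\mathbf y-\mathbf x)$, and $\Pi_\Omega=\Pi_\Omega^{I}$. **Maler with horizon $n$.** Put $K=\lceil\frac12\log_2 n\rceil$, $\eta^c=\frac1{2GD\sqrt n}$, $\eta_i=\frac{2^{-i}}{5GD}$ for $0\le i\le K$. There is one convex expert (point $\mathbf x^c$, weight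 $\pi^c=\frac13$) and for each $\eta=\eta_i$ an expert "s" (point $\mathbf x^{\eta,s}$) and an expert "l" (point $\mathbf x^{\eta,l}$), each with initial weight $\pi^{\eta,s}=\pi^{\eta,l}=\frac{1+1/(1+K)}{3(i+1)(i+2)}$; all start at $\mathbf x_1$. In its local round $\tau=1,2,\dots$ Maler plays $$\mathbf x=\frac{\pi^c\eta^c\mathbf x^c+\sum_\eta\eta(\pi^{\eta,s}\mathbf x^{\eta,s}+\pi^{\eta,l}\mathbf x^{\eta,l})}{\pi^c\eta^c+\sum_\eta\eta(\pi^{\eta,s}+\pi^{\eta,l})},$$ observes the gradient $\mathbf g$ at $\mathbf x$, multiplies each weight by $e^{-\text{surrogate loss of that expert's point}}$ and normalizes the weights to sum to one, where the surrogate losses are $c(\mathbf y)=-\eta^c\langle\mathbf g,\mathbf x-\mathbf y\rangle+(\eta^cGD)^2$, $s^\eta(\mathbf y)=-\eta\langle\mathbf g,\mathbf x-\mathbf y\rangle+\eta^2G^2\|\mathbf x-\mathbf y\|^2$, $l^\eta(\mathbf y)=-\eta\langle\mathbf g,\mathbf x-\mathbf y\rangle+\eta^2\langle\mathbf g,\mathbf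 x-\mathbf y\rangle^2$. The experts move to $\Pi_\Omega\big(\mathbf x^c-\frac{D}{\eta^cG\sqrt\tau}\,\eta^c\mathbf g\big)$, $\Pi_\Omega\big(\mathbf x^{\eta,s}-\frac{1}{2\eta^2G^2\tau}\nabla s^\eta(\mathbf x^{\eta,s})\big)$ and, with $\mathbf v=\nabla l^\eta(\mathbf x^{\eta,l})$, $\Sigma\leftarrow\Sigma+\mathbf v\mathbf v^\top$ (initially $\Sigma=\frac{1}{\beta_0^2D^2}I$, $\beta_0=\frac12\min\{\frac{1}{4\cdot 7/25},1\}$), to $\Pi^{\Sigma}_\Omega\big(\mathbf x^{\eta,l}-\frac1{\beta_0}\Sigma^{-1}\mathbf v\big)$. **UMA3.** The geometric covering (GC) intervals are $[i2^k,(i+1)2^k-1]$, $k\ge0$, $i\ge1$. For every GC interval $I=[r,s]$ an expert $E_I$ runs, during the rounds of $I$, its own instance of Maler with horizon $|I|$ on $f_r,\dots,f_s$ (so it observes $\nabla f_t$ at its own output $\mathbf w_{t,I}$), and has $x_{r-1,I}=1$, $L_{r-1,I}=0$. In round $t$, let $\mathcal A_t$ be the set of GC intervals containing $t$; with $\Delta_{t-1,I}=\min\Big\{\frac12,\sqrt{\frac{\ln(4s^2)}{1+L_{t-1,I}}}\Big\}$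 and $p_{t,I}=\frac{\Delta_{t-1,I}x_{t-1,I}}{\sum_{J\in\mathcal A_t}\Delta_{t-1,J}x_{t-1,J}}$, UMA3 plays $\mathbf w_t=\sum_{I\in\mathcal A_t}p_{t,I}\mathbf w_{t,I}$. Then, with $\ell_{t,I}=\frac{\langle\nabla f_t(\mathbf w_t),\mathbf w_{t,I}-\mathbf w_t\rangle+GD}{2GD}$ and $\ell_t=\sum_{I\in\mathcal A_t}p_{t,I}\ell_{t,I}$, it sets for all $I\in\mathcal A_t$ $$L_{t,I}=L_{t-1,I}+(\ell_t-\ell_{t,I})^2,\qquad x_{t,I}=\big(x_{t-1,I}(1+\Delta_{t-1,I}(\ell_t-\ell_{t,I}))\big)^{\Delta_{t,I}/\Delta_{t-1,I}} .$$ **Theorem.** UMA3 always plays $\mathbf w_t\in\Omega$. Let $1\le p\le q\le T$, $\mathbf w\in\Omega$, and put $b(p,q)=2\lceil\log_2(q-p+2)\rceil$, $c(q)=32\ln(2q)$, $\Xi(p,q)=2\ln\big(\frac{\sqrt3}2\log_2(q-p+1)+3\sqrt3\big)$. 1. If $f_t$ is $\alpha$-exp-concave for all $t\in[p,q]$ ($\alpha>0$),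 then with $\beta=\frac12\min\{\frac1{4GD},\alpha\}$ $$\sum_{t=p}^qf_t(\mathbf w_t)-\sum_{t=p}^qf_t(\mathbf w)\le\Big(10GD+\frac9{2\beta}\Big)b(p,q)\big(c(q)+\Xi(p,q)+10d\ln(q-p+1)\big).$$ 2. If $f_t$ is $\lambda$-strongly convex for all $t\in[p,q]$ ($\lambda>0$), then $$\sum_{t=p}^qf_t(\mathbf w_t)-\sum_{t=p}^qf_t(\mathbf w)\le\Big(10GD+\frac{9G^2}{2\lambda}\Big)b(p,q)\big(c(q)+\Xi(p,q)+\ln(q-p+1)\big).$$ 3. If $f_t$ is convex for all $t\in[p,q]$, then $$\sum_{t=p}^qf_t(\mathbf w_t)-\sum_{t=p}^qf_t(\mathbf w)\le2GD\,c(q)\,b(p,q)+7GD\Big(\sqrt{c(q)}+2\ln3+\frac32\Big)\sqrt{q-p+1}.$$ Moreover the regret on the left is $O\big(\frac{d\log q\log(q-p)}{\alpha}\big)$ in case 1 and $O\big(\frac{\log q\log(q-p)}{\lambda}\big)$ in case 2, uniformly over $q\ge p+2$, with constants that depend only on $G$, $D$ and an upper bound on $\alpha$, respectively $\lambda$; and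 it is $O\big(\sqrt{(q-p)\log q}\big)$ in case 3, uniformly over $q\ge p+1$, with a constant that depends only on $G$ and $D$. -/

import Mathlib

/-!  Online convex optimization in `ℝ^d`: the static-regret algorithm Maler, geometric covering
intervals, and the three-layer algorithm UMA3 (sleeping Adapt-ML-Prod over Maler experts). -/

namespace UMA

/-- The decision space `ℝ^d` with the Euclidean norm. -/
abbrev Vec (d : ℕ) := EuclideanSpace ℝ (Fin d)

/-! ### The online problem -/

/-- The standing assumptions on a `T`-round problem: `Ω` is a closed convex set of diameter at most
`D`, `x₁` is a point of it, and on `Ω` every loss `f t`, `1 ≤ t ≤ T`, has the gradient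
`grad t`, of norm at most `G`. -/
structure Setting {d : ℕ} (Ω : Set (Vec d)) (D G : ℝ) (x₁ : Vec d) (T : ℕ)
    (f : ℕ → Vec d → ℝ) (grad : ℕ → Vec d → Vec d) : Prop where
  isClosed : IsClosed Ω
  convex : Convex ℝ Ω
  init_mem : x₁ ∈ Ω
  diam_le : ∀ x ∈ Ω, ∀ y ∈ Ω, ‖x - y‖ ≤ D
  hasGradient : ∀ t ∈ Finset.Icc 1 T, ∀ x ∈ Ω, HasGradientWithinAt (f t) (grad t x) Ω x
  grad_le : ∀ t ∈ Finset.Icc 1 T, ∀ x ∈ Ω, ‖grad t x‖ ≤ G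

/-- `f` is `α`-exp-concave over `Ω`. -/
def ExpConcaveOn {d : ℕ} (Ω : Set (Vec d)) (α : ℝ) (f : Vec d → ℝ) : Prop :=
  ConcaveOn ℝ Ω (fun x => Real.exp (-α * f x))

/-- `f`, with gradient `grad`, is `lam`-strongly convex over `Ω`. -/
def StronglyConvexOn {d : ℕ} (Ω : Set (Vec d)) (lam : ℝ) (f : Vec d → ℝ)
    (grad : Vec d → Vec d) : Prop :=
  ∀ x ∈ Ω, ∀ y ∈ Ω, f x + inner ℝ (grad x) (y - x) + lam / 2 * ‖y - x‖ ^ 2 ≤ f y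

/-- The regret of the decisions `w t` over the rounds `p, …, q` against the fixed decision `u`. -/
def regret {d : ℕ} (f : ℕ → Vec d → ℝ) (w : ℕ → Vec d) (p q : ℕ) (u : Vec d) : ℝ :=
  ∑ t ∈ Finset.Icc p q, f t (w t) - ∑ t ∈ Finset.Icc p q, f t u

/-- What the algorithms are given in advance: the domain `Ω`, the bounds `D` and `G`, and the point
of `Ω` from which all iterative methods start. -/
structure Params (d : ℕ) where
  Ω : Set (Vec d)
  D : ℝ
  G : ℝ
  x₁ : Vec d

/-! ### Projections -/

/-- The quadratic form `vᵀ A v`. -/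
def quad {d : ℕ} (A : Matrix (Fin d) (Fin d) ℝ) (v : Vec d) : ℝ :=
  v.ofLp ⬝ᵥ A.mulVec v.ofLp

open Classical in
/-- The projection onto `Ω` in the norm induced by `A`: a point `y` of `Ω` that minimizes
`(y - x)ᵀ A (y - x)` (it exists and is unique if `Ω` is nonempty, closed and convex and `A` is
positive definite).  The Euclidean projection is the case `A = 1`. -/
noncomputable def proj {d : ℕ} (Ω : Set (Vec d)) (A : Matrix (Fin d) (Fin d) ℝ) (x : Vec d) :
    Vec d :=
  if h : ∃ y ∈ Ω, ∀ z ∈ Ω, quad A (y - x) ≤ quad A (z - x) then h.choose else x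

/-! ### Maler

Maler with horizon `n` keeps one convex expert (online gradient descent) and, for every learning
rate `eta i`, `0 ≤ i ≤ malerK n`, one strongly convex expert (online gradient descent on the
surrogate `lossS`) and one exp-concave expert (online Newton step on the surrogate `lossL`).
In the surrogates, `x` is the point played by Maler, `g` the gradient observed there, and `y` the
argument. -/

/-- The largest index of a learning rate, `⌈(1/2) log₂ n⌉`. -/
noncomputable def malerK (n : ℕ) : ℕ := ⌈Real.logb 2 n / 2⌉₊

/-- The learning rate `2^{-i} / (5 G D)`. -/
noncomputable def eta {d : ℕ} (P : Params d) (i : ℕ) : ℝ := 1 / (2 ^ i * (5 * P.G * P.D))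

/-- The learning rate `1 / (2 G D √n)` of the convex expert. -/
noncomputable def etaC {d : ℕ} (P : Params d) (n : ℕ) : ℝ := 1 / (2 * P.G * P.D * √n)

/-- The surrogate loss of the convex expert. -/
noncomputable def lossC {d : ℕ} (P : Params d) (n : ℕ) (x g y : Vec d) : ℝ :=
  -etaC P n * inner ℝ g (x - y) + (etaC P n * P.G * P.D) ^ 2

/-- The surrogate loss of the strongly convex expert with learning rate `h`. -/
noncomputable def lossS {d : ℕ} (P : Params d) (h : ℝ) (x g y : Vec d) : ℝ :=
  -h * inner ℝ g (x - y) + h ^ 2 * P.G ^ 2 * ‖x - y‖ ^ 2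

/-- The surrogate loss of the exp-concave expert with learning rate `h`. -/
noncomputable def lossL {d : ℕ} (h : ℝ) (x g y : Vec d) : ℝ :=
  -h * inner ℝ g (x - y) + h ^ 2 * inner ℝ g (x - y) ^ 2

/-- The gradient of `lossS` in its last argument. -/
noncomputable def gradS {d : ℕ} (P : Params d) (h : ℝ) (x g y : Vec d) : Vec d :=
  h • g + (2 * h ^ 2 * P.G ^ 2) • (y - x)

/-- The gradient of `lossL` in its last argument. -/
noncomputable def gradL {d : ℕ} (h : ℝ) (x g y : Vec d) : Vec d :=
  h • g + (2 * h ^ 2 * inner ℝ g (y - x)) • g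

/-- The parameter `(1/2) min {1 / (4 G' D), 1}` of the online Newton step, where `G' = 7 / (25 D)`
bounds the gradients of the surrogates `lossL`. -/
noncomputable def onsBeta {d : ℕ} (P : Params d) : ℝ :=
  1 / 2 * min (1 / (4 * (7 / (25 * P.D)) * P.D)) 1

/-- The state of Maler before one of its rounds; the families are indexed by the number of the
learning rate. -/
structure MalerState (d : ℕ) where
  /-- the number of the round, starting from 1 -/
  round : ℕ
  /-- the points of the experts -/
  ptC : Vec d
  ptS : ℕ → Vec d
  ptL : ℕ → Vec d
  /-- the matrices of the online Newton steps -/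
  cov : ℕ → Matrix (Fin d) (Fin d) ℝ
  /-- the weights of the experts -/
  wtC : ℝ
  wtS : ℕ → ℝ
  wtL : ℕ → ℝ

/-- The prior weight of the strongly convex and of the exp-concave expert number `i`. -/
noncomputable def malerPrior (n i : ℕ) : ℝ :=
  (1 + 1 / (1 + (malerK n : ℝ))) / (3 * ((i : ℝ) + 1) * ((i : ℝ) + 2))

/-- The initial state of Maler with horizon `n`. -/
noncomputable def malerInit {d : ℕ} (P : Params d) (n : ℕ) : MalerState d where
  round := 1
  ptC := P.x₁
  ptS := fun _ => P.x₁
  ptL := fun _ => P.x₁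
  cov := fun _ => (1 / (onsBeta P ^ 2 * P.D ^ 2)) • (1 : Matrix (Fin d) (Fin d) ℝ)
  wtC := 1 / 3
  wtS := malerPrior n
  wtL := malerPrior n

/-- The point played by Maler: the average of the points of its experts, with weights
proportional to (weight of the expert) × (learning rate of the expert). -/
noncomputable def malerPlay {d : ℕ} (P : Params d) (n : ℕ) (S : MalerState d) : Vec d :=
  (S.wtC * etaC P n +
      ∑ i ∈ Finset.range (malerK n + 1), (S.wtS i * eta P i + S.wtL i * eta P i))⁻¹ •
    ((S.wtC * etaC P n) • S.ptC +
      ∑ i ∈ Finset.range (malerK n + 1),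
        ((S.wtS i * eta P i) • S.ptS i + (S.wtL i * eta P i) • S.ptL i))

/-- The normalizing factor of the exponential weight update. -/
noncomputable def malerPhi {d : ℕ} (P : Params d) (n : ℕ) (S : MalerState d) (g : Vec d) : ℝ :=
  S.wtC * Real.exp (-lossC P n (malerPlay P n S) g S.ptC) +
    ∑ i ∈ Finset.range (malerK n + 1),
      (S.wtS i * Real.exp (-lossS P (eta P i) (malerPlay P n S) g (S.ptS i)) +
        S.wtL i * Real.exp (-lossL (eta P i) (malerPlay P n S) g (S.ptL i)))

/-- The updated matrix of the online Newton step number `i`. -/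
noncomputable def malerCov {d : ℕ} (P : Params d) (n : ℕ) (S : MalerState d) (g : Vec d) (i : ℕ) :
    Matrix (Fin d) (Fin d) ℝ :=
  S.cov i +
    Matrix.vecMulVec (gradL (eta P i) (malerPlay P n S) g (S.ptL i)).ofLp
      (gradL (eta P i) (malerPlay P n S) g (S.ptL i)).ofLp

/-- One round of Maler, in which it observes the gradient `g` at the point it plays. The convex
expert takes the step size `D / (etaC G √t)` on the gradient `etaC • g` of `lossC`. -/
noncomputable def malerStep {d : ℕ} (P : Params d) (n : ℕ) (S : MalerState d) (g : Vec d) :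
    MalerState d where
  round := S.round + 1
  ptC := proj P.Ω 1
    (S.ptC - (P.D / (etaC P n * P.G * √S.round)) • (etaC P n • g))
  ptS := fun i => proj P.Ω 1
    (S.ptS i - (1 / (2 * eta P i ^ 2 * P.G ^ 2 * S.round)) •
      gradS P (eta P i) (malerPlay P n S) g (S.ptS i))
  ptL := fun i => proj P.Ω (malerCov P n S g i)
    (S.ptL i - (1 / onsBeta P) • WithLp.toLp 2
      ((malerCov P n S g i)⁻¹.mulVec (gradL (eta P i) (malerPlay P n S) g (S.ptL i)).ofLp))
  cov := malerCov P n S g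
  wtC := S.wtC * Real.exp (-lossC P n (malerPlay P n S) g S.ptC) / malerPhi P n S g
  wtS := fun i =>
    S.wtS i * Real.exp (-lossS P (eta P i) (malerPlay P n S) g (S.ptS i)) / malerPhi P n S g
  wtL := fun i =>
    S.wtL i * Real.exp (-lossL (eta P i) (malerPlay P n S) g (S.ptL i)) / malerPhi P n S g

/-! ### Geometric covering intervals

The pair `J = (k, i)` with `1 ≤ i` stands for the interval `[i * 2 ^ k, (i + 1) * 2 ^ k - 1]`. -/

/-- The length of the interval `J`. -/
def gcLen (J : ℕ × ℕ) : ℕ := 2 ^ J.1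

/-- The first round of the interval `J`. -/
def gcStart (J : ℕ × ℕ) : ℕ := J.2 * 2 ^ J.1

/-- The last round of the interval `J`. -/
def gcEnd (J : ℕ × ℕ) : ℕ := (J.2 + 1) * 2 ^ J.1 - 1

/-- The geometric covering intervals that contain `t` (such an interval has `k, i ≤ t`). -/
def active (t : ℕ) : Finset (ℕ × ℕ) :=
  (Finset.range (t + 1) ×ˢ Finset.range (t + 1)).filter
    (fun J => 1 ≤ J.2 ∧ gcStart J ≤ t ∧ t ≤ gcEnd J)

/-! ### UMA3 -/

/-- The state of the expert of one interval: its own instance of Maler and the two quantities that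
the meta-algorithm keeps for it. -/
structure ExpertState (d : ℕ) where
  maler : MalerState d
  L : ℝ
  x : ℝ

/-- The state of UMA3 between two rounds.  An expert has its initial state until the first round
of its interval, and its state is neither used nor changed after the last one. -/
abbrev State (d : ℕ) := ℕ × ℕ → ExpertState d

/-- The initial state. -/
noncomputable def init {d : ℕ} (P : Params d) : State d :=
  fun J => ⟨malerInit P (gcLen J), 0, 1⟩

/-- The learning rate `min {1/2, √(ln γ / (1 + L))}` of the expert of `J`, where `γ = 4 s²` for the
last round `s` of `J`. -/
noncomputable def rate (J : ℕ × ℕ) (L : ℝ) : ℝ :=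
  min (1 / 2) √(Real.log (4 * (gcEnd J : ℝ) ^ 2) / (1 + L))

/-- The weight of the expert of `J` in round `t`. -/
noncomputable def weight {d : ℕ} (S : State d) (t : ℕ) (J : ℕ × ℕ) : ℝ :=
  rate J (S J).L * (S J).x / ∑ J' ∈ active t, rate J' (S J').L * (S J').x

/-- The output of the expert of `J`. -/
noncomputable def expertPlay {d : ℕ} (P : Params d) (S : State d) (J : ℕ × ℕ) : Vec d :=
  malerPlay P (gcLen J) (S J).maler

/-- The decision of UMA3 in round `t`. -/
noncomputable def play {d : ℕ} (P : Params d) (S : State d) (t : ℕ) : Vec d :=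
  ∑ J ∈ active t, weight S t J • expertPlay P S J

/-- The normalized linearized loss of the expert of `J` in round `t`, where `grad` is the gradient
of the loss function of this round. -/
noncomputable def expertLoss {d : ℕ} (P : Params d) (grad : Vec d → Vec d) (S : State d) (t : ℕ)
    (J : ℕ × ℕ) : ℝ :=
  (inner ℝ (grad (play P S t)) (expertPlay P S J - play P S t) + P.G * P.D) / (2 * P.G * P.D)

/-- The loss of the meta-algorithm in round `t`. -/
noncomputable def metaLoss {d : ℕ} (P : Params d) (grad : Vec d → Vec d) (S : State d) (t : ℕ) :
    ℝ :=
  ∑ J ∈ active t, weight S t J * expertLoss P grad S t J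

/-- The updated value of `L` for the expert of `J`. -/
noncomputable def nextL {d : ℕ} (P : Params d) (grad : Vec d → Vec d) (S : State d) (t : ℕ)
    (J : ℕ × ℕ) : ℝ :=
  (S J).L + (metaLoss P grad S t - expertLoss P grad S t J) ^ 2

/-- Round `t` of UMA3.  The Maler instance of `J` observes the gradient at its own output. -/
noncomputable def step {d : ℕ} (P : Params d) (grad : Vec d → Vec d) (S : State d) (t : ℕ) :
    State d :=
  fun J => if J ∈ active t then
    { maler := malerStep P (gcLen J) (S J).maler (grad (expertPlay P S J))
      L := nextL P grad S t J
      x := ((S J).x * (1 + rate J (S J).L *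
          (metaLoss P grad S t - expertLoss P grad S t J))) ^
        (rate J (nextL P grad S t J) / rate J (S J).L) }
    else S J

/-- The state of UMA3 after `t` rounds, when the loss functions have the gradients `grad`. -/
noncomputable def state {d : ℕ} (P : Params d) (grad : ℕ → Vec d → Vec d) : ℕ → State d
  | 0 => init P
  | t + 1 => step P (grad (t + 1)) (state P grad t) (t + 1)

/-- The decision of UMA3 in round `t = 1, 2, …`. -/
noncomputable def decision {d : ℕ} (P : Params d) (grad : ℕ → Vec d → Vec d) (t : ℕ) : Vec d :=
  play P (state P grad (t - 1)) t

/-! ### The quantities in the bounds -/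

/-- `b(p,q) = 2 ⌈log₂ (q - p + 2)⌉` -/
noncomputable def b (p q : ℕ) : ℝ := 2 * (⌈Real.logb 2 ((q : ℝ) - p + 2)⌉ : ℝ)

/-- `c(q) = 32 ln (2 q)` -/
noncomputable def c (q : ℕ) : ℝ := 32 * Real.log (2 * q)

/-- `Ξ(p,q) = 2 ln ((√3/2) log₂ (q - p + 1) + 3√3)` -/
noncomputable def Xi (p q : ℕ) : ℝ :=
  2 * Real.log (√3 / 2 * Real.logb 2 ((q : ℝ) - p + 1) + 3 * √3)

/-- `β = (1/2) min {1/(4GD), α}` -/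
noncomputable def beta (G D α : ℝ) : ℝ := 1 / 2 * min (1 / (4 * G * D)) α

end UMA

/-!
Fix a round interval `[p, q]`. It is partitioned into geometric covering intervals, at most
`b p q` of them, whose lengths first increase and then decrease, by a factor of two or more each
time except at the turn (`exists_gcPartition`). Cutting at the multiple of the highest power of two
makes both halves binary expansions, so the square roots of the lengths add up to `O(√(q - p + 1))`.
Over one interval `J` of the partition the regret is the regret of UMA3 against the expert of `J`
plus the regret of that expert, which is an instance of Maler run exactly on the rounds of `J`.

For the first part, the linearized losses are such that the decision itself has loss `1 / 2`.
Hence the first-order terms of the multiplicative updates cancel, and the total mass of all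
experts that have started grows only through the changes of the learning rates and is at most
`4 Q²` after `Q` rounds (`state_x_le`). Comparing with the mass of the expert of `J` bounds the
linearized regret by `4 G D A + (13 / 4) √(A (4 G² D² + V))`, where `A = log (4 s²)` for the
last round `s` of `J`, and `V` is the sum of the squares of the linearized regrets
(`meta_regret_le`). Exp-concavity and strong convexity provide a negative multiple of `V`, which
absorbs the root; for convex losses `V` is at most `G² D²` times the length of `J`.

For Maler, `exp (z - z²) ≤ 1 + z` and the choice of the played point as a balance point show that
the exponential weights never gain mass before normalization (`malerPhi_le_one`). So the surrogate
loss of each expert is bounded below by the logarithm of its prior, and together with the regret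
of the expert on its own surrogate (online gradient descent, or the online Newton step with the
log-determinant potential) this gives, for every learning rate `η` of the grid, a regret
bound `η V + M / η`. The grid contains a rate that is good for every curvature
(`sub_sq_le_of_forall_eta`).

The rates for exp-concave and strongly convex losses follow from the explicit bounds. The explicit
bound for convex losses does not imply the rate `√((q - p) log q)` when `q - p` is
comparable to `log q`; there the trivial bound `G D |J|` is used for the intervals `J` shorter than
`log q` (`sum_convex_le_sqrt_log`).
-/

namespace UMA

/-! ### First-order inequalities -/

/-- The gradient inequality. The gradient is only taken within `Ω`, so the claim is reduced to the
one-sided derivative along the segment from `x` to `y`. -/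
theorem convexOn_add_inner_le {d : ℕ} {Ω : Set (Vec d)} {f : Vec d → ℝ} {g x y : Vec d}
    (hf : ConvexOn ℝ Ω f) (hx : x ∈ Ω) (hy : y ∈ Ω) (hg : HasGradientWithinAt f g Ω x) :
    f x + inner ℝ g (y - x) ≤ f y := by
  let φ : ℝ → Vec d := AffineMap.lineMap x y
  have hmaps : Set.MapsTo φ (Set.Icc 0 1) Ω := fun θ hθ =>
    hf.1.lineMap_mem hx hy hθ
  have hφ0 : φ 0 = x := by simp [φ]
  have hφ1 : φ 1 = y := by simp [φ]
  have hφd : HasDerivWithinAt φ (y - x) (Set.Icc 0 1) 0 :=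
    (AffineMap.hasDerivAt_lineMap).hasDerivWithinAt
  have hconv : ConvexOn ℝ (Set.Icc (0 : ℝ) 1) (f ∘ φ) :=
    (hf.comp_affineMap (AffineMap.lineMap x y)).subset hmaps (convex_Icc 0 1)
  have hd : HasDerivWithinAt (f ∘ φ) (inner ℝ g (y - x)) (Set.Icc 0 1) 0 := by
    have h1 : HasFDerivWithinAt f (InnerProductSpace.toDual ℝ (Vec d) g) Ω (φ 0) := by
      rw [hφ0]; exact hg
    simpa using h1.comp_hasDerivWithinAt (0 : ℝ) hφd hmaps
  have := hconv.le_slope_of_hasDerivWithinAt (x := 0) (y := 1) (by simp) (by simp) one_pos hd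
  simp [slope_def_field, hφ0, hφ1] at this
  linarith

/-- The form of `-log (1 - u) ≥ u + u² / 4` that exp-concavity is used with. -/
theorem log_one_add_le {v : ℝ} (hv : |v| ≤ 1 / 4) : Real.log (1 + v) ≤ v - v ^ 2 / 4 := by
  have h := abs_le.1 hv
  have h1 := Real.abs_log_sub_add_sum_range_le (x := -v) (by rw [abs_neg]; linarith) 3
  have h2 : |-v| ^ (3 + 1) / (1 - |-v|) ≤ v ^ 2 / 12 := by
    rw [abs_neg, div_le_iff₀ (by linarith)]
    have h3 : |v| ^ (3 + 1) = v ^ 2 * v ^ 2 := by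
      rw [← sq_abs]; ring
    have h4 : v ^ 2 ≤ 1 / 16 := by nlinarith
    have h6 : 0 ≤ v ^ 2 * (1 / 16 - v ^ 2) := mul_nonneg (sq_nonneg v) (by linarith)
    have h7 : 0 ≤ v ^ 2 * (1 / 4 - |v|) := mul_nonneg (sq_nonneg v) (by linarith)
    rw [h3]
    linarith
  have h5 := (abs_le.1 (h1.trans h2)).2
  simp [Finset.sum_range_succ] at h5
  nlinarith [sq_nonneg v, mul_nonneg (sq_nonneg v) (by linarith : 0 ≤ 1 / 4 - v)]

/-- The lower bound on the logarithm behind both weight updates, that of Maler and that of the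
meta-algorithm. -/
theorem sub_sq_le_log_one_add {z : ℝ} (hz : -(1 / 2) ≤ z) : z - z ^ 2 ≤ Real.log (1 + z) := by
  rcases le_total 0 z with h0 | h0
  · refine le_trans ?_ (Real.le_log_one_add_of_nonneg h0)
    rw [le_div_iff₀ (by linarith)]
    nlinarith [pow_nonneg h0 2, pow_nonneg h0 3]
  · rw [Real.le_log_iff_exp_le (by linarith)]
    have h1 := Real.quadratic_le_exp_of_nonneg (x := -z + z ^ 2) (by nlinarith)
    have h2 : Real.exp (z - z ^ 2) * Real.exp (-z + z ^ 2) = 1 := by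
      rw [← Real.exp_add]; simp
    have h3 : 1 ≤ (1 + z) * (1 + (-z + z ^ 2) + (-z + z ^ 2) ^ 2 / 2) := by
      have : 0 ≤ z ^ 2 * (1 + z - z ^ 2 + z ^ 3) := by
        apply mul_nonneg (sq_nonneg _)
        nlinarith [mul_nonneg (by linarith : 0 ≤ -z) (by linarith : 0 ≤ 1 / 2 + z),
          pow_nonneg (neg_nonneg.2 h0) 2]
      nlinarith
    have h4 : 1 ≤ (1 + z) * Real.exp (-z + z ^ 2) :=
      h3.trans (mul_le_mul_of_nonneg_left h1 (by linarith))
    nlinarith [Real.exp_pos (z - z ^ 2)]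

theorem exp_sub_sq_le {z y : ℝ} (hz : -(1 / 2) ≤ z) (hy : z ^ 2 ≤ y) :
    Real.exp (z - y) ≤ 1 + z := by
  rcases hz.eq_or_lt with h | h
  all_goals
    rw [← Real.le_log_iff_exp_le (by linarith)]
    linarith [sub_sq_le_log_one_add hz]

/-- An exp-concave function lies above its quadratic lower model in the direction of the gradient.
The concavity of `exp (-α f)` bounds `exp (α (f x - f y))` linearly; Bernoulli's inequality lowers
the exponent `α` to `2 β`. -/
theorem ExpConcaveOn.add_inner_add_sq_le {d : ℕ} {Ω : Set (Vec d)} {f : Vec d → ℝ}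
    {g x y : Vec d} {α β R : ℝ} (hα : 0 < α) (hβ : 0 < β) (hβα : 2 * β ≤ α)
    (hβR : 2 * β * R ≤ 1 / 4) (hf : ExpConcaveOn Ω α f) (hx : x ∈ Ω) (hy : y ∈ Ω)
    (hg : HasGradientWithinAt f g Ω x) (hR : |inner ℝ g (y - x)| ≤ R) :
    f x + inner ℝ g (y - x) + β / 2 * inner ℝ g (y - x) ^ 2 ≤ f y := by
  set z := inner ℝ g (y - x) with hz
  have hgrad : HasGradientWithinAt (fun x => -Real.exp (-α * f x))
      ((α * Real.exp (-α * f x)) • g) Ω x := by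
    have h1 : HasFDerivWithinAt f (InnerProductSpace.toDual ℝ (Vec d) g) Ω x := hg
    have h2 := ((h1.const_mul (-α)).exp).neg
    refine h2.congr_fderiv ?_
    ext v
    simp
    ring
  have h1 := convexOn_add_inner_le (ConcaveOn.neg hf) hx hy hgrad
  rw [real_inner_smul_left, ← hz] at h1
  have h2 : Real.exp (α * (f x - f y)) ≤ 1 - α * z := by
    have h3 : Real.exp (α * (f x - f y)) * Real.exp (-α * f x) = Real.exp (-α * f y) := by
      rw [← Real.exp_add]; ring_nf
    have h4 : Real.exp (-α * f y) ≤ (1 - α * z) * Real.exp (-α * f x) := by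
      simp only [Pi.neg_apply] at h1
      linarith
    rw [← h3] at h4
    exact le_of_mul_le_mul_right h4 (Real.exp_pos _)
  have hpos : 0 < 1 - α * z := (Real.exp_pos _).trans_le h2
  have h5 := rpow_one_add_le_one_add_mul_self (s := -(α * z)) (by linarith) (p := 2 * β / α)
    (by positivity) ((div_le_one hα).2 hβα)
  have h6 : Real.exp (2 * β * (f x - f y)) ≤ 1 + -(2 * β * z) := by
    calc Real.exp (2 * β * (f x - f y)) = Real.exp (α * (f x - f y)) ^ (2 * β / α) := by
          rw [← Real.exp_mul]; congr 1; field_simp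
      _ ≤ (1 + -(α * z)) ^ (2 * β / α) :=
          Real.rpow_le_rpow (Real.exp_pos _).le (by linarith) (by positivity)
      _ ≤ 1 + 2 * β / α * -(α * z) := h5
      _ = _ := by field_simp
  have habs : |-(2 * β * z)| ≤ 1 / 4 := by
    rw [abs_neg, abs_mul, abs_of_pos (by positivity : 0 < 2 * β)]
    exact (mul_le_mul_of_nonneg_left hR (by positivity)).trans hβR
  have h7 := log_one_add_le habs
  have h8 : 2 * β * (f x - f y) ≤ Real.log (1 + -(2 * β * z)) := by
    rw [Real.le_log_iff_exp_le ((Real.exp_pos _).trans_le h6)]; exact h6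
  have h9 : 2 * β * (f x + z + β / 2 * z ^ 2 - f y) ≤ 0 := by nlinarith
  nlinarith [nonpos_of_mul_nonpos_right h9 (by positivity : 0 < 2 * β)]

/-! ### Generalized projections -/

theorem isCompact_of_diam_le {d : ℕ} {Ω : Set (Vec d)} {D : ℝ} (hc : IsClosed Ω)
    (hD : ∀ x ∈ Ω, ∀ y ∈ Ω, ‖x - y‖ ≤ D) : IsCompact Ω :=
  Metric.isCompact_of_isClosed_isBounded hc
    (Metric.isBounded_iff.2 ⟨D, fun x hx y hy => by rw [dist_eq_norm]; exact hD x hx y hy⟩)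

theorem continuous_quad {d : ℕ} (A : Matrix (Fin d) (Fin d) ℝ) : Continuous (quad A) := by
  unfold quad
  have h : Continuous fun v : Vec d => v.ofLp := PiLp.continuous_ofLp 2 _
  exact h.dotProduct (Continuous.matrix_mulVec continuous_const h)

theorem proj_spec {d : ℕ} {Ω : Set (Vec d)} (hc : IsCompact Ω) (hne : Ω.Nonempty)
    (A : Matrix (Fin d) (Fin d) ℝ) (x : Vec d) :
    proj Ω A x ∈ Ω ∧ ∀ z ∈ Ω, quad A (proj Ω A x - x) ≤ quad A (z - x) := by
  have h : ∃ y ∈ Ω, ∀ z ∈ Ω, quad A (y - x) ≤ quad A (z - x) := by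
    obtain ⟨y, hy, hmin⟩ := hc.exists_isMinOn hne
      ((continuous_quad A).comp (continuous_id.sub continuous_const) :
        Continuous fun y => quad A (y - x)).continuousOn
    exact ⟨y, hy, fun z hz => hmin hz⟩
  rw [proj, dif_pos h]
  exact h.choose_spec

theorem proj_mem {d : ℕ} {Ω : Set (Vec d)} (hc : IsCompact Ω) (hne : Ω.Nonempty)
    (A : Matrix (Fin d) (Fin d) ℝ) (x : Vec d) : proj Ω A x ∈ Ω :=
  (proj_spec hc hne A x).1

theorem quad_add_smul {d : ℕ} {A : Matrix (Fin d) (Fin d) ℝ} (hA : A.IsSymm) (u v : Vec d)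
    (θ : ℝ) : quad A (u + θ • v) =
      quad A u + 2 * θ * (v.ofLp ⬝ᵥ A.mulVec u.ofLp) + θ ^ 2 * quad A v := by
  have h : u.ofLp ⬝ᵥ A.mulVec v.ofLp = v.ofLp ⬝ᵥ A.mulVec u.ofLp := by
    rw [Matrix.dotProduct_mulVec, ← Matrix.mulVec_transpose, hA.eq, dotProduct_comm]
  simp only [quad, WithLp.ofLp_add, WithLp.ofLp_smul, Matrix.mulVec_add, Matrix.mulVec_smul,
    dotProduct_add, add_dotProduct, smul_dotProduct, dotProduct_smul, smul_eq_mul, h]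
  ring

/-- Projecting onto a convex set does not increase the distance to the points of the set. -/
theorem quad_proj_sub_le {d : ℕ} {Ω : Set (Vec d)} (hc : IsCompact Ω) (hconv : Convex ℝ Ω)
    {A : Matrix (Fin d) (Fin d) ℝ} (hA : A.PosSemidef) (x : Vec d) {w : Vec d} (hw : w ∈ Ω) :
    quad A (proj Ω A x - w) ≤ quad A (x - w) := by
  have hs : A.IsSymm := by
    have := hA.isHermitian.eq
    rwa [Matrix.conjTranspose_eq_transpose_of_trivial] at this
  obtain ⟨hy, hmin⟩ := proj_spec hc ⟨w, hw⟩ A x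
  set y := proj Ω A x
  set B := (w - y).ofLp ⬝ᵥ A.mulVec (y - x).ofLp with hB
  -- comparing `y` with the points `y + θ (w - y)` of `Ω` for small `θ` gives `0 ≤ B`
  have h1 : ∀ θ ∈ Set.Ioc (0 : ℝ) 1, 0 ≤ 2 * B + θ * quad A (w - y) := by
    intro θ hθ
    have hm : y + θ • (w - y) ∈ Ω := hconv.add_smul_sub_mem hy hw ⟨hθ.1.le, hθ.2⟩
    have h := hmin _ hm
    rw [show y + θ • (w - y) - x = (y - x) + θ • (w - y) by abel, quad_add_smul hs, ← hB] at h
    have : 0 ≤ θ * (2 * B + θ * quad A (w - y)) := by linarith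
    exact nonneg_of_mul_nonneg_right this hθ.1
  have hB0 : 0 ≤ B := by
    have ht : Filter.Tendsto (fun θ : ℝ => 2 * B + θ * quad A (w - y)) (nhdsWithin 0 (Set.Ioi 0))
        (nhds (2 * B + 0 * quad A (w - y))) :=
      ((by fun_prop : Continuous fun θ : ℝ => 2 * B + θ * quad A (w - y)).tendsto 0).mono_left
        nhdsWithin_le_nhds
    have := ge_of_tendsto ht (Filter.eventually_of_mem (Ioc_mem_nhdsGT one_pos) h1)
    linarith
  have h2 := quad_add_smul hs (y - x) (w - y) 1
  have h3 : 0 ≤ quad A (y - x) := by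
    have := hA.dotProduct_mulVec_nonneg (y - x).ofLp
    simpa [quad] using this
  have hneg : ∀ u v : Vec d, quad A (u - v) = quad A (v - u) := by
    intro u v
    rw [← neg_sub v u]
    simp only [quad, WithLp.ofLp_neg, Matrix.mulVec_neg, dotProduct_neg, neg_dotProduct, neg_neg]
  rw [hneg x w, hneg y w]
  rw [show y - x + (1 : ℝ) • (w - y) = w - x by rw [one_smul]; abel, ← hB] at h2
  nlinarith

theorem quad_one {d : ℕ} (v : Vec d) : quad 1 v = ‖v‖ ^ 2 := by
  rw [EuclideanSpace.real_norm_sq_eq]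
  simp [quad, dotProduct, sq]

theorem norm_proj_sub_sq_le {d : ℕ} {Ω : Set (Vec d)} (hc : IsCompact Ω) (hconv : Convex ℝ Ω)
    (x : Vec d) {w : Vec d} (hw : w ∈ Ω) : ‖proj Ω 1 x - w‖ ^ 2 ≤ ‖x - w‖ ^ 2 := by
  simpa only [quad_one] using quad_proj_sub_le hc hconv Matrix.PosSemidef.one x hw

/-! ### Online gradient descent and the online Newton step -/

/-- One projected gradient step. -/
theorem inner_le_of_proj_step {d : ℕ} {Ω : Set (Vec d)} (hc : IsCompact Ω) (hconv : Convex ℝ Ω)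
    {x v w : Vec d} {a : ℝ} (ha : 0 < a) (hw : w ∈ Ω) :
    inner ℝ v (x - w) ≤
      (‖x - w‖ ^ 2 - ‖proj Ω 1 (x - a • v) - w‖ ^ 2) / (2 * a) + a / 2 * ‖v‖ ^ 2 := by
  have h := norm_proj_sub_sq_le hc hconv (x - a • v) hw
  rw [show x - a • v - w = (x - w) - a • v by abel, norm_sub_sq_real (x - w), norm_smul, mul_pow,
    Real.norm_eq_abs, sq_abs, real_inner_smul_right, real_inner_comm] at h
  have h2 : (‖x - w‖ ^ 2 - ‖proj Ω 1 (x - a • v) - w‖ ^ 2) / (2 * a) + a / 2 * ‖v‖ ^ 2 =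
    (‖x - w‖ ^ 2 - ‖proj Ω 1 (x - a • v) - w‖ ^ 2 + a ^ 2 * ‖v‖ ^ 2) / (2 * a) := by
    field_simp
  rw [h2, le_div_iff₀ (by positivity)]
  linarith

/-- Online gradient descent with the step sizes `D / (G √τ)`. -/
theorem sum_inner_le_of_ogd {d : ℕ} {Ω : Set (Vec d)} (hc : IsCompact Ω) (hconv : Convex ℝ Ω)
    {D G : ℝ} (hD : 0 < D) (hG : 0 < G) {x v : ℕ → Vec d} {w : Vec d} (hw : w ∈ Ω) {n : ℕ}
    (hx : ∀ t < n, x (t + 1) = proj Ω 1 (x t - (D / (G * √(t + 1 : ℕ))) • v t))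
    (hd : ∀ t < n, ‖x t - w‖ ≤ D) (hv : ∀ t < n, ‖v t‖ ≤ G) :
    ∑ t ∈ Finset.range n, inner ℝ (v t) (x t - w) ≤ 3 / 2 * G * D * √n := by
  suffices h : ∀ m ≤ n, ∑ t ∈ Finset.range m, inner ℝ (v t) (x t - w) ≤
      G / (2 * D) * √m * (D ^ 2 - ‖x m - w‖ ^ 2) + G * D * √m by
    refine (h n le_rfl).trans ?_
    have : G / (2 * D) * √n * (D ^ 2 - ‖x n - w‖ ^ 2) ≤ G / (2 * D) * √n * D ^ 2 := by
      gcongr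
      linarith [sq_nonneg ‖x n - w‖]
    have h2 : G / (2 * D) * √n * D ^ 2 = 1 / 2 * G * D * √n := by field_simp
    linarith
  intro m
  induction m with
  | zero => simp
  | succ m ih =>
    intro hm
    have hm' : m < n := hm
    rw [Finset.sum_range_succ]
    have h1 := ih hm'.le
    set r := √(m : ℝ) with hr
    set s := √((m + 1 : ℕ) : ℝ) with hs
    have hs0 : 0 < s := by rw [hs]; positivity
    have hr0 : 0 ≤ r := Real.sqrt_nonneg _
    have hrs : r ≤ s := by
      apply Real.sqrt_le_sqrt; push_cast; linarith
    have hr2 : r ^ 2 = m := Real.sq_sqrt (by positivity)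
    have hs2 : s ^ 2 = m + 1 := by rw [hs, Real.sq_sqrt (by positivity)]; push_cast; rfl
    have h2 := inner_le_of_proj_step hc hconv (x := x m) (v := v m) (a := D / (G * s))
      (by positivity) hw
    rw [← hx m hm'] at h2
    have h3 : (‖x m - w‖ ^ 2 - ‖x (m + 1) - w‖ ^ 2) / (2 * (D / (G * s))) =
        G / (2 * D) * s * (‖x m - w‖ ^ 2 - ‖x (m + 1) - w‖ ^ 2) := by
      field_simp
    have h4 : D / (G * s) / 2 * ‖v m‖ ^ 2 ≤ G * D * (1 / (2 * s)) := by
      have : ‖v m‖ ^ 2 ≤ G ^ 2 := pow_le_pow_left₀ (norm_nonneg _) (hv m hm') 2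
      calc D / (G * s) / 2 * ‖v m‖ ^ 2 ≤ D / (G * s) / 2 * G ^ 2 := by gcongr
        _ = G * D * (1 / (2 * s)) := by field_simp
    have h5 : r + 1 / (2 * s) ≤ s := by
      rw [← le_sub_iff_add_le', div_le_iff₀ (by positivity)]
      nlinarith
    have h6 : G / (2 * D) * ((s - r) * (D ^ 2 - ‖x m - w‖ ^ 2)) ≥ 0 := by
      have : ‖x m - w‖ ^ 2 ≤ D ^ 2 := pow_le_pow_left₀ (norm_nonneg _) (hd m hm') 2
      have := mul_nonneg (sub_nonneg.2 hrs) (sub_nonneg.2 this)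
      positivity
    have h7 : G * D * (r + 1 / (2 * s)) ≤ G * D * s := by gcongr
    rw [h3] at h2
    nlinarith

theorem sum_inv_succ_le (n : ℕ) :
    ∑ t ∈ Finset.range n, 1 / ((t : ℝ) + 1) ≤ 1 + Real.log n := by
  have := harmonic_le_one_add_log n
  simpa [harmonic] using this

/-- Online gradient descent on `μ`-strongly convex losses, with the step sizes `1 / (μ τ)`. -/
theorem sum_inner_sub_sq_le_of_ogd {d : ℕ} {Ω : Set (Vec d)} (hc : IsCompact Ω)
    (hconv : Convex ℝ Ω) {μ N : ℝ} (hμ : 0 < μ) {x v : ℕ → Vec d} {w : Vec d} (hw : w ∈ Ω)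
    {n : ℕ}
    (hx : ∀ t < n, x (t + 1) = proj Ω 1 (x t - (1 / (μ * (t + 1 : ℕ))) • v t))
    (hv : ∀ t < n, ‖v t‖ ≤ N) :
    ∑ t ∈ Finset.range n, (inner ℝ (v t) (x t - w) - μ / 2 * ‖x t - w‖ ^ 2) ≤
      N ^ 2 / (2 * μ) * (1 + Real.log n) := by
  have h : ∀ m ≤ n, ∑ t ∈ Finset.range m, (inner ℝ (v t) (x t - w) - μ / 2 * ‖x t - w‖ ^ 2) ≤
      N ^ 2 / (2 * μ) * ∑ t ∈ Finset.range m, 1 / ((t : ℝ) + 1) - μ * m / 2 * ‖x m - w‖ ^ 2 := by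
    intro m
    induction m with
    | zero => simp
    | succ m ih =>
      intro hm
      have hm' : m < n := hm
      rw [Finset.sum_range_succ, Finset.sum_range_succ]
      have h1 := ih hm'.le
      have h2 := inner_le_of_proj_step hc hconv (x := x m) (v := v m)
        (a := 1 / (μ * (m + 1 : ℕ))) (by positivity) hw
      rw [← hx m hm'] at h2
      have h3 : (‖x m - w‖ ^ 2 - ‖x (m + 1) - w‖ ^ 2) / (2 * (1 / (μ * (m + 1 : ℕ)))) =
          μ * (m + 1) / 2 * (‖x m - w‖ ^ 2 - ‖x (m + 1) - w‖ ^ 2) := by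
        push_cast; field_simp
      have h4 : 1 / (μ * (m + 1 : ℕ)) / 2 * ‖v m‖ ^ 2 ≤ N ^ 2 / (2 * μ) * (1 / ((m : ℝ) + 1)) := by
        have : ‖v m‖ ^ 2 ≤ N ^ 2 := pow_le_pow_left₀ (norm_nonneg _) (hv m hm') 2
        calc 1 / (μ * (m + 1 : ℕ)) / 2 * ‖v m‖ ^ 2 ≤ 1 / (μ * (m + 1 : ℕ)) / 2 * N ^ 2 := by gcongr
          _ = _ := by push_cast; field_simp
      rw [h3] at h2
      rw [mul_add]
      push_cast
      linarith
  refine (h n le_rfl).trans ?_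
  have h1 : 0 ≤ μ * n / 2 * ‖x n - w‖ ^ 2 := by positivity
  have h2 := mul_le_mul_of_nonneg_left (sum_inv_succ_le n)
    (by positivity : 0 ≤ N ^ 2 / (2 * μ))
  linarith

theorem posDef_add_vecMulVec {d : ℕ} {A : Matrix (Fin d) (Fin d) ℝ} (hA : A.PosDef)
    (v : Fin d → ℝ) : (A + Matrix.vecMulVec v v).PosDef := by
  have := Matrix.posSemidef_vecMulVec_self_star v
  rw [star_trivial] at this
  exact hA.add_posSemidef this

/-- The elliptical potential: `vᵀ B⁻¹ v` is at most the growth of the log-determinant. -/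
theorem dotProduct_inv_mulVec_le {d : ℕ} {A : Matrix (Fin d) (Fin d) ℝ} (hA : A.PosDef)
    (v : Fin d → ℝ) :
    v ⬝ᵥ (A + Matrix.vecMulVec v v)⁻¹.mulVec v ≤
      Real.log (A + Matrix.vecMulVec v v).det - Real.log A.det := by
  set B := A + Matrix.vecMulVec v v with hB
  have hBp : B.PosDef := posDef_add_vecMulVec hA v
  have h1 : A.det = B.det * (1 - v ⬝ᵥ B⁻¹.mulVec v) := by
    have h2 := Matrix.det_add_replicateCol_mul_replicateRow (ι := Unit) (A := B)
      hBp.det_pos.ne'.isUnit (-v) v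
    rw [← Matrix.vecMulVec_eq, Matrix.neg_vecMulVec, hB, add_neg_cancel_right, ← hB] at h2
    rw [h2]
    congr 1
    rw [Matrix.det_unique, Matrix.add_apply, Matrix.one_apply_eq, ← Matrix.replicateRow_vecMul,
      Matrix.replicateRow_mul_replicateCol_apply, dotProduct_neg, ← Matrix.dotProduct_mulVec,
      sub_eq_add_neg]
  have h2 : 0 < 1 - v ⬝ᵥ B⁻¹.mulVec v := by
    have := hA.det_pos
    rw [h1] at this
    exact (pos_iff_pos_of_mul_pos this).1 hBp.det_pos
  rw [h1, Real.log_mul hBp.det_pos.ne' h2.ne']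
  linarith [Real.log_le_sub_one_of_pos h2]

/-- The determinant is at most that of the multiple of the identity with the same trace. -/
theorem log_det_le {d : ℕ} (hd : 0 < d) {A : Matrix (Fin d) (Fin d) ℝ} (hA : A.PosDef) :
    Real.log A.det ≤ d * Real.log (A.trace / d) := by
  have hd' : (0 : ℝ) < d := by exact_mod_cast hd
  have h1 : A.det = ∏ i, hA.isHermitian.eigenvalues i := by
    simpa using hA.isHermitian.det_eq_prod_eigenvalues
  have h2 : A.trace = ∑ i, hA.isHermitian.eigenvalues i := by
    simpa using hA.isHermitian.trace_eq_sum_eigenvalues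
  have hpos := hA.eigenvalues_pos
  have htr : 0 < A.trace := by
    rw [h2]
    have : Nonempty (Fin d) := ⟨⟨0, hd⟩⟩
    exact Finset.sum_pos (fun i _ => hpos i) Finset.univ_nonempty
  set a := A.trace / d with ha
  have ha0 : 0 < a := by positivity
  rw [h1, Real.log_prod (fun i _ => (hpos i).ne')]
  -- each logarithm is below its tangent at the average eigenvalue
  have h3 : ∀ i, Real.log (hA.isHermitian.eigenvalues i) ≤
      Real.log a + (hA.isHermitian.eigenvalues i / a - 1) := by
    intro i
    have := Real.log_le_sub_one_of_pos (div_pos (hpos i) ha0)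
    rw [Real.log_div (hpos i).ne' ha0.ne'] at this
    linarith
  refine (Finset.sum_le_sum fun i _ => h3 i).trans ?_
  rw [Finset.sum_add_distrib, Finset.sum_sub_distrib, ← Finset.sum_div, ← h2]
  have : A.trace / a = d := by rw [ha]; field_simp
  simp [this]

/-- One online Newton step. -/
theorem dotProduct_le_of_ons_step {d : ℕ} {Ω : Set (Vec d)} (hc : IsCompact Ω)
    (hconv : Convex ℝ Ω) {A : Matrix (Fin d) (Fin d) ℝ} (hA : A.PosDef) {β : ℝ} (hβ : 0 < β)
    {x v w : Vec d} (hw : w ∈ Ω) :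
    inner ℝ v (x - w) - β / 2 * inner ℝ v (x - w) ^ 2 ≤
      β / 2 * (quad A (x - w) -
        quad (A + Matrix.vecMulVec v.ofLp v.ofLp)
          (proj Ω (A + Matrix.vecMulVec v.ofLp v.ofLp) (x - (1 / β) •
            WithLp.toLp 2 ((A + Matrix.vecMulVec v.ofLp v.ofLp)⁻¹.mulVec v.ofLp)) - w)) +
      1 / (2 * β) * (Real.log (A + Matrix.vecMulVec v.ofLp v.ofLp).det - Real.log A.det) := by
  have hlog := dotProduct_inv_mulVec_le hA v.ofLp
  have hquad : quad (A + Matrix.vecMulVec v.ofLp v.ofLp) (x - w) =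
      quad A (x - w) + inner ℝ v (x - w) ^ 2 := by
    have h : inner ℝ v (x - w) = v.ofLp ⬝ᵥ (x - w).ofLp := by
      simp [PiLp.inner_apply, dotProduct, mul_comm]
    simp only [quad, Matrix.add_mulVec, dotProduct_add, Matrix.vecMulVec_mulVec, h,
      dotProduct_smul, dotProduct_comm (x - w).ofLp v.ofLp, MulOpposite.smul_eq_mul_unop,
      MulOpposite.unop_op, sq]
  have hBp := posDef_add_vecMulVec hA v.ofLp
  set B := A + Matrix.vecMulVec v.ofLp v.ofLp with hB
  set u : Vec d := WithLp.toLp 2 (B⁻¹.mulVec v.ofLp) with hu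
  have hBs : B.IsSymm := by
    have := hBp.isHermitian.eq
    rwa [Matrix.conjTranspose_eq_transpose_of_trivial] at this
  have hBu : B.mulVec u.ofLp = v.ofLp := by
    rw [hu, Matrix.mulVec_mulVec, Matrix.mul_nonsing_inv _ hBp.det_pos.ne'.isUnit,
      Matrix.one_mulVec]
  have hproj := quad_proj_sub_le hc hconv hBp.posSemidef (x - (1 / β) • u) hw
  have h1 : quad B (x - (1 / β) • u - w) = quad B (x - w) - 2 / β * inner ℝ v (x - w) +
      1 / β ^ 2 * (v.ofLp ⬝ᵥ B⁻¹.mulVec v.ofLp) := by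
    rw [show x - (1 / β) • u - w = (x - w) + (-(1 / β)) • u by rw [neg_smul]; abel,
      quad_add_smul hBs]
    have h2 : u.ofLp ⬝ᵥ B.mulVec (x - w).ofLp = inner ℝ v (x - w) := by
      rw [Matrix.dotProduct_mulVec, ← Matrix.mulVec_transpose, hBs.eq, hBu]
      simp [PiLp.inner_apply, dotProduct, mul_comm]
    have h3 : quad B u = v.ofLp ⬝ᵥ B⁻¹.mulVec v.ofLp := by
      rw [quad, hBu, dotProduct_comm]
    rw [h2, h3]
    field_simp
    ring
  rw [h1, hquad] at hproj
  have h4 : β / 2 * quad B (proj Ω B (x - (1 / β) • u) - w) ≤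
      β / 2 * (quad A (x - w) + inner ℝ v (x - w) ^ 2 - 2 / β * inner ℝ v (x - w) +
      1 / β ^ 2 * (v.ofLp ⬝ᵥ B⁻¹.mulVec v.ofLp)) := by gcongr
  have h5 : β / 2 * (quad A (x - w) + inner ℝ v (x - w) ^ 2 - 2 / β * inner ℝ v (x - w) +
      1 / β ^ 2 * (v.ofLp ⬝ᵥ B⁻¹.mulVec v.ofLp)) = β / 2 * quad A (x - w) +
      β / 2 * inner ℝ v (x - w) ^ 2 - inner ℝ v (x - w) +
      1 / (2 * β) * (v.ofLp ⬝ᵥ B⁻¹.mulVec v.ofLp) := by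
    field_simp
  have h6 : 1 / (2 * β) * (v.ofLp ⬝ᵥ B⁻¹.mulVec v.ofLp) ≤
      1 / (2 * β) * (Real.log B.det - Real.log A.det) := by gcongr
  linarith

/-- The online Newton step with the initial matrix `a I`. -/
theorem sum_inner_sub_sq_le_of_ons {d : ℕ} (hd : 0 < d) {Ω : Set (Vec d)} (hc : IsCompact Ω)
    (hconv : Convex ℝ Ω) {a β N : ℝ} (ha : 0 < a) (hβ : 0 < β) {x v : ℕ → Vec d}
    {A : ℕ → Matrix (Fin d) (Fin d) ℝ} {w : Vec d} (hw : w ∈ Ω) {n : ℕ}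
    (hA0 : A 0 = a • (1 : Matrix (Fin d) (Fin d) ℝ))
    (hA : ∀ t < n, A (t + 1) = A t + Matrix.vecMulVec (v t).ofLp (v t).ofLp)
    (hx : ∀ t < n, x (t + 1) = proj Ω (A (t + 1))
      (x t - (1 / β) • WithLp.toLp 2 ((A (t + 1))⁻¹.mulVec (v t).ofLp)))
    (hv : ∀ t < n, ‖v t‖ ≤ N) :
    ∑ t ∈ Finset.range n, (inner ℝ (v t) (x t - w) - β / 2 * inner ℝ (v t) (x t - w) ^ 2) ≤
      β / 2 * (a * ‖x 0 - w‖ ^ 2) + 1 / (2 * β) * (d * Real.log (1 + n * N ^ 2 / (a * d))) := by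
  have hd' : (0 : ℝ) < d := by exact_mod_cast hd
  have h : ∀ m ≤ n, (A m).PosDef ∧ (A m).trace ≤ d * a + m * N ^ 2 ∧
      ∑ t ∈ Finset.range m, (inner ℝ (v t) (x t - w) - β / 2 * inner ℝ (v t) (x t - w) ^ 2) ≤
      β / 2 * (quad (A 0) (x 0 - w) - quad (A m) (x m - w)) +
        1 / (2 * β) * (Real.log (A m).det - Real.log (A 0).det) := by
    intro m
    induction m with
    | zero =>
      intro _
      refine ⟨?_, ?_, by simp⟩
      · rw [hA0]; exact Matrix.PosDef.one.smul ha
      · rw [hA0]; simp [mul_comm]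
    | succ m ih =>
      intro hm
      have hm' : m < n := hm
      obtain ⟨hp, ht, hs⟩ := ih hm'.le
      refine ⟨?_, ?_, ?_⟩
      · rw [hA m hm']; exact posDef_add_vecMulVec hp _
      · rw [hA m hm', Matrix.trace_add]
        have h1 : (Matrix.vecMulVec (v m).ofLp (v m).ofLp).trace = ‖v m‖ ^ 2 := by
          rw [EuclideanSpace.real_norm_sq_eq]
          simp [Matrix.trace, Matrix.vecMulVec_apply, sq]
        have h2 : ‖v m‖ ^ 2 ≤ N ^ 2 := pow_le_pow_left₀ (norm_nonneg _) (hv m hm') 2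
        rw [h1]
        push_cast
        linarith
      · rw [Finset.sum_range_succ]
        have h1 := dotProduct_le_of_ons_step hc hconv hp hβ (x := x m) (v := v m) hw
        rw [← hA m hm', ← hx m hm'] at h1
        linarith
  obtain ⟨hp, ht, hs⟩ := h n le_rfl
  have h1 : 0 ≤ quad (A n) (x n - w) := by
    simpa [quad] using hp.posSemidef.dotProduct_mulVec_nonneg (x n - w).ofLp
  have h2 : quad (A 0) (x 0 - w) = a * ‖x 0 - w‖ ^ 2 := by
    rw [← quad_one, hA0]; simp [quad, Matrix.smul_mulVec]
  have h3 : Real.log (A 0).det = d * Real.log a := by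
    rw [hA0]; simp
  have h4 : Real.log (A n).det ≤ d * Real.log (a * (1 + n * N ^ 2 / (a * d))) := by
    refine (log_det_le hd hp).trans ?_
    have htr : 0 < (A n).trace := by
      have : Nonempty (Fin d) := ⟨⟨0, hd⟩⟩
      exact hp.trace_pos
    have : (A n).trace / d ≤ a * (1 + n * N ^ 2 / (a * d)) := by
      rw [div_le_iff₀ hd']
      refine ht.trans (le_of_eq ?_)
      field_simp
    gcongr
  rw [Real.log_mul ha.ne' (by positivity)] at h4
  have h5 : 1 / (2 * β) * (Real.log (A n).det - Real.log (A 0).det) ≤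
      1 / (2 * β) * (d * Real.log (1 + n * N ^ 2 / (a * d))) := by
    gcongr
    linarith
  have h6 : β / 2 * (quad (A 0) (x 0 - w) - quad (A n) (x n - w)) ≤
      β / 2 * (a * ‖x 0 - w‖ ^ 2) := by
    gcongr
    linarith
  linarith

/-! ### Maler -/

/-- The standing assumptions on the parameters of the algorithms. -/
structure Params.Admissible {d : ℕ} (P : Params d) : Prop where
  isClosed : IsClosed P.Ω
  convex : Convex ℝ P.Ω
  init_mem : P.x₁ ∈ P.Ω
  diam_le : ∀ x ∈ P.Ω, ∀ y ∈ P.Ω, ‖x - y‖ ≤ P.D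
  D_pos : 0 < P.D
  G_pos : 0 < P.G

theorem Params.Admissible.isCompact {d : ℕ} {P : Params d} (hP : P.Admissible) : IsCompact P.Ω :=
  isCompact_of_diam_le hP.isClosed hP.diam_le

theorem Params.Admissible.nonempty {d : ℕ} {P : Params d} (hP : P.Admissible) : P.Ω.Nonempty :=
  ⟨_, hP.init_mem⟩

theorem Params.Admissible.abs_inner_le {d : ℕ} {P : Params d} (hP : P.Admissible) {g x y : Vec d}
    (hg : ‖g‖ ≤ P.G) (hx : x ∈ P.Ω) (hy : y ∈ P.Ω) : |inner ℝ g (x - y)| ≤ P.G * P.D :=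
  (abs_real_inner_le_norm _ _).trans
    (mul_le_mul hg (hP.diam_le x hx y hy) (norm_nonneg _) hP.G_pos.le)

theorem eta_pos {d : ℕ} {P : Params d} (hP : P.Admissible) (i : ℕ) : 0 < eta P i := by
  have := hP.D_pos
  have := hP.G_pos
  unfold eta
  positivity

theorem eta_mul_le {d : ℕ} {P : Params d} (hP : P.Admissible) (i : ℕ) :
    eta P i * (P.G * P.D) ≤ 1 / 5 := by
  have h1 := hP.D_pos
  have h2 := hP.G_pos
  have h3 : (1 : ℝ) ≤ 2 ^ i := one_le_pow₀ (by norm_num)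
  rw [eta, div_mul_eq_mul_div, div_le_iff₀ (by positivity)]
  nlinarith [mul_pos h1 h2]

theorem etaC_pos {d : ℕ} {P : Params d} (hP : P.Admissible) {n : ℕ} (hn : 1 ≤ n) :
    0 < etaC P n := by
  have := hP.D_pos
  have := hP.G_pos
  unfold etaC
  positivity

theorem etaC_mul_eq {d : ℕ} {P : Params d} (hP : P.Admissible) {n : ℕ} (hn : 1 ≤ n) :
    etaC P n * P.G * P.D = 1 / (2 * √n) := by
  have := hP.D_pos
  have := hP.G_pos
  unfold etaC
  field_simp

/-- What every state of Maler satisfies: the points of the experts are feasible and the weights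
form a probability distribution with full support. -/
structure MalerState.Valid {d : ℕ} (P : Params d) (n : ℕ) (S : MalerState d) : Prop where
  ptC_mem : S.ptC ∈ P.Ω
  ptS_mem : ∀ i, S.ptS i ∈ P.Ω
  ptL_mem : ∀ i, S.ptL i ∈ P.Ω
  wtC_pos : 0 < S.wtC
  wtS_pos : ∀ i, 0 < S.wtS i
  wtL_pos : ∀ i, 0 < S.wtL i
  sum_eq : S.wtC + ∑ i ∈ Finset.range (malerK n + 1), (S.wtS i + S.wtL i) = 1

/-- Weighted averages of points of a convex set can be accumulated term by term. -/
theorem inv_smul_add_mem {d : ℕ} {Ω : Set (Vec d)} (hΩ : Convex ℝ Ω) {r s : ℝ} {u v : Vec d}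
    (hr : 0 < r) (hs : 0 < s) (hu : r⁻¹ • u ∈ Ω) (hv : s⁻¹ • v ∈ Ω) :
    (r + s)⁻¹ • (u + v) ∈ Ω := by
  have := hΩ hu hv (a := r / (r + s)) (b := s / (r + s)) (by positivity) (by positivity)
    (by field_simp)
  convert this using 1
  rw [smul_smul, smul_smul, smul_add]
  congr 2 <;> field_simp

theorem malerPlay_mem {d : ℕ} {P : Params d} (hP : P.Admissible) {n : ℕ} (hn : 1 ≤ n)
    {S : MalerState d} (hS : S.Valid P n) : malerPlay P n S ∈ P.Ω := by
  have hc := mul_pos hS.wtC_pos (etaC_pos hP hn)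
  have hpos : ∀ i, 0 < S.wtS i * eta P i + S.wtL i * eta P i := fun i =>
    add_pos (mul_pos (hS.wtS_pos i) (eta_pos hP i)) (mul_pos (hS.wtL_pos i) (eta_pos hP i))
  have hmem : ∀ {r : ℝ} {u : Vec d}, 0 < r → u ∈ P.Ω → r⁻¹ • r • u ∈ P.Ω := by
    intro r u hr hu
    rwa [inv_smul_smul₀ hr.ne']
  unfold malerPlay
  induction malerK n + 1 with
  | zero => simpa using hmem hc hS.ptC_mem
  | succ m ih =>
    rw [Finset.sum_range_succ, Finset.sum_range_succ, ← add_assoc (S.wtC * etaC P n),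
      ← add_assoc ((S.wtC * etaC P n) • S.ptC)]
    refine inv_smul_add_mem hP.convex ?_ (hpos m) ih ?_
    · exact add_pos_of_pos_of_nonneg hc (Finset.sum_nonneg fun i _ => (hpos i).le)
    · exact inv_smul_add_mem hP.convex (mul_pos (hS.wtS_pos m) (eta_pos hP m))
        (mul_pos (hS.wtL_pos m) (eta_pos hP m))
        (hmem (mul_pos (hS.wtS_pos m) (eta_pos hP m)) (hS.ptS_mem m))
        (hmem (mul_pos (hS.wtL_pos m) (eta_pos hP m)) (hS.ptL_mem m))

theorem malerPhi_pos {d : ℕ} {P : Params d} {n : ℕ} {S : MalerState d} (hS : S.Valid P n)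
    (g : Vec d) : 0 < malerPhi P n S g := by
  refine add_pos_of_pos_of_nonneg (mul_pos hS.wtC_pos (Real.exp_pos _))
    (Finset.sum_nonneg fun i _ => ?_)
  exact add_nonneg (mul_nonneg (hS.wtS_pos i).le (Real.exp_pos _).le)
    (mul_nonneg (hS.wtL_pos i).le (Real.exp_pos _).le)

/-- Maler plays the point at which the linear parts of the surrogate losses average to zero. -/
theorem malerPlay_balance {d : ℕ} {P : Params d} (hP : P.Admissible) {n : ℕ} (hn : 1 ≤ n)
    {S : MalerState d} (hS : S.Valid P n) (g : Vec d) :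
    S.wtC * (etaC P n * inner ℝ g (malerPlay P n S - S.ptC)) +
      ∑ i ∈ Finset.range (malerK n + 1),
        (S.wtS i * (eta P i * inner ℝ g (malerPlay P n S - S.ptS i)) +
          S.wtL i * (eta P i * inner ℝ g (malerPlay P n S - S.ptL i))) = 0 := by
  have hc := mul_pos hS.wtC_pos (etaC_pos hP hn)
  have hpos : ∀ i, 0 < S.wtS i * eta P i + S.wtL i * eta P i := fun i =>
    add_pos (mul_pos (hS.wtS_pos i) (eta_pos hP i)) (mul_pos (hS.wtL_pos i) (eta_pos hP i))
  set W := S.wtC * etaC P n +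
    ∑ i ∈ Finset.range (malerK n + 1), (S.wtS i * eta P i + S.wtL i * eta P i) with hW
  have hW0 : 0 < W := add_pos_of_pos_of_nonneg hc (Finset.sum_nonneg fun i _ => (hpos i).le)
  have h1 : W • malerPlay P n S = (S.wtC * etaC P n) • S.ptC +
      ∑ i ∈ Finset.range (malerK n + 1),
        ((S.wtS i * eta P i) • S.ptS i + (S.wtL i * eta P i) • S.ptL i) := by
    rw [malerPlay, smul_inv_smul₀ hW0.ne']
  have h2 := congrArg (fun v => inner ℝ g v) h1
  simp only [inner_add_right, inner_sum, real_inner_smul_right] at h2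
  rw [hW, add_mul, Finset.sum_mul] at h2
  simp only [inner_sub_right]
  rw [← sub_eq_zero] at h2
  rw [← h2, add_sub_add_comm, ← Finset.sum_sub_distrib]
  congr 1
  · ring
  · exact Finset.sum_congr rfl fun i _ => by ring

/-- The weights multiplied by the exponentials of the surrogate losses do not gain mass, because
`exp (z - z²) ≤ 1 + z` and the linear parts cancel. -/
theorem malerPhi_le_one {d : ℕ} {P : Params d} (hP : P.Admissible) {n : ℕ} (hn : 1 ≤ n)
    {S : MalerState d} (hS : S.Valid P n) {g : Vec d} (hg : ‖g‖ ≤ P.G) :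
    malerPhi P n S g ≤ 1 := by
  have hx := malerPlay_mem hP hn hS
  set x := malerPlay P n S with hxdef
  have hG := hP.G_pos
  have hD := hP.D_pos
  have hC : Real.exp (-lossC P n x g S.ptC) ≤ 1 + etaC P n * inner ℝ g (x - S.ptC) := by
    have h1 := hP.abs_inner_le hg hx hS.ptC_mem
    have h2 : |etaC P n * inner ℝ g (x - S.ptC)| ≤ etaC P n * P.G * P.D := by
      rw [abs_mul, abs_of_pos (etaC_pos hP hn), mul_assoc]
      exact mul_le_mul_of_nonneg_left h1 (etaC_pos hP hn).le
    have h3 : etaC P n * P.G * P.D ≤ 1 / 2 := by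
      rw [etaC_mul_eq hP hn]
      have : 1 ≤ √(n : ℝ) := Real.one_le_sqrt.2 (by exact_mod_cast hn)
      rw [div_le_div_iff₀ (by positivity) (by norm_num)]
      linarith
    have h4 := exp_sub_sq_le (z := etaC P n * inner ℝ g (x - S.ptC))
      (y := (etaC P n * P.G * P.D) ^ 2) (by linarith [(abs_le.1 (h2.trans h3)).1])
      (sq_le_sq' (abs_le.1 h2).1 (abs_le.1 h2).2)
    refine le_trans (le_of_eq ?_) h4
    rw [lossC]; ring_nf
  have hz : ∀ i, ∀ y ∈ P.Ω, -(1 / 2) ≤ eta P i * inner ℝ g (x - y) := by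
    intro i y hy
    have h1 := hP.abs_inner_le hg hx hy
    have h2 : |eta P i * inner ℝ g (x - y)| ≤ eta P i * (P.G * P.D) := by
      rw [abs_mul, abs_of_pos (eta_pos hP i)]
      exact mul_le_mul_of_nonneg_left h1 (eta_pos hP i).le
    have := (abs_le.1 (h2.trans (eta_mul_le hP i))).1
    linarith
  have hSs : ∀ i, Real.exp (-lossS P (eta P i) x g (S.ptS i)) ≤
      1 + eta P i * inner ℝ g (x - S.ptS i) := by
    intro i
    have h1 : inner ℝ g (x - S.ptS i) ^ 2 ≤ P.G ^ 2 * ‖x - S.ptS i‖ ^ 2 := by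
      rw [← mul_pow, ← sq_abs]
      exact pow_le_pow_left₀ (abs_nonneg _) ((abs_real_inner_le_norm _ _).trans
        (mul_le_mul_of_nonneg_right hg (norm_nonneg _))) 2
    have h4 := exp_sub_sq_le (y := eta P i ^ 2 * P.G ^ 2 * ‖x - S.ptS i‖ ^ 2)
      (hz i _ (hS.ptS_mem i)) (by
        rw [mul_pow, mul_assoc]; exact mul_le_mul_of_nonneg_left h1 (sq_nonneg _))
    refine le_trans (le_of_eq ?_) h4
    rw [lossS]; ring_nf
  have hLl : ∀ i, Real.exp (-lossL (eta P i) x g (S.ptL i)) ≤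
      1 + eta P i * inner ℝ g (x - S.ptL i) := by
    intro i
    have h4 := exp_sub_sq_le (hz i _ (hS.ptL_mem i)) le_rfl
    refine le_trans (le_of_eq ?_) h4
    rw [lossL]; ring_nf
  have hbal := malerPlay_balance hP hn hS g
  rw [← hxdef] at hbal
  calc malerPhi P n S g ≤ S.wtC * (1 + etaC P n * inner ℝ g (x - S.ptC)) +
      ∑ i ∈ Finset.range (malerK n + 1),
        (S.wtS i * (1 + eta P i * inner ℝ g (x - S.ptS i)) +
          S.wtL i * (1 + eta P i * inner ℝ g (x - S.ptL i))) := by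
        unfold malerPhi
        rw [← hxdef]
        have := hS.wtC_pos
        have h1 := fun i => hS.wtS_pos i
        have h2 := fun i => hS.wtL_pos i
        gcongr with i hi i hi
        · exact (h1 i).le
        · exact hSs i
        · exact (h2 i).le
        · exact hLl i
    _ = (S.wtC + ∑ i ∈ Finset.range (malerK n + 1), (S.wtS i + S.wtL i)) + 0 := by
        rw [← hbal, add_add_add_comm, ← Finset.sum_add_distrib]
        congr 1
        · ring
        · exact Finset.sum_congr rfl fun i _ => by ring
    _ = 1 := by rw [hS.sum_eq, add_zero]

theorem sum_malerPrior (n : ℕ) : ∑ i ∈ Finset.range (malerK n + 1), malerPrior n i = 1 / 3 := by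
  unfold malerPrior
  have h : ∀ (a : ℝ) (m : ℕ), ∑ i ∈ Finset.range m, a / (3 * ((i : ℝ) + 1) * ((i : ℝ) + 2)) =
      a / 3 * (m / (m + 1)) := by
    intro a m
    induction m with
    | zero => simp
    | succ m ih =>
      rw [Finset.sum_range_succ, ih]
      push_cast
      field_simp
      ring
  rw [h]
  push_cast
  field_simp
  ring

theorem malerPrior_pos (n i : ℕ) : 0 < malerPrior n i := by
  unfold malerPrior; positivity

/-- The prior of every expert is at least `1 / (3 (K + 1)²)`. -/
theorem neg_log_malerPrior_le {n i : ℕ} (hi : i ≤ malerK n) :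
    -Real.log (malerPrior n i) ≤ 2 * Real.log (√3 * (malerK n + 1)) := by
  have hi' : (i : ℝ) ≤ malerK n := by exact_mod_cast hi
  set K : ℝ := (malerK n : ℝ) with hK
  have hK0 : 0 ≤ K := by positivity
  have h1 : 2 * Real.log (√3 * (K + 1)) = Real.log (3 * (K + 1) ^ 2) := by
    rw [← Nat.cast_ofNat, ← Real.log_pow, mul_pow]
    norm_num
  rw [h1, ← Real.log_inv]
  apply Real.log_le_log (inv_pos.2 (malerPrior_pos n i))
  rw [malerPrior, ← hK, inv_div, div_le_iff₀ (by positivity)]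
  have h2 : 3 * (K + 1) ^ 2 * (1 + 1 / (1 + K)) = 3 * (K + 1) * (K + 2) := by
    field_simp
    ring
  rw [h2]
  gcongr

theorem malerInit_valid {d : ℕ} {P : Params d} (hP : P.Admissible) (n : ℕ) :
    (malerInit P n).Valid P n where
  ptC_mem := hP.init_mem
  ptS_mem _ := hP.init_mem
  ptL_mem _ := hP.init_mem
  wtC_pos := by simp [malerInit]
  wtS_pos i := malerPrior_pos n i
  wtL_pos i := malerPrior_pos n i
  sum_eq := by
    simp only [malerInit, Finset.sum_add_distrib, sum_malerPrior]
    norm_num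

theorem malerStep_valid {d : ℕ} {P : Params d} (hP : P.Admissible) {n : ℕ} {S : MalerState d}
    (hS : S.Valid P n) (g : Vec d) : (malerStep P n S g).Valid P n where
  ptC_mem := proj_mem hP.isCompact hP.nonempty _ _
  ptS_mem _ := proj_mem hP.isCompact hP.nonempty _ _
  ptL_mem _ := proj_mem hP.isCompact hP.nonempty _ _
  wtC_pos := div_pos (mul_pos hS.wtC_pos (Real.exp_pos _)) (malerPhi_pos hS g)
  wtS_pos i := div_pos (mul_pos (hS.wtS_pos i) (Real.exp_pos _)) (malerPhi_pos hS g)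
  wtL_pos i := div_pos (mul_pos (hS.wtL_pos i) (Real.exp_pos _)) (malerPhi_pos hS g)
  sum_eq := by
    simp only [malerStep, ← add_div, ← Finset.sum_div]
    exact div_self (malerPhi_pos hS g).ne'

/-- The run of Maler with horizon `n` in which round `t` (counted from `0`) reveals the gradient
`gr t` at the point played. -/
noncomputable def malerRun {d : ℕ} (P : Params d) (n : ℕ) (gr : ℕ → Vec d → Vec d) :
    ℕ → MalerState d
  | 0 => malerInit P n
  | t + 1 => malerStep P n (malerRun P n gr t) (gr t (malerPlay P n (malerRun P n gr t)))

/-- The point played in round `t` of a run. -/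
noncomputable def malerPt {d : ℕ} (P : Params d) (n : ℕ) (gr : ℕ → Vec d → Vec d) (t : ℕ) :
    Vec d := malerPlay P n (malerRun P n gr t)

/-- The gradient observed in round `t` of a run. -/
noncomputable def malerGrad {d : ℕ} (P : Params d) (n : ℕ) (gr : ℕ → Vec d → Vec d) (t : ℕ) :
    Vec d := gr t (malerPt P n gr t)

theorem malerRun_succ {d : ℕ} (P : Params d) (n : ℕ) (gr : ℕ → Vec d → Vec d) (t : ℕ) :
    malerRun P n gr (t + 1) = malerStep P n (malerRun P n gr t) (malerGrad P n gr t) := rfl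

theorem malerRun_valid {d : ℕ} {P : Params d} (hP : P.Admissible) (n : ℕ)
    (gr : ℕ → Vec d → Vec d) (t : ℕ) : (malerRun P n gr t).Valid P n := by
  induction t with
  | zero => exact malerInit_valid hP n
  | succ t ih => exact malerStep_valid hP ih _

theorem malerRun_round {d : ℕ} (P : Params d) (n : ℕ) (gr : ℕ → Vec d → Vec d) (t : ℕ) :
    (malerRun P n gr t).round = t + 1 := by
  induction t with
  | zero => rfl
  | succ t ih => rw [malerRun_succ, malerStep, ih]

theorem malerPt_mem {d : ℕ} {P : Params d} (hP : P.Admissible) {n : ℕ} (hn : 1 ≤ n)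
    (gr : ℕ → Vec d → Vec d) (t : ℕ) : malerPt P n gr t ∈ P.Ω :=
  malerPlay_mem hP hn (malerRun_valid hP n gr t)

theorem norm_malerGrad_le {d : ℕ} {P : Params d} (hP : P.Admissible) {n : ℕ} (hn : 1 ≤ n)
    {gr : ℕ → Vec d → Vec d} {t : ℕ} (hgr : ∀ x ∈ P.Ω, ‖gr t x‖ ≤ P.G) :
    ‖malerGrad P n gr t‖ ≤ P.G :=
  hgr _ (malerPt_mem hP hn gr t)

/-- If a weight is multiplied by `exp (-loss)` and normalized, where normalizing never decreases
it and it never exceeds one, then the total loss is at least the logarithm of the prior weight. -/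
theorem neg_sum_loss_le {wt loss Φ : ℕ → ℝ} {n : ℕ} (h0 : 0 < wt 0)
    (hs : ∀ t < n, wt (t + 1) = wt t * Real.exp (-loss t) / Φ t)
    (hΦ : ∀ t < n, 0 < Φ t ∧ Φ t ≤ 1) (h1 : wt n ≤ 1) :
    -∑ t ∈ Finset.range n, loss t ≤ -Real.log (wt 0) := by
  have h : ∀ m ≤ n, 0 < wt m ∧
      Real.log (wt 0) - ∑ t ∈ Finset.range m, loss t ≤ Real.log (wt m) := by
    intro m
    induction m with
    | zero => simp [h0]
    | succ m ih =>
      intro hm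
      have hm' : m < n := hm
      obtain ⟨hp, hl⟩ := ih hm'.le
      obtain ⟨hΦ0, hΦ1⟩ := hΦ m hm'
      rw [hs m hm', Finset.sum_range_succ]
      refine ⟨by positivity, ?_⟩
      rw [Real.log_div (by positivity) hΦ0.ne', Real.log_mul hp.ne' (Real.exp_pos _).ne',
        Real.log_exp]
      have := Real.log_nonpos hΦ0.le hΦ1
      linarith
  obtain ⟨hp, hl⟩ := h n le_rfl
  have := Real.log_nonpos hp.le h1
  linarith

theorem MalerState.Valid.wtC_le_one {d : ℕ} {P : Params d} {n : ℕ} {S : MalerState d}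
    (hS : S.Valid P n) : S.wtC ≤ 1 := by
  rw [← hS.sum_eq]
  exact le_add_of_nonneg_right (Finset.sum_nonneg fun i _ =>
    add_nonneg (hS.wtS_pos i).le (hS.wtL_pos i).le)

theorem MalerState.Valid.wt_add_wt_le_one {d : ℕ} {P : Params d} {n : ℕ} {S : MalerState d}
    (hS : S.Valid P n) {i : ℕ} (hi : i ≤ malerK n) : S.wtS i + S.wtL i ≤ 1 := by
  rw [← hS.sum_eq]
  have h := Finset.single_le_sum (f := fun i => S.wtS i + S.wtL i)
    (fun i _ => add_nonneg (hS.wtS_pos i).le (hS.wtL_pos i).le)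
    (Finset.mem_range.2 (Nat.lt_succ_of_le hi))
  have := hS.wtC_pos
  linarith

section Regret

variable {d : ℕ} {P : Params d} {n : ℕ} {gr : ℕ → Vec d → Vec d}

theorem malerPhi_run_mem (hP : P.Admissible) (hn : 1 ≤ n)
    (hgr : ∀ t < n, ∀ x ∈ P.Ω, ‖gr t x‖ ≤ P.G) (t : ℕ) (ht : t < n) :
    0 < malerPhi P n (malerRun P n gr t) (malerGrad P n gr t) ∧
      malerPhi P n (malerRun P n gr t) (malerGrad P n gr t) ≤ 1 :=
  ⟨malerPhi_pos (malerRun_valid hP n gr t) _, malerPhi_le_one hP hn (malerRun_valid hP n gr t)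
    (norm_malerGrad_le hP hn (hgr t ht))⟩

/-- The regret of Maler for convex losses. -/
theorem maler_convex_regret_le (hP : P.Admissible) (hn : 1 ≤ n)
    (hgr : ∀ t < n, ∀ x ∈ P.Ω, ‖gr t x‖ ≤ P.G) {w : Vec d} (hw : w ∈ P.Ω) :
    ∑ t ∈ Finset.range n, inner ℝ (malerGrad P n gr t) (malerPt P n gr t - w) ≤
      P.G * P.D * √n * (2 * Real.log 3 + 2) := by
  have hG := hP.G_pos
  have hD := hP.D_pos
  set x := malerPt P n gr
  set g := malerGrad P n gr
  set pt : ℕ → Vec d := fun t => (malerRun P n gr t).ptC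
  have hη := etaC_pos hP hn
  have hn0 : 0 < √(n : ℝ) := Real.sqrt_pos.2 (by exact_mod_cast hn)
  have h1 := neg_sum_loss_le (wt := fun t => (malerRun P n gr t).wtC)
    (loss := fun t => lossC P n (x t) (g t) (pt t))
    (Φ := fun t => malerPhi P n (malerRun P n gr t) (g t)) (n := n)
    (malerRun_valid hP n gr 0).wtC_pos (fun t _ => rfl) (malerPhi_run_mem hP hn hgr)
    (malerRun_valid hP n gr n).wtC_le_one
  have h2 := sum_inner_le_of_ogd hP.isCompact hP.convex hD hG (x := pt) (v := g) hw (n := n)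
    (fun t _ => by
      change proj P.Ω 1 ((malerRun P n gr t).ptC - (P.D / (etaC P n * P.G *
        √((malerRun P n gr t).round : ℝ))) • (etaC P n • g t)) = _
      rw [malerRun_round, smul_smul]
      congr 3
      field_simp)
    (fun t _ => hP.diam_le _ (malerRun_valid hP n gr t).ptC_mem _ hw)
    (fun t ht => norm_malerGrad_le hP hn (hgr t ht))
  have h3 : -∑ t ∈ Finset.range n, lossC P n (x t) (g t) (pt t) =
      etaC P n * ∑ t ∈ Finset.range n, inner ℝ (g t) (x t - pt t) - 1 / 4 := by
    have : (etaC P n * P.G * P.D) ^ 2 = 1 / (4 * n) := by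
      rw [etaC_mul_eq hP hn, div_pow, mul_pow, Real.sq_sqrt (by positivity)]; norm_num
    simp only [lossC, this, Finset.sum_add_distrib, neg_mul, Finset.sum_neg_distrib,
      ← Finset.mul_sum, Finset.sum_const, Finset.card_range, nsmul_eq_mul]
    have : (n : ℝ) * (1 / (4 * n)) = 1 / 4 := by field_simp
    linarith
  have h4 : -Real.log (malerRun P n gr 0).wtC = Real.log 3 := by
    simp [malerRun, malerInit]
  rw [h3, h4] at h1
  have h5 : ∑ t ∈ Finset.range n, inner ℝ (g t) (x t - pt t) ≤
      P.G * P.D * √n * (2 * Real.log 3 + 1 / 2) := by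
    have h6 : etaC P n * (P.G * P.D * √n * (2 * Real.log 3 + 1 / 2)) = Real.log 3 + 1 / 4 := by
      unfold etaC; field_simp; ring
    have : etaC P n * ∑ t ∈ Finset.range n, inner ℝ (g t) (x t - pt t) ≤
        etaC P n * (P.G * P.D * √n * (2 * Real.log 3 + 1 / 2)) := by linarith
    exact le_of_mul_le_mul_left this hη
  have h6 : ∑ t ∈ Finset.range n, inner ℝ (g t) (x t - w) =
      ∑ t ∈ Finset.range n, inner ℝ (g t) (x t - pt t) +
        ∑ t ∈ Finset.range n, inner ℝ (g t) (pt t - w) := by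
    rw [← Finset.sum_add_distrib]
    refine Finset.sum_congr rfl fun t _ => ?_
    rw [← inner_add_right, sub_add_sub_cancel]
  rw [h6]
  linarith

/-- The expert "s" number `i`, as a bound on the regret of Maler. -/
theorem maler_regret_le_eta_norm (hP : P.Admissible) (hn : 1 ≤ n)
    (hgr : ∀ t < n, ∀ x ∈ P.Ω, ‖gr t x‖ ≤ P.G) {w : Vec d} (hw : w ∈ P.Ω) {i : ℕ}
    (hi : i ≤ malerK n) :
    ∑ t ∈ Finset.range n, inner ℝ (malerGrad P n gr t) (malerPt P n gr t - w) ≤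
      eta P i * (P.G ^ 2 * ∑ t ∈ Finset.range n, ‖malerPt P n gr t - w‖ ^ 2) +
        (2 * Real.log (√3 * (malerK n + 1)) + 1 / 2 * (1 + Real.log n)) / eta P i := by
  have hG := hP.G_pos
  have hD := hP.D_pos
  set x := malerPt P n gr
  set g := malerGrad P n gr
  set pt : ℕ → Vec d := fun t => (malerRun P n gr t).ptS i
  set h := eta P i
  have hη : 0 < h := eta_pos hP i
  have hηGD : h * (P.G * P.D) ≤ 1 / 5 := eta_mul_le hP i
  -- the weight of the expert bounds its total surrogate loss from below
  have hval := fun t => malerRun_valid hP n gr t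
  have h1 := neg_sum_loss_le (wt := fun t => (malerRun P n gr t).wtS i)
    (loss := fun t => lossS P h (x t) (g t) (pt t))
    (Φ := fun t => malerPhi P n (malerRun P n gr t) (g t)) (n := n)
    ((hval 0).wtS_pos i) (fun t _ => rfl) (malerPhi_run_mem hP hn hgr)
    (by linarith [(hval n).wt_add_wt_le_one hi, (hval n).wtL_pos i])
  have hv : ∀ t < n, ‖gradS P h (x t) (g t) (pt t)‖ ≤ 7 / 5 * (h * P.G) := by
    intro t ht
    have hg := norm_malerGrad_le hP hn (hgr t ht)
    have hd := hP.diam_le _ ((hval t).ptS_mem i) _ (malerPt_mem hP hn gr t)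
    calc ‖gradS P h (x t) (g t) (pt t)‖
        ≤ ‖h • g t‖ + ‖(2 * h ^ 2 * P.G ^ 2) • (pt t - x t)‖ := norm_add_le _ _
      _ = h * ‖g t‖ + 2 * h ^ 2 * P.G ^ 2 * ‖pt t - x t‖ := by
          rw [norm_smul, norm_smul, Real.norm_of_nonneg hη.le, Real.norm_of_nonneg (by positivity)]
      _ ≤ h * P.G + 2 * h ^ 2 * P.G ^ 2 * P.D := by gcongr
      _ = h * P.G + 2 * (h * P.G) * (h * (P.G * P.D)) := by ring
      _ ≤ h * P.G + 2 * (h * P.G) * (1 / 5) := by gcongr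
      _ = _ := by ring
  have h2 := sum_inner_sub_sq_le_of_ogd hP.isCompact hP.convex (μ := 2 * h ^ 2 * P.G ^ 2)
    (by positivity) (x := pt) (v := fun t => gradS P h (x t) (g t) (pt t)) hw
    (fun t _ => by
      change proj P.Ω 1 ((malerRun P n gr t).ptS i - (1 / (2 * eta P i ^ 2 * P.G ^ 2 *
        (malerRun P n gr t).round)) • gradS P h (x t) (g t) (pt t)) = _
      rw [malerRun_round])
    hv
  have h3 : ∀ t, inner ℝ (gradS P h (x t) (g t) (pt t)) (pt t - w) -
      2 * h ^ 2 * P.G ^ 2 / 2 * ‖pt t - w‖ ^ 2 =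
      lossS P h (x t) (g t) (pt t) + h * inner ℝ (g t) (x t - w) -
        h ^ 2 * P.G ^ 2 * ‖x t - w‖ ^ 2 := by
    intro t
    have e1 : ‖x t - w‖ ^ 2 = ‖x t - pt t‖ ^ 2 + 2 * inner ℝ (x t - pt t) (pt t - w) +
        ‖pt t - w‖ ^ 2 := by
      rw [← norm_add_sq_real, sub_add_sub_cancel]
    have e2 : inner ℝ (g t) (x t - w) = inner ℝ (g t) (x t - pt t) + inner ℝ (g t) (pt t - w) := by
      rw [← inner_add_right, sub_add_sub_cancel]
    rw [gradS, lossS, inner_add_left, real_inner_smul_left, real_inner_smul_left, e1, e2,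
      ← neg_sub (x t) (pt t), inner_neg_left]
    ring
  simp only [h3] at h2
  rw [Finset.sum_sub_distrib, Finset.sum_add_distrib, ← Finset.mul_sum, ← Finset.mul_sum] at h2
  have h4 : (7 / 5 * (h * P.G)) ^ 2 / (2 * (2 * h ^ 2 * P.G ^ 2)) = 49 / 100 := by
    field_simp; norm_num
  rw [h4] at h2
  have h5 : -Real.log ((malerRun P n gr 0).wtS i) ≤ 2 * Real.log (√3 * (malerK n + 1)) :=
    neg_log_malerPrior_le hi
  have h6 : 0 ≤ Real.log n := Real.log_natCast_nonneg n
  rw [← sub_le_iff_le_add', le_div_iff₀ hη]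
  linarith

theorem onsBeta_eq (hP : P.Admissible) : onsBeta P = 25 / 56 := by
  have hD := hP.D_pos
  have : 1 / (4 * (7 / (25 * P.D)) * P.D) = 25 / 28 := by field_simp; norm_num
  rw [onsBeta, this]
  norm_num

/-- The expert "l" number `i`, as a bound on the regret of Maler. -/
theorem maler_regret_le_eta_inner (hd : 0 < d) (hP : P.Admissible) (hn : 1 ≤ n)
    (hgr : ∀ t < n, ∀ x ∈ P.Ω, ‖gr t x‖ ≤ P.G) {w : Vec d} (hw : w ∈ P.Ω) {i : ℕ}
    (hi : i ≤ malerK n) :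
    ∑ t ∈ Finset.range n, inner ℝ (malerGrad P n gr t) (malerPt P n gr t - w) ≤
      eta P i * (∑ t ∈ Finset.range n, inner ℝ (malerGrad P n gr t) (malerPt P n gr t - w) ^ 2) +
        (2 * Real.log (√3 * (malerK n + 1)) +
          28 / 25 * (1 + d * Real.log (1 + n / (64 * d)))) / eta P i := by
  have hG := hP.G_pos
  have hD := hP.D_pos
  have hd' : (0 : ℝ) < d := by exact_mod_cast hd
  set x := malerPt P n gr
  set g := malerGrad P n gr
  set pt : ℕ → Vec d := fun t => (malerRun P n gr t).ptL i
  set h := eta P i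
  have hη : 0 < h := eta_pos hP i
  have hηGD : h * (P.G * P.D) ≤ 1 / 5 := eta_mul_le hP i
  have hval := fun t => malerRun_valid hP n gr t
  have h1 := neg_sum_loss_le (wt := fun t => (malerRun P n gr t).wtL i)
    (loss := fun t => lossL h (x t) (g t) (pt t))
    (Φ := fun t => malerPhi P n (malerRun P n gr t) (g t)) (n := n)
    ((hval 0).wtL_pos i) (fun t _ => rfl) (malerPhi_run_mem hP hn hgr)
    (by linarith [(hval n).wt_add_wt_le_one hi, (hval n).wtS_pos i])
  have habs : ∀ t < n, |1 + 2 * h * inner ℝ (g t) (pt t - x t)| ≤ 7 / 5 := by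
    intro t ht
    have h2 := abs_le.1 (hP.abs_inner_le (norm_malerGrad_le hP hn (hgr t ht)) ((hval t).ptL_mem i)
      (malerPt_mem hP hn gr t))
    have h3 : h * inner ℝ (g t) (pt t - x t) ≤ h * (P.G * P.D) :=
      mul_le_mul_of_nonneg_left h2.2 hη.le
    have h4 : h * -(P.G * P.D) ≤ h * inner ℝ (g t) (pt t - x t) :=
      mul_le_mul_of_nonneg_left h2.1 hη.le
    rw [abs_le]
    constructor <;> linarith
  have hgrad : ∀ t, gradL h (x t) (g t) (pt t) =
      (h * (1 + 2 * h * inner ℝ (g t) (pt t - x t))) • g t := by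
    intro t
    rw [gradL, ← add_smul]
    congr 1
    ring
  have hv : ∀ t < n, ‖gradL h (x t) (g t) (pt t)‖ ≤ 7 / (25 * P.D) := by
    intro t ht
    have hg := norm_malerGrad_le hP hn (hgr t ht)
    rw [hgrad, norm_smul, norm_mul, Real.norm_of_nonneg hη.le, Real.norm_eq_abs]
    calc h * |1 + 2 * h * inner ℝ (g t) (pt t - x t)| * ‖g t‖
        ≤ h * (7 / 5) * P.G := by
          gcongr
          exact habs t ht
      _ = 7 / 5 * (h * (P.G * P.D)) / P.D := by field_simp
      _ ≤ 7 / 5 * (1 / 5) / P.D := by gcongr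
      _ = _ := by field_simp; norm_num
  have h2 := sum_inner_sub_sq_le_of_ons hd hP.isCompact hP.convex
    (a := 1 / (onsBeta P ^ 2 * P.D ^ 2)) (β := onsBeta P) (N := 7 / (25 * P.D))
    (by rw [onsBeta_eq hP]; positivity) (by rw [onsBeta_eq hP]; positivity) (x := pt)
    (v := fun t => gradL h (x t) (g t) (pt t)) (A := fun t => (malerRun P n gr t).cov i) hw
    rfl (fun t _ => rfl) (fun t _ => rfl) hv
  rw [onsBeta_eq hP] at h2
  -- the surrogate is quadratic along `g`, so its curvature is read off directly
  have h3 : ∀ t ∈ Finset.range n, lossL h (x t) (g t) (pt t) + h * inner ℝ (g t) (x t - w) -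
      h ^ 2 * inner ℝ (g t) (x t - w) ^ 2 ≤
      inner ℝ (gradL h (x t) (g t) (pt t)) (pt t - w) -
        25 / 56 / 2 * inner ℝ (gradL h (x t) (g t) (pt t)) (pt t - w) ^ 2 := by
    intro t ht
    have ha := habs t (Finset.mem_range.1 ht)
    have e2 : inner ℝ (g t) (x t - w) = inner ℝ (g t) (x t - pt t) + inner ℝ (g t) (pt t - w) := by
      rw [← inner_add_right, sub_add_sub_cancel]
    rw [hgrad, real_inner_smul_left, lossL, e2]
    rw [← neg_sub (x t) (pt t), inner_neg_right] at ha ⊢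
    set a := h * inner ℝ (g t) (x t - pt t) with hadef
    set z := h * inner ℝ (g t) (pt t - w) with hzdef
    have e3 : |1 - 2 * a| ≤ 7 / 5 := by
      rw [hadef]; convert ha using 2; ring
    have e4 : (1 - 2 * a) ^ 2 ≤ 49 / 25 := by
      have := sq_le_sq' (abs_le.1 e3).1 (abs_le.1 e3).2
      norm_num at this ⊢; exact this
    have e5 : (1 - 2 * a) ^ 2 * z ^ 2 ≤ 49 / 25 * z ^ 2 :=
      mul_le_mul_of_nonneg_right e4 (sq_nonneg _)
    have e6 : 25 / 56 / 2 * ((1 - 2 * a) ^ 2 * z ^ 2) ≤ z ^ 2 := by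
      linarith [sq_nonneg z]
    have e7 : h * (1 + 2 * h * -inner ℝ (g t) (x t - pt t)) * inner ℝ (g t) (pt t - w) =
        (1 - 2 * a) * z := by
      rw [hadef, hzdef]; ring
    rw [e7, mul_pow]
    have e8 : -h * inner ℝ (g t) (x t - pt t) + h ^ 2 * inner ℝ (g t) (x t - pt t) ^ 2 +
        h * (inner ℝ (g t) (x t - pt t) + inner ℝ (g t) (pt t - w)) -
        h ^ 2 * (inner ℝ (g t) (x t - pt t) + inner ℝ (g t) (pt t - w)) ^ 2 =
        (1 - 2 * a) * z - z ^ 2 := by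
      rw [hadef, hzdef]; ring
    rw [e8]
    linarith
  have h4 := (Finset.sum_le_sum h3).trans h2
  rw [Finset.sum_sub_distrib, Finset.sum_add_distrib, ← Finset.mul_sum, ← Finset.mul_sum] at h4
  have h5 : -Real.log ((malerRun P n gr 0).wtL i) ≤ 2 * Real.log (√3 * (malerK n + 1)) :=
    neg_log_malerPrior_le hi
  have h6 : (25 / 56 : ℝ) / 2 * (1 / ((25 / 56) ^ 2 * P.D ^ 2) * ‖pt 0 - w‖ ^ 2) ≤ 28 / 25 := by
    have : ‖pt 0 - w‖ ^ 2 ≤ P.D ^ 2 := pow_le_pow_left₀ (norm_nonneg _)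
      (hP.diam_le _ ((hval 0).ptL_mem i) _ hw) 2
    calc (25 / 56 : ℝ) / 2 * (1 / ((25 / 56) ^ 2 * P.D ^ 2) * ‖pt 0 - w‖ ^ 2)
        ≤ (25 / 56 : ℝ) / 2 * (1 / ((25 / 56) ^ 2 * P.D ^ 2) * P.D ^ 2) := by gcongr
      _ = 28 / 25 := by field_simp; norm_num
  have h7 : n * (7 / (25 * P.D)) ^ 2 / (1 / ((25 / 56) ^ 2 * P.D ^ 2) * d) = n / (64 * d) := by
    field_simp; norm_num
  -- `β₀ = 25 / 56` and the gradient bound `7 / (25 D)` turn the determinant ratio into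
  -- `1 + n / (64 d)`
  have h8 : 1 / (2 * (25 / 56)) = (28 / 25 : ℝ) := by norm_num
  rw [h7, h8] at h4
  rw [← sub_le_iff_le_add', le_div_iff₀ hη]
  linarith

end Regret

/-! ### Tuning the learning rate of Maler -/

theorem sqrt_le_two_pow_malerK {n : ℕ} (hn : 1 ≤ n) : √(n : ℝ) ≤ 2 ^ malerK n := by
  have hn' : (0 : ℝ) < n := by exact_mod_cast hn
  have h1 : Real.logb 2 n / 2 ≤ malerK n := Nat.le_ceil _
  have h2 : Real.logb 2 √(n : ℝ) ≤ malerK n := by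
    rw [Real.sqrt_eq_rpow, Real.logb_rpow_eq_mul_logb_of_pos hn']
    linarith
  rw [Real.logb_le_iff_le_rpow (by norm_num) (by positivity)] at h2
  exact_mod_cast h2

theorem malerK_le {n : ℕ} (hn : 1 ≤ n) : (malerK n : ℝ) ≤ Real.logb 2 n / 2 + 1 := by
  have : 0 ≤ Real.logb 2 n := Real.logb_nonneg (by norm_num) (by exact_mod_cast hn)
  exact (Nat.ceil_lt_add_one (by positivity)).le

/-- The grid of learning rates of Maler contains a rate that is good enough for every curvature
`b`: the first rate below `b / 2` if there is one, and the smallest rate otherwise. -/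
theorem sub_sq_le_of_forall_eta {d : ℕ} {P : Params d} (hP : P.Admissible) {n : ℕ} (hn : 1 ≤ n)
    {R V M b : ℝ} (hV0 : 0 ≤ V) (hV : V ≤ (P.G * P.D) ^ 2 * n) (hM : 1 ≤ M) (hb : 0 < b)
    (h : ∀ i ≤ malerK n, R ≤ eta P i * V + M / eta P i) :
    R - b / 2 * V ≤ (5 * P.G * P.D + 9 / (2 * b)) * M := by
  have hG := hP.G_pos
  have hD := hP.D_pos
  have hinv : ∀ i, M / eta P i = M * (2 ^ i * (5 * P.G * P.D)) := by
    intro i; rw [eta, div_div_eq_mul_div, div_one]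
  have hb9 : 4 * M / b ≤ 9 / (2 * b) * M := by
    rw [show 9 / (2 * b) * M = (9 / 2 * M) / b by field_simp]
    gcongr
    linarith
  have hGDM : 0 ≤ 5 * P.G * P.D * M := by positivity
  by_cases hex : ∃ i, eta P i ≤ b / 2 ∧ i ≤ malerK n
  · classical
    obtain ⟨hi, hiK⟩ := Nat.find_spec hex
    have hmin := fun j (hj : j < Nat.find hex) => Nat.find_min hex hj
    generalize Nat.find hex = i at hi hiK hmin
    have h1 := h i hiK
    have h2 : eta P i * V ≤ b / 2 * V := by gcongr
    suffices h3 : M / eta P i ≤ (5 * P.G * P.D + 9 / (2 * b)) * M by linarith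
    rw [hinv, add_mul]
    cases i with
    | zero =>
      have : 0 ≤ 9 / (2 * b) * M := by positivity
      linarith
    | succ j =>
      have h4 : b / 2 < eta P j := by
        have := hmin j (Nat.lt_succ_self j)
        by_contra hcon
        exact this ⟨not_lt.1 hcon, by omega⟩
      rw [eta, lt_div_iff₀ (by positivity)] at h4
      have h5 : M * (2 ^ (j + 1) * (5 * P.G * P.D)) ≤ 4 * M / b := by
        rw [le_div_iff₀ hb, pow_succ]
        nlinarith
      linarith
  · push Not at hex
    have h1 := h _ le_rfl
    have h4 : b / 2 < eta P (malerK n) := by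
      by_contra hcon
      exact lt_irrefl _ (hex _ (not_lt.1 hcon))
    set r : ℝ := 2 ^ malerK n with hr
    have hr0 : 0 < r := by positivity
    have hrn : (n : ℝ) ≤ r ^ 2 := by
      rw [← Real.sqrt_le_left hr0.le]
      exact sqrt_le_two_pow_malerK hn
    rw [hinv] at h1
    rw [eta, lt_div_iff₀ (by positivity), ← hr] at h4
    have h2 : eta P (malerK n) * V ≤ 2 / b := by
      rw [eta, ← hr, div_mul_eq_mul_div, one_mul, div_le_div_iff₀ (by positivity) hb]
      have h5 : V ≤ (P.G * P.D) ^ 2 * r ^ 2 := hV.trans (by gcongr)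
      have h6 : V * b ≤ (P.G * P.D) ^ 2 * r ^ 2 * b := by gcongr
      have h7 : (r * (5 * P.G * P.D)) * (b / 2 * (r * (5 * P.G * P.D))) ≤
          (r * (5 * P.G * P.D)) * 1 := by gcongr
      have h8 : 0 < (P.G * P.D) ^ 2 * r ^ 2 * b := by positivity
      nlinarith
    have h3 : M * (r * (5 * P.G * P.D)) ≤ 2 * M / b := by
      rw [le_div_iff₀ hb]
      nlinarith
    have h5 : 2 / b ≤ 2 * M / b := by gcongr; linarith
    have h6 : 4 * M / b = 2 * M / b + 2 * M / b := by ring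
    have h7 : 0 ≤ b / 2 * V := by positivity
    rw [add_mul]
    linarith

theorem one_le_two_mul_log_malerK (n : ℕ) : 1 ≤ 2 * Real.log (√3 * (malerK n + 1)) := by
  have h1 : Real.log √3 ≤ Real.log (√3 * (malerK n + 1)) := by
    apply Real.log_le_log (by positivity)
    have : (0 : ℝ) ≤ malerK n := by positivity
    nlinarith [Real.sqrt_nonneg 3]
  rw [Real.log_sqrt (by norm_num)] at h1
  have h2 : (1 : ℝ) ≤ Real.log 3 := by
    rw [Real.le_log_iff_exp_le (by norm_num)]
    linarith [Real.exp_one_lt_d9]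
  linarith

theorem two_mul_log_malerK_le_Xi {n p q : ℕ} (hn : 1 ≤ n) (hpq : p ≤ q) (hnq : n ≤ q - p + 1) :
    2 * Real.log (√3 * (malerK n + 1)) ≤ Xi p q := by
  have h1 := malerK_le hn
  have hn0 : (0 : ℝ) < n := by exact_mod_cast hn
  have h2 : (n : ℝ) ≤ (q : ℝ) - p + 1 := by
    have : (n : ℝ) ≤ ((q - p + 1 : ℕ) : ℝ) := by exact_mod_cast hnq
    rwa [Nat.cast_add, Nat.cast_sub hpq, Nat.cast_one] at this
  have h3 : Real.logb 2 n ≤ Real.logb 2 ((q : ℝ) - p + 1) :=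
    Real.logb_le_logb_of_le (by norm_num) hn0 h2
  unfold Xi
  have h4 : √3 * (malerK n + 1) ≤ √3 / 2 * Real.logb 2 ((q : ℝ) - p + 1) + 3 * √3 := by
    have : √3 * ((malerK n : ℝ) + 1) ≤ √3 * (Real.logb 2 ((q : ℝ) - p + 1) / 2 + 2) :=
      mul_le_mul_of_nonneg_left (by linarith) (Real.sqrt_nonneg _)
    nlinarith [Real.sqrt_nonneg 3]
  gcongr

section Regret

variable {d : ℕ} {P : Params d} {n : ℕ} {gr : ℕ → Vec d → Vec d}

/-- The regret of Maler when the losses have curvature `b G²` in all directions. -/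
theorem maler_regret_sub_norm_le (hP : P.Admissible) (hn : 1 ≤ n)
    (hgr : ∀ t < n, ∀ x ∈ P.Ω, ‖gr t x‖ ≤ P.G) {w : Vec d} (hw : w ∈ P.Ω) {b : ℝ} (hb : 0 < b) :
    ∑ t ∈ Finset.range n, inner ℝ (malerGrad P n gr t) (malerPt P n gr t - w) -
      b / 2 * (P.G ^ 2 * ∑ t ∈ Finset.range n, ‖malerPt P n gr t - w‖ ^ 2) ≤
      (5 * P.G * P.D + 9 / (2 * b)) *
        (2 * Real.log (√3 * (malerK n + 1)) + 1 / 2 * (1 + Real.log n)) := by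
  refine sub_sq_le_of_forall_eta hP hn (by positivity) ?_ ?_ hb
    fun i hi => maler_regret_le_eta_norm hP hn hgr hw hi
  · rw [mul_pow, mul_assoc]
    refine mul_le_mul_of_nonneg_left ?_ (sq_nonneg _)
    calc ∑ t ∈ Finset.range n, ‖malerPt P n gr t - w‖ ^ 2
        ≤ ∑ t ∈ Finset.range n, P.D ^ 2 := Finset.sum_le_sum fun t _ =>
          pow_le_pow_left₀ (norm_nonneg _) (hP.diam_le _ (malerPt_mem hP hn gr t) _ hw) 2
      _ = P.D ^ 2 * n := by simp [mul_comm]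
  · have := one_le_two_mul_log_malerK n
    have := Real.log_natCast_nonneg n
    linarith

/-- The regret of Maler when the losses have curvature `b` along the observed gradients. -/
theorem maler_regret_sub_inner_le (hd : 0 < d) (hP : P.Admissible) (hn : 1 ≤ n)
    (hgr : ∀ t < n, ∀ x ∈ P.Ω, ‖gr t x‖ ≤ P.G) {w : Vec d} (hw : w ∈ P.Ω) {b : ℝ} (hb : 0 < b) :
    ∑ t ∈ Finset.range n, inner ℝ (malerGrad P n gr t) (malerPt P n gr t - w) -
      b / 2 * (∑ t ∈ Finset.range n, inner ℝ (malerGrad P n gr t) (malerPt P n gr t - w) ^ 2) ≤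
      (5 * P.G * P.D + 9 / (2 * b)) * (2 * Real.log (√3 * (malerK n + 1)) +
          28 / 25 * (1 + d * Real.log (1 + n / (64 * d)))) := by
  refine sub_sq_le_of_forall_eta hP hn (Finset.sum_nonneg fun _ _ => sq_nonneg _) ?_ ?_ hb
    fun i hi => maler_regret_le_eta_inner hd hP hn hgr hw hi
  · calc ∑ t ∈ Finset.range n, inner ℝ (malerGrad P n gr t) (malerPt P n gr t - w) ^ 2
        ≤ ∑ t ∈ Finset.range n, (P.G * P.D) ^ 2 := Finset.sum_le_sum fun t ht => by
          have := abs_le.1 (hP.abs_inner_le (norm_malerGrad_le hP hn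
            (hgr t (Finset.mem_range.1 ht))) (malerPt_mem hP hn gr t) hw)
          exact sq_le_sq' this.1 this.2
      _ = (P.G * P.D) ^ 2 * n := by simp [mul_comm]
  · have := one_le_two_mul_log_malerK n
    have h1 : 0 ≤ Real.log (1 + n / (64 * d)) := Real.log_nonneg (by
      have : (0 : ℝ) ≤ n / (64 * d) := by positivity
      linarith)
    have : 0 ≤ d * Real.log (1 + n / (64 * d)) := by positivity
    linarith

end Regret

/-- The logarithm of the determinant ratio does not grow with `d` when `n = 1`, where the final
bound contains no multiple of `d`. -/
theorem mul_log_one_add_div_le {n d : ℕ} (hd : 0 < d) (hn : 1 ≤ n) :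
    d * Real.log (1 + n / (64 * d)) ≤ 1 / 64 + d * Real.log n := by
  have hd' : (1 : ℝ) ≤ d := by exact_mod_cast hd
  have hn' : (1 : ℝ) ≤ n := by exact_mod_cast hn
  rcases hn.eq_or_lt with rfl | hn2
  · have h1 : Real.log (1 + (1 : ℕ) / (64 * (d : ℝ))) ≤ 1 / (64 * d) := by
      refine (Real.log_le_sub_one_of_pos (by positivity)).trans (le_of_eq ?_)
      push_cast; ring
    have h2 : (d : ℝ) * Real.log (1 + (1 : ℕ) / (64 * (d : ℝ))) ≤ d * (1 / (64 * d)) := by gcongr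
    have h3 : (d : ℝ) * (1 / (64 * d)) = 1 / 64 := by field_simp
    simp only [Nat.cast_one, Real.log_one, mul_zero, add_zero] at *
    linarith
  · have hn2' : (2 : ℝ) ≤ n := by exact_mod_cast hn2
    have h1 : 1 + (n : ℝ) / (64 * d) ≤ n := by
      have : (n : ℝ) / (64 * d) ≤ n / 64 := by
        gcongr
        linarith
      linarith
    have h2 : Real.log (1 + n / (64 * d)) ≤ Real.log n := Real.log_le_log (by positivity) h1
    have h3 : (d : ℝ) * Real.log (1 + n / (64 * d)) ≤ d * Real.log n := by gcongr
    linarith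

/-! ### Partitions into geometric covering intervals -/

theorem gcEnd_add_one (J : ℕ × ℕ) : gcEnd J + 1 = gcStart J + gcLen J := by
  unfold gcEnd gcStart gcLen
  have h : 1 ≤ (J.2 + 1) * 2 ^ J.1 := Nat.one_le_iff_ne_zero.2 (by positivity)
  rw [Nat.sub_add_cancel h]
  ring

theorem one_le_gcLen (J : ℕ × ℕ) : 1 ≤ gcLen J := Nat.one_le_two_pow

theorem gcStart_pos {J : ℕ × ℕ} (hJ : 1 ≤ J.2) : 1 ≤ gcStart J :=
  Nat.one_le_iff_ne_zero.2 (by unfold gcStart; positivity)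

/-- The geometric covering intervals listed in `s` partition the rounds `a, …, e - 1`; the
partition is expressed by the sums over it. -/
structure IsGCPartition (a e : ℕ) (s : List (ℕ × ℕ)) : Prop where
  mem : ∀ J ∈ s, 1 ≤ J.2 ∧ a ≤ gcStart J ∧ gcEnd J < e
  sum_eq : ∀ F : ℕ → ℝ, ∑ t ∈ Finset.Ico a e, F t =
    (s.map fun J => ∑ t ∈ Finset.Icc (gcStart J) (gcEnd J), F t).sum

theorem IsGCPartition.nil (a : ℕ) : IsGCPartition a a [] := ⟨by simp, by simp⟩

theorem IsGCPartition.singleton (J : ℕ × ℕ) (hJ : 1 ≤ J.2) :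
    IsGCPartition (gcStart J) (gcStart J + gcLen J) [J] := by
  constructor
  · intro J' hJ'
    rw [List.mem_singleton] at hJ'
    subst hJ'
    exact ⟨hJ, le_rfl, by rw [← gcEnd_add_one]; exact Nat.lt_succ_self _⟩
  · intro F
    rw [← gcEnd_add_one]
    simp only [List.map_cons, List.map_nil, List.sum_cons, List.sum_nil, add_zero]
    rfl

theorem IsGCPartition.append {a e u : ℕ} {s s' : List (ℕ × ℕ)} (hs : IsGCPartition a e s)
    (hs' : IsGCPartition e u s') (hae : a ≤ e) (heu : e ≤ u) : IsGCPartition a u (s ++ s') := by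
  constructor
  · intro J hJ
    rcases List.mem_append.1 hJ with h | h
    · obtain ⟨h1, h2, h3⟩ := hs.mem J h
      exact ⟨h1, h2, by omega⟩
    · obtain ⟨h1, h2, h3⟩ := hs'.mem J h
      exact ⟨h1, by omega, h3⟩
  · intro F
    rw [List.map_append, List.sum_append, ← hs.sum_eq, ← hs'.sum_eq,
      Finset.sum_Ico_consecutive F hae heu]

/-- The sum of the square roots of the lengths of the intervals in a list. -/
noncomputable def sqrtLenSum (s : List (ℕ × ℕ)) : ℝ := (s.map fun J => √(gcLen J : ℝ)).sum

theorem sqrtLenSum_append (s s' : List (ℕ × ℕ)) :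
    sqrtLenSum (s ++ s') = sqrtLenSum s + sqrtLenSum s' := by
  simp [sqrtLenSum]

theorem sqrt_add_mul_sqrt_le {x y : ℝ} (hy : 0 ≤ y) (hyx : y ≤ x) :
    √x + (1 + √2) * √y ≤ (1 + √2) * √(x + y) := by
  rcases hy.trans hyx |>.eq_or_lt with hx | hx
  · have : y = 0 := by linarith
    simp [← hx, this]
  set a := √x with ha
  set b := √y
  set c := √(x + y)
  have ha0 : 0 < a := Real.sqrt_pos.2 hx
  have ha2 : a ^ 2 = x := Real.sq_sqrt hx.le
  have hb2 : b ^ 2 = y := Real.sq_sqrt hy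
  have hc2 : c ^ 2 = x + y := Real.sq_sqrt (by linarith)
  have hba : b ≤ a := Real.sqrt_le_sqrt hyx
  have hbc : b ≤ c := Real.sqrt_le_sqrt (by linarith)
  have hca : c ≤ √2 * a := by
    rw [ha, ← Real.sqrt_mul (by norm_num)]
    exact Real.sqrt_le_sqrt (by linarith)
  -- `a² = (c - b) (c + b)` and `c + b ≤ (1 + √2) a`
  have h1 : a * a ≤ (1 + √2) * (c - b) * a := by
    have : (c - b) * (c + b) ≤ (c - b) * ((1 + √2) * a) :=
      mul_le_mul_of_nonneg_left (by linarith) (by linarith)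
    nlinarith
  have := le_of_mul_le_mul_right h1 ha0
  linarith

/-- Rounds that follow a multiple `a` of `2 ^ m` are partitioned along the binary expansion of
their number, the longest interval first. -/
theorem exists_gcPartition_right (m : ℕ) : ∀ a n : ℕ, 0 < a → 2 ^ m ∣ a → n < 2 ^ m →
    ∃ s, IsGCPartition a (a + n) s ∧ 2 ^ s.length ≤ n + 1 ∧ sqrtLenSum s ≤ (1 + √2) * √n := by
  induction m with
  | zero =>
    intro a n _ _ hn
    obtain rfl : n = 0 := by simpa using hn
    exact ⟨[], IsGCPartition.nil a, by simp, by simp [sqrtLenSum]⟩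
  | succ m ih =>
    intro a n ha hdvd hn
    have hdvd' : 2 ^ m ∣ a := (pow_dvd_pow 2 (Nat.le_succ m)).trans hdvd
    rcases lt_or_ge n (2 ^ m) with h | h
    · exact ih a n ha hdvd' h
    · obtain ⟨n', rfl⟩ := Nat.exists_eq_add_of_le h
      have hn' : n' < 2 ^ m := by rw [pow_succ] at hn; omega
      obtain ⟨s, hs, hcard, hsqrt⟩ := ih (a + 2 ^ m) n' (by omega)
        (Dvd.dvd.add hdvd' dvd_rfl) hn'
      obtain ⟨i, rfl⟩ := hdvd'
      have hi : 1 ≤ i := Nat.one_le_iff_ne_zero.2 (by rintro rfl; simp at ha)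
      have hJ := IsGCPartition.singleton (m, i) hi
      have hst : gcStart (m, i) = 2 ^ m * i := by simp [gcStart, mul_comm]
      have hlen : gcLen (m, i) = 2 ^ m := rfl
      rw [hst, hlen] at hJ
      refine ⟨[(m, i)] ++ s, ?_, ?_, ?_⟩
      · rw [← add_assoc]
        exact hJ.append hs (by omega) (by omega)
      · rw [List.length_append, pow_add, List.length_singleton, pow_one]
        omega
      · rw [sqrtLenSum_append]
        have h1 : sqrtLenSum [(m, i)] = √((2 ^ m : ℕ) : ℝ) := by simp [sqrtLenSum, gcLen]
        rw [h1]
        have h2 := sqrt_add_mul_sqrt_le (x := ((2 ^ m : ℕ) : ℝ)) (y := (n' : ℝ)) (by positivity)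
          (by exact_mod_cast hn'.le)
        push_cast at h2 ⊢
        linarith

/-- Rounds that precede a multiple `e` of `2 ^ m` are partitioned in the mirrored way. -/
theorem exists_gcPartition_left (m : ℕ) : ∀ a n : ℕ, 0 < a → 2 ^ m ∣ a + n → n < 2 ^ m →
    ∃ s, IsGCPartition a (a + n) s ∧ 2 ^ s.length ≤ n + 1 ∧ sqrtLenSum s ≤ (1 + √2) * √n := by
  induction m with
  | zero =>
    intro a n _ _ hn
    obtain rfl : n = 0 := by simpa using hn
    exact ⟨[], IsGCPartition.nil a, by simp, by simp [sqrtLenSum]⟩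
  | succ m ih =>
    intro a n ha hdvd hn
    have hdvd' : 2 ^ m ∣ a + n := (pow_dvd_pow 2 (Nat.le_succ m)).trans hdvd
    rcases lt_or_ge n (2 ^ m) with h | h
    · exact ih a n ha hdvd' h
    · obtain ⟨n', rfl⟩ := Nat.exists_eq_add_of_le' h
      have hn' : n' < 2 ^ m := by rw [pow_succ] at hn; omega
      rw [← add_assoc] at hdvd'
      obtain ⟨s, hs, hcard, hsqrt⟩ := ih a n' ha ((Nat.dvd_add_left dvd_rfl).1 hdvd') hn'
      obtain ⟨i, hi'⟩ := (Nat.dvd_add_left dvd_rfl).1 hdvd'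
      have hi : 1 ≤ i := Nat.one_le_iff_ne_zero.2 (by rintro rfl; simp at hi'; omega)
      have hJ := IsGCPartition.singleton (m, i) hi
      have hst : gcStart (m, i) = a + n' := by simp [gcStart, mul_comm, hi']
      have hlen : gcLen (m, i) = 2 ^ m := rfl
      rw [hst, hlen] at hJ
      refine ⟨s ++ [(m, i)], ?_, ?_, ?_⟩
      · rw [← add_assoc]
        exact hs.append hJ (by omega) (by omega)
      · rw [List.length_append, pow_add, List.length_singleton, pow_one]
        omega
      · rw [sqrtLenSum_append]
        have h1 : sqrtLenSum [(m, i)] = √((2 ^ m : ℕ) : ℝ) := by simp [sqrtLenSum, gcLen]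
        rw [h1]
        have h2 := sqrt_add_mul_sqrt_le (x := ((2 ^ m : ℕ) : ℝ)) (y := (n' : ℝ)) (by positivity)
          (by exact_mod_cast hn'.le)
        push_cast at h2 ⊢
        rw [add_comm (n' : ℝ)]
        linarith

/-- Among the numbers `p, …, e` the one divisible by the highest power of two is the pivot at
which a run of lengthening intervals turns into a run of shortening ones. -/
theorem exists_pivot {p e : ℕ} (hp : 1 ≤ p) (hpe : p ≤ e) :
    ∃ m u, p ≤ u ∧ u ≤ e ∧ 2 ^ m ∣ u ∧ u < p + 2 ^ m ∧ e < u + 2 ^ m := by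
  classical
  let Q : ℕ → Prop := fun m => ∃ u, p ≤ u ∧ u ≤ e ∧ 2 ^ m ∣ u
  have h0 : Q 0 := ⟨p, le_rfl, hpe, by simp⟩
  have hbound : ∀ m, Q m → m ≤ e := by
    rintro m ⟨u, h1, h2, h3⟩
    have := Nat.le_of_dvd (by omega) h3
    have := Nat.lt_two_pow_self (n := m)
    omega
  have hQ := Nat.findGreatest_spec (P := Q) (Nat.zero_le e) h0
  have hmax : ¬ Q (Nat.findGreatest Q e + 1) := by
    intro h
    have := Nat.le_findGreatest (hbound _ h) h
    omega
  set m := Nat.findGreatest Q e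
  obtain ⟨u, h1, h2, i, hi⟩ := hQ
  -- of two neighbouring multiples of `2 ^ m` one is a multiple of `2 ^ (m + 1)`
  have heven : ∀ j, p ≤ 2 ^ m * j → 2 ^ m * j ≤ e → ¬ 2 ∣ j := by
    rintro j hj1 hj2 ⟨k, rfl⟩
    exact hmax ⟨_, hj1, hj2, ⟨k, by ring⟩⟩
  have hM : 0 < 2 ^ m := by positivity
  refine ⟨m, u, h1, h2, ⟨i, hi⟩, ?_, ?_⟩
  · by_contra hcon
    push Not at hcon
    have hi0 : i ≠ 0 := by
      rintro rfl
      simp at hi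
      omega
    obtain ⟨j, rfl⟩ := Nat.exists_eq_succ_of_ne_zero hi0
    rw [Nat.succ_eq_add_one, mul_add, mul_one] at hi
    have ha := heven j (by omega) (by omega)
    have hb := heven (j + 1) (by rw [mul_add, mul_one]; omega) (by rw [mul_add, mul_one]; omega)
    omega
  · by_contra hcon
    push Not at hcon
    have ha := heven i (by omega) (by omega)
    have hb := heven (i + 1) (by rw [mul_add, mul_one]; omega) (by rw [mul_add, mul_one]; omega)
    omega

theorem length_le_ceil_logb {l : ℕ} {x : ℝ} (h : (2 : ℝ) ^ l ≤ x) :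
    (l : ℝ) ≤ (⌈Real.logb 2 x⌉ : ℝ) := by
  refine le_trans ?_ (Int.le_ceil _)
  rw [Real.le_logb_iff_rpow_le (by norm_num) (lt_of_lt_of_le (by positivity) h)]
  exact_mod_cast h

/-- Every interval of rounds is partitioned into few geometric covering intervals. -/
theorem exists_gcPartition {p q : ℕ} (hp : 1 ≤ p) (hpq : p ≤ q) :
    ∃ s, IsGCPartition p (q + 1) s ∧ (s.length : ℝ) ≤ b p q ∧
      sqrtLenSum s ≤ 7 / 2 * √((q : ℝ) - p + 1) := by
  obtain ⟨m, u, h1, h2, h3, h4, h5⟩ := exists_pivot hp (hpq.trans (Nat.le_succ q))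
  obtain ⟨n, rfl⟩ := Nat.exists_eq_add_of_le h1
  obtain ⟨n', hn'⟩ := Nat.exists_eq_add_of_le h2
  have hN : (q : ℝ) - p + 1 = n + n' := by
    have : (q : ℝ) + 1 = p + n + n' := by exact_mod_cast hn'
    linarith
  obtain ⟨s, hs, hcard, hsqrt⟩ := exists_gcPartition_left m p n hp h3 (by omega)
  obtain ⟨s', hs', hcard', hsqrt'⟩ := exists_gcPartition_right m (p + n) n' (by omega) h3 (by omega)
  have hN2 : (q : ℝ) - p + 2 = n + n' + 1 := by linarith
  refine ⟨s ++ s', ?_, ?_, ?_⟩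
  · rw [Nat.succ_eq_add_one] at hn'
    rw [hn']
    exact hs.append hs' (by omega) (by omega)
  · have e1 : (2 : ℝ) ^ s.length ≤ (q : ℝ) - p + 2 := by
      have : (2 : ℝ) ^ s.length ≤ n + 1 := by exact_mod_cast hcard
      have : (0 : ℝ) ≤ n' := by positivity
      linarith
    have e2 : (2 : ℝ) ^ s'.length ≤ (q : ℝ) - p + 2 := by
      have : (2 : ℝ) ^ s'.length ≤ n' + 1 := by exact_mod_cast hcard'
      have : (0 : ℝ) ≤ n := by positivity
      linarith
    have := length_le_ceil_logb e1
    have := length_le_ceil_logb e2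
    rw [List.length_append, b]
    push_cast
    linarith
  · rw [sqrtLenSum_append, hN]
    have e1 : √(n : ℝ) + √(n' : ℝ) ≤ √2 * √((n : ℝ) + n') := by
      rw [← Real.sqrt_mul (by norm_num)]
      apply Real.le_sqrt_of_sq_le
      have a1 := Real.sq_sqrt (Nat.cast_nonneg (α := ℝ) n)
      have a2 := Real.sq_sqrt (Nat.cast_nonneg (α := ℝ) n')
      nlinarith [sq_nonneg (√(n : ℝ) - √(n' : ℝ))]
    have e2 : √2 ≤ (3 / 2 : ℝ) := by
      rw [Real.sqrt_le_left (by norm_num)]; norm_num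
    have e3 : √2 ^ 2 = (2 : ℝ) := Real.sq_sqrt (by norm_num)
    have e4 : (1 + √2) * (√(n : ℝ) + √(n' : ℝ)) ≤ (1 + √2) * (√2 * √((n : ℝ) + n')) := by gcongr
    have e5 : 0 ≤ (3 / 2 - √2) * √((n : ℝ) + n') :=
      mul_nonneg (by linarith) (Real.sqrt_nonneg _)
    have e6 : (1 + √2) * (√2 * √((n : ℝ) + n')) = (√2 + √2 ^ 2) * √((n : ℝ) + n') := by ring
    rw [e3] at e6
    linarith

/-! ### The meta-algorithm -/

theorem mem_active {t : ℕ} {J : ℕ × ℕ} :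
    J ∈ active t ↔ 1 ≤ J.2 ∧ gcStart J ≤ t ∧ t ≤ gcEnd J := by
  simp only [active, Finset.mem_filter, Finset.mem_product, Finset.mem_range]
  refine ⟨fun h => h.2, fun h => ⟨?_, h⟩⟩
  obtain ⟨h1, h2, -⟩ := h
  unfold gcStart at h2
  have h3 := Nat.lt_two_pow_self (n := J.1)
  constructor
  · nlinarith
  · nlinarith [Nat.one_le_two_pow (n := J.1)]

theorem singleton_mem_active {t : ℕ} (ht : 1 ≤ t) : (0, t) ∈ active t :=
  mem_active.2 ⟨ht, by simp [gcStart], by simp [gcEnd]⟩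

theorem one_le_gcEnd {J : ℕ × ℕ} (hJ : 1 ≤ J.2) : 1 ≤ gcEnd J := by
  have h1 := gcStart_pos hJ
  have h2 := gcEnd_add_one J
  have h3 := one_le_gcLen J
  omega

theorem one_le_log_four_mul_sq {s : ℕ} (hs : 1 ≤ s) : 1 ≤ Real.log (4 * (s : ℝ) ^ 2) := by
  have hs' : (1 : ℝ) ≤ s := by exact_mod_cast hs
  rw [Real.le_log_iff_exp_le (by positivity)]
  nlinarith [Real.exp_one_lt_d9]

theorem rate_pos {J : ℕ × ℕ} (hJ : 1 ≤ J.2) {L : ℝ} (hL : 0 ≤ L) : 0 < rate J L := by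
  have := one_le_log_four_mul_sq (one_le_gcEnd hJ)
  exact lt_min (by norm_num) (Real.sqrt_pos.2 (by positivity))

/-- What every state of UMA3 satisfies. -/
structure ValidState {d : ℕ} (P : Params d) (S : State d) : Prop where
  maler : ∀ J, (S J).maler.Valid P (gcLen J)
  L_nonneg : ∀ J, 0 ≤ (S J).L
  x_pos : ∀ J, 0 < (S J).x

section Round

variable {d : ℕ} {P : Params d} {S : State d} {t : ℕ}

theorem expertPlay_mem (hP : P.Admissible) (hS : ValidState P S) (J : ℕ × ℕ) :
    expertPlay P S J ∈ P.Ω :=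
  malerPlay_mem hP (one_le_gcLen J) (hS.maler J)

theorem rate_mul_pos (hS : ValidState P S) {J : ℕ × ℕ} (hJ : J ∈ active t) :
    0 < rate J (S J).L * (S J).x :=
  mul_pos (rate_pos (mem_active.1 hJ).1 (hS.L_nonneg J)) (hS.x_pos J)

theorem sum_rate_mul_pos (hS : ValidState P S) (ht : 1 ≤ t) :
    0 < ∑ J ∈ active t, rate J (S J).L * (S J).x :=
  Finset.sum_pos (fun _ hJ => rate_mul_pos hS hJ) ⟨_, singleton_mem_active ht⟩

theorem sum_weight (hS : ValidState P S) (ht : 1 ≤ t) : ∑ J ∈ active t, weight S t J = 1 := by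
  unfold weight
  rw [← Finset.sum_div]
  exact div_self (sum_rate_mul_pos hS ht).ne'

theorem play_mem (hP : P.Admissible) (hS : ValidState P S) (ht : 1 ≤ t) : play P S t ∈ P.Ω :=
  hP.convex.sum_mem
    (fun _ hJ => (div_pos (rate_mul_pos hS hJ) (sum_rate_mul_pos hS ht)).le)
    (sum_weight hS ht) fun J _ => expertPlay_mem hP hS J

variable {gr : Vec d → Vec d}

/-- The weighted linearized losses average to the value at the decision itself. -/
theorem metaLoss_eq (hP : P.Admissible) (hS : ValidState P S) (ht : 1 ≤ t) :
    metaLoss P gr S t = 1 / 2 := by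
  have hG := hP.G_pos
  have hD := hP.D_pos
  set g := gr (play P S t)
  have h1 : metaLoss P gr S t = (inner ℝ g (∑ J ∈ active t, weight S t J • expertPlay P S J) +
      (∑ J ∈ active t, weight S t J) * (P.G * P.D - inner ℝ g (play P S t))) /
        (2 * P.G * P.D) := by
    rw [metaLoss, inner_sum, Finset.sum_mul, ← Finset.sum_add_distrib, Finset.sum_div]
    refine Finset.sum_congr rfl fun J _ => ?_
    rw [expertLoss, inner_sub_right, real_inner_smul_right]
    ring
  rw [h1, sum_weight hS ht, ← play]
  field_simp
  ring

theorem metaLoss_sub_expertLoss (hP : P.Admissible) (hS : ValidState P S) (ht : 1 ≤ t)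
    (J : ℕ × ℕ) : metaLoss P gr S t - expertLoss P gr S t J =
      inner ℝ (gr (play P S t)) (play P S t - expertPlay P S J) / (2 * P.G * P.D) := by
  have hG := hP.G_pos
  have hD := hP.D_pos
  rw [metaLoss_eq hP hS ht, expertLoss, ← neg_sub (play P S t), inner_neg_right]
  field_simp
  ring

theorem abs_metaLoss_sub_expertLoss_le (hP : P.Admissible) (hS : ValidState P S) (ht : 1 ≤ t)
    (hgr : ∀ x ∈ P.Ω, ‖gr x‖ ≤ P.G) (J : ℕ × ℕ) :
    |metaLoss P gr S t - expertLoss P gr S t J| ≤ 1 / 2 := by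
  have hG := hP.G_pos
  have hD := hP.D_pos
  have hw := play_mem hP hS ht
  rw [metaLoss_sub_expertLoss hP hS ht, abs_div, abs_of_pos (by positivity : 0 < 2 * P.G * P.D),
    div_le_iff₀ (by positivity)]
  have := hP.abs_inner_le (hgr _ hw) hw (expertPlay_mem hP hS J)
  linarith

/-- The first-order terms of the multiplicative updates cancel over the active experts. -/
theorem sum_rate_mul_metaLoss_sub_expertLoss (hS : ValidState P S) (ht : 1 ≤ t) :
    ∑ J ∈ active t, rate J (S J).L * (S J).x *
      (metaLoss P gr S t - expertLoss P gr S t J) = 0 := by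
  have h0 := sum_rate_mul_pos hS ht
  have h1 : ∑ J ∈ active t, weight S t J * (metaLoss P gr S t - expertLoss P gr S t J) = 0 := by
    simp only [mul_sub, Finset.sum_sub_distrib]
    rw [← Finset.sum_mul, sum_weight hS ht, one_mul, metaLoss, sub_self]
  simp only [weight, div_mul_eq_mul_div] at h1
  rw [← Finset.sum_div, div_eq_zero_iff] at h1
  exact h1.resolve_right h0.ne'

theorem one_add_rate_mul_pos (hP : P.Admissible) (hS : ValidState P S) (ht : 1 ≤ t)
    (hgr : ∀ x ∈ P.Ω, ‖gr x‖ ≤ P.G) {J : ℕ × ℕ} (hJ : 1 ≤ J.2) :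
    0 < 1 + rate J (S J).L * (metaLoss P gr S t - expertLoss P gr S t J) := by
  have h1 := abs_le.1 (abs_metaLoss_sub_expertLoss_le hP hS ht hgr J)
  have h2 := rate_pos hJ (hS.L_nonneg J)
  have h3 : rate J (S J).L ≤ 1 / 2 := min_le_left _ _
  nlinarith

theorem step_valid (hP : P.Admissible) (hS : ValidState P S) (ht : 1 ≤ t)
    (hgr : ∀ x ∈ P.Ω, ‖gr x‖ ≤ P.G) : ValidState P (step P gr S t) := by
  constructor <;> intro J <;> unfold step <;> split_ifs with hJ
  · exact malerStep_valid hP (hS.maler J) _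
  · exact hS.maler J
  · exact add_nonneg (hS.L_nonneg J) (sq_nonneg _)
  · exact hS.L_nonneg J
  · exact Real.rpow_pos_of_pos (mul_pos (hS.x_pos J)
      (one_add_rate_mul_pos hP hS ht hgr (mem_active.1 hJ).1)) _
  · exact hS.x_pos J

/-- Changing the learning rate costs at most the growth of `log (1 + L) / 2`. -/
theorem rate_ratio_ge {J : ℕ × ℕ} {L L' : ℝ} (hL : 0 ≤ L) (hLL' : L ≤ L') :
    rate J L * (1 - 1 / 2 * (Real.log (1 + L') - Real.log (1 + L))) ≤ rate J L' := by
  have hr0 : 0 ≤ rate J L := le_min (by norm_num) (Real.sqrt_nonneg _)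
  set θ := √((1 + L) / (1 + L')) with hθ
  have hθ1 : θ ≤ 1 := by
    rw [hθ, Real.sqrt_le_left zero_le_one, one_pow, div_le_one (by linarith)]
    linarith
  have hθ0 : 0 ≤ θ := Real.sqrt_nonneg _
  have hlog : 1 - 1 / 2 * (Real.log (1 + L') - Real.log (1 + L)) ≤ θ := by
    have h1 : Real.log θ = 1 / 2 * (Real.log (1 + L) - Real.log (1 + L')) := by
      rw [hθ, Real.log_sqrt (div_nonneg (by linarith) (by linarith)),
        Real.log_div (by linarith) (by linarith)]
      ring
    have h2 := Real.log_le_sub_one_of_pos (x := θ)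
      (Real.sqrt_pos.2 (div_pos (by linarith) (by linarith)))
    linarith
  refine (mul_le_mul_of_nonneg_left hlog hr0).trans (le_min ?_ ?_)
  · have : rate J L ≤ 1 / 2 := min_le_left _ _
    nlinarith
  · have h1 : rate J L ≤ √(Real.log (4 * (gcEnd J : ℝ) ^ 2) / (1 + L)) := min_le_right _ _
    refine (mul_le_mul_of_nonneg_right h1 hθ0).trans (le_of_eq ?_)
    rw [hθ, ← Real.sqrt_mul' _ (div_nonneg (by linarith) (by linarith))]
    congr 1
    have : 1 + L ≠ 0 := by linarith
    field_simp

/-- Bernoulli's inequality, applied to the exponent by which the learning rate changes. -/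
theorem rpow_le_add_one_sub {y a : ℝ} (hy : 0 ≤ y) (ha0 : 0 ≤ a) (ha1 : a ≤ 1) :
    y ^ a ≤ y + (1 - a) := by
  have h := rpow_one_add_le_one_add_mul_self (s := y - 1) (by linarith) ha0 ha1
  rw [add_sub_cancel] at h
  nlinarith

/-- One round changes the potential `x - log (1 + L) / 2` of an expert by at most the linear term
of the multiplicative update. -/
theorem potential_step_le (hP : P.Admissible) (hS : ValidState P S) (ht : 1 ≤ t)
    (hgr : ∀ x ∈ P.Ω, ‖gr x‖ ≤ P.G) {J : ℕ × ℕ} (hJ : J ∈ active t) :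
    (step P gr S t J).x - 1 / 2 * Real.log (1 + (step P gr S t J).L) ≤
      ((S J).x - 1 / 2 * Real.log (1 + (S J).L)) +
        rate J (S J).L * (S J).x * (metaLoss P gr S t - expertLoss P gr S t J) := by
  have hJ1 := (mem_active.1 hJ).1
  have hL := hS.L_nonneg J
  have hx := hS.x_pos J
  have hpos := one_add_rate_mul_pos hP hS ht hgr hJ1
  simp only [step, if_pos hJ]
  set r := metaLoss P gr S t - expertLoss P gr S t J
  have hL' : (S J).L ≤ nextL P gr S t J := le_add_of_nonneg_right (sq_nonneg _)
  set L := (S J).L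
  set L' := nextL P gr S t J
  set x := (S J).x
  have hr := rate_pos hJ1 hL
  have hr' := rate_pos hJ1 (hL.trans hL')
  have h1 := rate_ratio_ge (J := J) hL hL'
  have hmono : rate J L' ≤ rate J L := by
    unfold rate
    have := one_le_log_four_mul_sq (one_le_gcEnd hJ1)
    gcongr
  have h2 := rpow_le_add_one_sub (y := x * (1 + rate J L * r)) (a := rate J L' / rate J L)
    (by positivity) (by positivity) ((div_le_one hr).2 hmono)
  have h3 : 1 - 1 / 2 * (Real.log (1 + L') - Real.log (1 + L)) ≤ rate J L' / rate J L := by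
    rw [le_div_iff₀ hr]; linarith
  linarith

end Round

section Run

variable {d : ℕ} {P : Params d} {grad : ℕ → Vec d → Vec d} {T : ℕ}

theorem state_valid (hP : P.Admissible)
    (hgrad : ∀ t ∈ Finset.Icc 1 T, ∀ x ∈ P.Ω, ‖grad t x‖ ≤ P.G) {t : ℕ} (ht : t ≤ T) :
    ValidState P (state P grad t) := by
  induction t with
  | zero => exact ⟨fun J => malerInit_valid hP _, fun _ => le_rfl, fun _ => one_pos⟩
  | succ t ih =>
    exact step_valid hP (ih (by omega)) (by omega) (hgrad _ (Finset.mem_Icc.2 ⟨by omega, ht⟩))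

theorem decision_mem (hP : P.Admissible)
    (hgrad : ∀ t ∈ Finset.Icc 1 T, ∀ x ∈ P.Ω, ‖grad t x‖ ≤ P.G) {t : ℕ}
    (ht : t ∈ Finset.Icc 1 T) : decision P grad t ∈ P.Ω := by
  obtain ⟨h1, h2⟩ := Finset.mem_Icc.1 ht
  exact play_mem hP (state_valid hP hgrad (by omega)) h1

/-- The geometric covering intervals that start up to round `Q`. -/
def started (Q : ℕ) : Finset (ℕ × ℕ) :=
  (Finset.range Q ×ˢ Finset.range (Q + 1)).filter (fun J => 1 ≤ J.2 ∧ gcStart J ≤ Q)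

theorem mem_started {Q : ℕ} {J : ℕ × ℕ} : J ∈ started Q ↔ 1 ≤ J.2 ∧ gcStart J ≤ Q := by
  simp only [started, Finset.mem_filter, Finset.mem_product, Finset.mem_range]
  refine ⟨fun h => h.2, fun h => ⟨?_, h⟩⟩
  obtain ⟨h1, h2⟩ := h
  unfold gcStart at h2
  have h3 := Nat.lt_two_pow_self (n := J.1)
  constructor
  · nlinarith
  · nlinarith [Nat.one_le_two_pow (n := J.1)]

/-- There are at most `Q / 2 ^ k` intervals of length `2 ^ k`. -/
theorem card_started_le (Q : ℕ) : ((started Q).card : ℝ) ≤ 2 * Q := by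
  have h1 : started Q ⊆ ((Finset.range Q).sigma (fun k => Finset.Icc 1 (Q / 2 ^ k))).map
      (Equiv.sigmaEquivProd ℕ ℕ).toEmbedding := by
    intro J hJ
    have hJ' := mem_started.1 hJ
    simp only [started, Finset.mem_filter, Finset.mem_product] at hJ
    simp only [Finset.mem_map_equiv, Finset.mem_sigma, Equiv.sigmaEquivProd_symm_apply,
      Finset.mem_Icc]
    exact ⟨hJ.1.1, hJ'.1, (Nat.le_div_iff_mul_le (by positivity)).2 hJ'.2⟩
  have h2 := Finset.card_le_card h1
  rw [Finset.card_map, Finset.card_sigma] at h2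
  simp only [Nat.card_Icc, Nat.add_sub_cancel] at h2
  have h3 : ((started Q).card : ℝ) ≤ ∑ k ∈ Finset.range Q, (Q : ℝ) * (1 / 2) ^ k := by
    refine le_trans (Nat.cast_le.2 h2) ?_
    rw [Nat.cast_sum]
    refine Finset.sum_le_sum fun k _ => ?_
    refine Nat.cast_div_le.trans (le_of_eq ?_)
    push_cast
    rw [one_div, inv_pow, div_eq_mul_inv]
  refine h3.trans ?_
  rw [← Finset.mul_sum, geom_sum_eq (by norm_num)]
  have : (0 : ℝ) ≤ (1 / 2) ^ Q := by positivity
  have hQ : (0 : ℝ) ≤ Q := by positivity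
  have h4 : ((1 / 2 : ℝ) ^ Q - 1) / (1 / 2 - 1) ≤ 2 := by
    rw [div_le_iff_of_neg (by norm_num)]
    linarith
  nlinarith

/-- The advantages are at most `1 / 2` in absolute value, so their squares add up to at most
`t / 4`. -/
theorem state_L_le (hP : P.Admissible)
    (hgrad : ∀ t ∈ Finset.Icc 1 T, ∀ x ∈ P.Ω, ‖grad t x‖ ≤ P.G) {t : ℕ} (ht : t ≤ T)
    (J : ℕ × ℕ) : (state P grad t J).L ≤ t / 4 := by
  induction t with
  | zero => simp [state, init]
  | succ t ih =>
    have h := ih (by omega)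
    have hS := state_valid hP hgrad (by omega : t ≤ T)
    have h1 := abs_le.1 (abs_metaLoss_sub_expertLoss_le hP hS (by omega : 1 ≤ t + 1)
      (hgrad _ (Finset.mem_Icc.2 ⟨by omega, ht⟩)) J)
    simp only [state, step]
    push_cast
    split_ifs
    · simp only [nextL]
      nlinarith [sq_le_sq' h1.1 h1.2]
    · linarith

/-- The total mass of the experts that have started grows at most polynomially. -/
theorem state_x_le (hP : P.Admissible)
    (hgrad : ∀ t ∈ Finset.Icc 1 T, ∀ x ∈ P.Ω, ‖grad t x‖ ≤ P.G) {Q : ℕ} (hQ1 : 1 ≤ Q)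
    (hQ : Q ≤ T) {J : ℕ × ℕ} (hJ : J ∈ started Q) : (state P grad Q J).x ≤ 4 * (Q : ℝ) ^ 2 := by
  have hpot : ∀ t ≤ Q, ∑ J ∈ started Q,
      ((state P grad t J).x - 1 / 2 * Real.log (1 + (state P grad t J).L)) ≤
        (started Q).card := by
    intro t
    induction t with
    | zero => simp [state, init]
    | succ t ih =>
      intro ht
      refine le_trans ?_ (ih (by omega))
      have hS := state_valid hP hgrad (by omega : t ≤ T)
      have hgr := hgrad (t + 1) (Finset.mem_Icc.2 ⟨by omega, by omega⟩)
      have hsub : active (t + 1) ⊆ started Q := fun J hJ => by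
        obtain ⟨h1, h2, -⟩ := mem_active.1 hJ
        exact mem_started.2 ⟨h1, by omega⟩
      have hzero := sum_rate_mul_metaLoss_sub_expertLoss (gr := grad (t + 1)) hS
        (by omega : 1 ≤ t + 1)
      rw [← Finset.sum_sdiff hsub, ← Finset.sum_sdiff (f := fun J =>
        (state P grad t J).x - 1 / 2 * Real.log (1 + (state P grad t J).L)) hsub]
      refine add_le_add (Finset.sum_le_sum fun J hJ => ?_) ?_
      · rw [state, step, if_neg (Finset.mem_sdiff.1 hJ).2]
      · refine (Finset.sum_le_sum fun J hJ =>
          potential_step_le hP hS (by omega : 1 ≤ t + 1) hgr hJ).trans ?_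
        rw [Finset.sum_add_distrib, hzero, add_zero]
  have hS := state_valid hP hgrad hQ
  have hQ' : (1 : ℝ) ≤ Q := by exact_mod_cast hQ1
  have h1 := hpot Q le_rfl
  rw [Finset.sum_sub_distrib] at h1
  have h2 : ∑ J ∈ started Q, 1 / 2 * Real.log (1 + (state P grad Q J).L) ≤
      ∑ J ∈ started Q, (Q : ℝ) / 8 := by
    refine Finset.sum_le_sum fun J _ => ?_
    have h3 := state_L_le hP hgrad hQ J
    have h4 := hS.L_nonneg J
    have := Real.log_le_sub_one_of_pos (x := 1 + (state P grad Q J).L) (by linarith)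
    linarith
  rw [Finset.sum_const, nsmul_eq_mul] at h2
  have h3 := card_started_le Q
  have h4 : (state P grad Q J).x ≤ ∑ J ∈ started Q, (state P grad Q J).x :=
    Finset.single_le_sum (f := fun J => (state P grad Q J).x) (fun J _ => (hS.x_pos J).le) hJ
  nlinarith

end Run

/-- The telescoping estimate for the second-order terms; `r² ≤ 1 / 4` gives the constant `9 / 4`. -/
theorem sq_div_sqrt_le {a r : ℝ} (ha : 1 ≤ a) (hr : r ^ 2 ≤ 1 / 4) :
    r ^ 2 / √a ≤ 9 / 4 * (√(a + r ^ 2) - √a) := by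
  have ha0 : 0 < √a := Real.sqrt_pos.2 (by linarith)
  have h1 : √a ^ 2 = a := Real.sq_sqrt (by linarith)
  have h2 : √(a + r ^ 2) ^ 2 = a + r ^ 2 := Real.sq_sqrt (by positivity)
  have h3 : √(a + r ^ 2) ≤ 5 / 4 * √a := by
    rw [Real.sqrt_le_left (by positivity), mul_pow, h1]
    linarith
  have h4 : √a ≤ √(a + r ^ 2) := Real.sqrt_le_sqrt (by linarith [sq_nonneg r])
  rw [div_le_iff₀ ha0]
  have h5 : r ^ 2 = (√(a + r ^ 2) - √a) * (√(a + r ^ 2) + √a) := by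
    linear_combination h1 - h2
  have h6 : (√(a + r ^ 2) - √a) * (√(a + r ^ 2) + √a) ≤
      (√(a + r ^ 2) - √a) * (9 / 4 * √a) :=
    mul_le_mul_of_nonneg_left (by linarith) (by linarith)
  linarith

/-- The second-order bound of Adapt-ML-Prod: the total advantage over an expert in terms of its
final mass and of the squares of the advantages. -/
theorem sum_le_of_prod_update {A : ℝ} (hA : 0 < A) {Δ : ℝ → ℝ}
    (hΔ : ∀ L, Δ L = min (1 / 2) √(A / (1 + L))) {L x r : ℕ → ℝ} {n : ℕ} (hL0 : L 0 = 0)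
    (hx0 : x 0 = 1) (hL : ∀ t < n, L (t + 1) = L t + r t ^ 2)
    (hx : ∀ t < n, x (t + 1) = (x t * (1 + Δ (L t) * r t)) ^ (Δ (L (t + 1)) / Δ (L t)))
    (hr : ∀ t < n, |r t| ≤ 1 / 2) (hxn : Real.log (x n) ≤ A) :
    ∑ t ∈ Finset.range n, r t ≤
      2 * A + 13 / 4 * √(A * (1 + ∑ t ∈ Finset.range n, r t ^ 2)) := by
  have hΔpos : ∀ L, 0 ≤ L → 0 < Δ L := fun L hL => by
    rw [hΔ]; exact lt_min (by norm_num) (Real.sqrt_pos.2 (by positivity))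
  have h : ∀ m ≤ n, 0 < x m ∧ L m = ∑ t ∈ Finset.range m, r t ^ 2 ∧
      ∑ t ∈ Finset.range m, r t ≤
        Real.log (x m) / Δ (L m) + 9 / 4 * √A * (√(1 + L m) - 1) := by
    intro m
    induction m with
    | zero => simp [hL0, hx0]
    | succ m ih =>
      intro hm
      have hm' : m < n := hm
      obtain ⟨hxp, hLm, hs⟩ := ih hm'.le
      have hL0 : 0 ≤ L m := by rw [hLm]; exact Finset.sum_nonneg fun _ _ => sq_nonneg _
      have hL1 : 0 ≤ L (m + 1) := by rw [hL m hm']; positivity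
      have hrm := abs_le.1 (hr m hm')
      have hd := hΔpos _ hL0
      have hd1 := hΔpos _ hL1
      have hdle : Δ (L m) ≤ 1 / 2 := by rw [hΔ]; exact min_le_left _ _
      have hz : -(1 / 2) ≤ Δ (L m) * r m := by nlinarith
      have hz0 : 0 < 1 + Δ (L m) * r m := by linarith
      refine ⟨?_, ?_, ?_⟩
      · rw [hx m hm']; positivity
      · rw [hL m hm', Finset.sum_range_succ, hLm]
      · rw [Finset.sum_range_succ]
        have h1 : Real.log (x (m + 1)) / Δ (L (m + 1)) =
            Real.log (x m) / Δ (L m) + Real.log (1 + Δ (L m) * r m) / Δ (L m) := by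
          rw [hx m hm', Real.log_rpow (by positivity), Real.log_mul hxp.ne' hz0.ne']
          field_simp
        have h2 : r m - Δ (L m) * r m ^ 2 ≤ Real.log (1 + Δ (L m) * r m) / Δ (L m) := by
          rw [le_div_iff₀ hd]
          have := sub_sq_le_log_one_add hz
          linarith
        have h3 : Δ (L m) * r m ^ 2 ≤ 9 / 4 * √A * (√(1 + L (m + 1)) - √(1 + L m)) := by
          have h4 : Δ (L m) ≤ √A / √(1 + L m) := by
            rw [hΔ, ← Real.sqrt_div hA.le]; exact min_le_right _ _
          have h5 : r m ^ 2 ≤ 1 / 4 := by nlinarith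
          have h6 := sq_div_sqrt_le (a := 1 + L m) (by linarith) h5
          rw [add_assoc, ← hL m hm'] at h6
          calc Δ (L m) * r m ^ 2 ≤ √A / √(1 + L m) * r m ^ 2 := by gcongr
            _ = √A * (r m ^ 2 / √(1 + L m)) := by ring
            _ ≤ √A * (9 / 4 * (√(1 + L (m + 1)) - √(1 + L m))) := by gcongr
            _ = _ := by ring
        rw [h1]
        linarith
  obtain ⟨hxp, hLn, hs⟩ := h n le_rfl
  rw [← hLn]
  have hL0' : 0 ≤ L n := by rw [hLn]; exact Finset.sum_nonneg fun _ _ => sq_nonneg _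
  have hd := hΔpos _ hL0'
  have h1 : Real.log (x n) / Δ (L n) ≤ A / Δ (L n) := by gcongr
  have h2 : A / Δ (L n) ≤ 2 * A + √(A * (1 + L n)) := by
    rw [hΔ]
    have hs0 : 0 < √(A / (1 + L n)) := Real.sqrt_pos.2 (by positivity)
    have h3 : A / √(A / (1 + L n)) = √(A * (1 + L n)) := by
      rw [Real.sqrt_div hA.le, Real.sqrt_mul hA.le, div_div_eq_mul_div, div_eq_iff (by positivity)]
      have := Real.mul_self_sqrt hA.le
      linear_combination (-√(1 + L n)) * this
    rcases min_choice (1 / 2) √(A / (1 + L n)) with h | h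
    · rw [h]
      have := Real.sqrt_nonneg (A * (1 + L n))
      linarith
    · rw [h, h3]; linarith
  have h3 : √(A * (1 + L n)) = √A * √(1 + L n) := Real.sqrt_mul hA.le _
  have h4 : 0 ≤ √A := Real.sqrt_nonneg _
  rw [h3] at h2 ⊢
  linarith

section Interval

variable {d : ℕ} {P : Params d} {grad : ℕ → Vec d → Vec d} {T : ℕ}

theorem sum_Icc_gc (J : ℕ × ℕ) (F : ℕ → ℝ) :
    ∑ t ∈ Finset.Icc (gcStart J) (gcEnd J), F t =
      ∑ i ∈ Finset.range (gcLen J), F (gcStart J + i) := by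
  change ∑ t ∈ Finset.Ico (gcStart J) (gcEnd J + 1), F t = _
  rw [Finset.sum_Ico_eq_sum_range, gcEnd_add_one, Nat.add_sub_cancel_left]

theorem state_eq_init {J : ℕ × ℕ} {t : ℕ} (ht : t < gcStart J) :
    state P grad t J = init P J := by
  induction t with
  | zero => rfl
  | succ t ih =>
    rw [state, step, if_neg, ih (by omega)]
    intro h
    have := (mem_active.1 h).2.1
    omega

/-- The Maler instance of `J` goes through a run of its own, driven by the gradients of the rounds
of `J`. -/
theorem state_maler_eq {J : ℕ × ℕ} (hJ : 1 ≤ J.2) {i : ℕ} (hi : i ≤ gcLen J) :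
    (state P grad (gcStart J - 1 + i) J).maler =
      malerRun P (gcLen J) (fun i => grad (gcStart J + i)) i := by
  have hs := gcStart_pos hJ
  induction i with
  | zero => rw [state_eq_init (by omega)]; rfl
  | succ i ih =>
    have hact : J ∈ active (gcStart J - 1 + i + 1) := by
      have := gcEnd_add_one J
      exact mem_active.2 ⟨hJ, by omega, by omega⟩
    rw [← add_assoc, state, step, if_pos hact, malerRun, expertPlay, ih (by omega)]
    have : gcStart J - 1 + i + 1 = gcStart J + i := by omega
    rw [this]

/-- What the expert of `J` plays in round `t`. -/
noncomputable def expertDecision {d : ℕ} (P : Params d) (grad : ℕ → Vec d → Vec d) (J : ℕ × ℕ)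
    (t : ℕ) : Vec d := expertPlay P (state P grad (t - 1)) J

theorem expertDecision_eq {J : ℕ × ℕ} (hJ : 1 ≤ J.2) {i : ℕ} (hi : i < gcLen J) :
    expertDecision P grad J (gcStart J + i) =
      malerPt P (gcLen J) (fun i => grad (gcStart J + i)) i := by
  have hs := gcStart_pos hJ
  rw [expertDecision, expertPlay, malerPt, ← state_maler_eq hJ hi.le]
  congr 4
  omega

theorem expertDecision_mem (hP : P.Admissible)
    (hgrad : ∀ t ∈ Finset.Icc 1 T, ∀ x ∈ P.Ω, ‖grad t x‖ ≤ P.G) (J : ℕ × ℕ) {t : ℕ}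
    (ht : t ∈ Finset.Icc 1 T) : expertDecision P grad J t ∈ P.Ω := by
  obtain ⟨h1, h2⟩ := Finset.mem_Icc.1 ht
  exact expertPlay_mem hP (state_valid hP hgrad (by omega)) J

/-- The regret of the meta-algorithm against the expert of `J`. -/
theorem meta_regret_le (hP : P.Admissible)
    (hgrad : ∀ t ∈ Finset.Icc 1 T, ∀ x ∈ P.Ω, ‖grad t x‖ ≤ P.G) {J : ℕ × ℕ} (hJ : 1 ≤ J.2)
    (hJT : gcEnd J ≤ T) :
    ∑ t ∈ Finset.Icc (gcStart J) (gcEnd J),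
      inner ℝ (grad t (decision P grad t)) (decision P grad t - expertDecision P grad J t) ≤
    4 * (P.G * P.D) * Real.log (4 * (gcEnd J : ℝ) ^ 2) +
      13 / 4 * √(Real.log (4 * (gcEnd J : ℝ) ^ 2) * ((2 * (P.G * P.D)) ^ 2 +
        ∑ t ∈ Finset.Icc (gcStart J) (gcEnd J),
          inner ℝ (grad t (decision P grad t))
            (decision P grad t - expertDecision P grad J t) ^ 2)) := by
  have hG := hP.G_pos
  have hD := hP.D_pos
  have hs := gcStart_pos hJ
  have hend := gcEnd_add_one J
  have hlen := one_le_gcLen J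
  set A := Real.log (4 * (gcEnd J : ℝ) ^ 2) with hA
  have hA1 : 1 ≤ A := one_le_log_four_mul_sq (one_le_gcEnd hJ)
  set z : ℕ → ℝ := fun t =>
    inner ℝ (grad t (decision P grad t)) (decision P grad t - expertDecision P grad J t) with hz
  set S : ℕ → State d := fun i => state P grad (gcStart J - 1 + i) with hS
  have hidx : ∀ i, gcStart J - 1 + i + 1 = gcStart J + i := fun i => by omega
  have hact : ∀ i < gcLen J, J ∈ active (gcStart J + i) := fun i hi =>
    mem_active.2 ⟨hJ, by omega, by omega⟩
  have hstep : ∀ i, S (i + 1) = step P (grad (gcStart J + i)) (S i) (gcStart J + i) := fun i => by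
    simp only [hS]
    rw [← add_assoc, state, hidx]
  have hvalid : ∀ i < gcLen J, ValidState P (S i) := fun i hi =>
    state_valid hP hgrad (by omega)
  have hgr : ∀ i < gcLen J, ∀ x ∈ P.Ω, ‖grad (gcStart J + i) x‖ ≤ P.G := fun i hi =>
    hgrad _ (Finset.mem_Icc.2 ⟨by omega, by omega⟩)
  have hgap : ∀ i < gcLen J, metaLoss P (grad (gcStart J + i)) (S i) (gcStart J + i) -
      expertLoss P (grad (gcStart J + i)) (S i) (gcStart J + i) J =
        z (gcStart J + i) / (2 * P.G * P.D) := by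
    intro i hi
    rw [metaLoss_sub_expertLoss hP (hvalid i hi) (by omega)]
    have : gcStart J + i - 1 = gcStart J - 1 + i := by omega
    simp only [hz, hS, decision, expertDecision, this]
  have hxn : Real.log (S (gcLen J) J).x ≤ A := by
    have hQ : gcStart J - 1 + gcLen J = gcEnd J := by omega
    have h1 := state_x_le hP hgrad (one_le_gcEnd hJ) hJT
      (mem_started.2 ⟨hJ, by omega⟩ : J ∈ started (gcEnd J))
    simp only [hS]
    rw [hQ]
    exact Real.log_le_log ((state_valid hP hgrad hJT).x_pos J) h1
  have h := sum_le_of_prod_update (A := A) (by linarith) (Δ := rate J) (fun L => rfl)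
    (L := fun i => (S i J).L) (x := fun i => (S i J).x)
    (r := fun i => z (gcStart J + i) / (2 * P.G * P.D)) (n := gcLen J)
    (by simp only [hS]; rw [state_eq_init (by omega)]; rfl)
    (by simp only [hS]; rw [state_eq_init (by omega)]; rfl)
    (fun i hi => by
      simp only [hstep, step, if_pos (hact i hi), nextL, hgap i hi])
    (fun i hi => by
      simp only [hstep, step, if_pos (hact i hi), hgap i hi])
    (fun i hi => by
      rw [← hgap i hi]
      exact abs_metaLoss_sub_expertLoss_le hP (hvalid i hi) (by omega) (hgr i hi) J)
    hxn
  rw [sum_Icc_gc J z, sum_Icc_gc J (fun t => z t ^ 2)]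
  simp only [div_pow, ← Finset.sum_div] at h
  rw [div_le_iff₀ (by positivity)] at h
  refine h.trans (le_of_eq ?_)
  set V := ∑ i ∈ Finset.range (gcLen J), z (gcStart J + i) ^ 2
  have h1 : A * ((2 * (P.G * P.D)) ^ 2 + V) =
      (2 * (P.G * P.D)) ^ 2 * (A * (1 + V / (2 * P.G * P.D) ^ 2)) := by
    field_simp
  rw [h1, Real.sqrt_mul (sq_nonneg (2 * (P.G * P.D))), Real.sqrt_sq (by positivity)]
  ring

end Interval

/-! ### Regret over one geometric covering interval -/

theorem Setting.admissible {d : ℕ} {Ω : Set (Vec d)} {D G : ℝ} {x₁ : Vec d} {T : ℕ}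
    {f : ℕ → Vec d → ℝ} {grad : ℕ → Vec d → Vec d} (h : Setting Ω D G x₁ T f grad)
    (hG : 0 < G) (hD : 0 < D) : (⟨Ω, D, G, x₁⟩ : Params d).Admissible :=
  ⟨h.isClosed, h.convex, h.init_mem, h.diam_le, hD, hG⟩

/-- An interval inside `[p, q]` ends at `q` or before, so its confidence term is at most
`c q / 16`; this slack pays for all lower-order terms. -/
theorem log_four_mul_sq_le {s q : ℕ} (hs : 1 ≤ s) (hsq : s ≤ q) :
    16 * Real.log (4 * (s : ℝ) ^ 2) ≤ c q := by
  have hs' : (1 : ℝ) ≤ s := by exact_mod_cast hs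
  have hsq' : (s : ℝ) ≤ q := by exact_mod_cast hsq
  have h1 : Real.log (4 * (s : ℝ) ^ 2) ≤ Real.log ((2 * (q : ℝ)) ^ 2) := by
    apply Real.log_le_log (by positivity)
    rw [mul_pow]
    norm_num
    gcongr
  rw [Real.log_pow] at h1
  unfold c
  push_cast at h1
  linarith

theorem c_le_log {q : ℕ} (hq : 2 ≤ q) : c q ≤ 64 * Real.log q := by
  have hq' : (2 : ℝ) ≤ q := by exact_mod_cast hq
  have : Real.log (2 * q) ≤ Real.log ((q : ℝ) ^ 2) :=
    Real.log_le_log (by positivity) (by nlinarith)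
  rw [Real.log_pow] at this
  push_cast at this
  rw [c]
  linarith

theorem sixteen_le_c {q : ℕ} (hq : 1 ≤ q) : 16 ≤ c q := by
  have := log_four_mul_sq_le hq le_rfl
  have := one_le_log_four_mul_sq hq
  linarith

section Interval

variable {d : ℕ} {P : Params d} {grad : ℕ → Vec d → Vec d} {T q : ℕ} {J : ℕ × ℕ}

/-- Curvature absorbs the second-order term of the regret of the meta-algorithm. -/
theorem meta_regret_sub_sq_le (hP : P.Admissible)
    (hgrad : ∀ t ∈ Finset.Icc 1 T, ∀ x ∈ P.Ω, ‖grad t x‖ ≤ P.G) (hJ : 1 ≤ J.2)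
    (hJq : gcEnd J ≤ q) (hqT : q ≤ T) {β : ℝ} (hβ : 0 < β) :
    ∑ t ∈ Finset.Icc (gcStart J) (gcEnd J),
      (inner ℝ (grad t (decision P grad t)) (decision P grad t - expertDecision P grad J t) -
        β / 2 * inner ℝ (grad t (decision P grad t))
          (decision P grad t - expertDecision P grad J t) ^ 2) ≤
      (P.G * P.D + 1 / (2 * β)) * c q := by
  have hGD := mul_pos hP.G_pos hP.D_pos
  have h := meta_regret_le hP hgrad hJ (hJq.trans hqT)
  have hA1 := one_le_log_four_mul_sq (one_le_gcEnd hJ)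
  have hAc := log_four_mul_sq_le (one_le_gcEnd hJ) hJq
  rw [Finset.sum_sub_distrib, ← Finset.mul_sum]
  set A := Real.log (4 * (gcEnd J : ℝ) ^ 2)
  set V := ∑ t ∈ Finset.Icc (gcStart J) (gcEnd J), inner ℝ (grad t (decision P grad t))
    (decision P grad t - expertDecision P grad J t) ^ 2
  have hV : 0 ≤ V := Finset.sum_nonneg fun _ _ => sq_nonneg _
  have hbc : (P.G * P.D + 1 / (2 * β)) * (16 * A) ≤ (P.G * P.D + 1 / (2 * β)) * c q := by gcongr
  have h1 : √(A * ((2 * (P.G * P.D)) ^ 2 + V)) ≤ 2 * (P.G * P.D) * A + √(A * V) := by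
    have e1 : √(A * V) ^ 2 = A * V := Real.sq_sqrt (by positivity)
    have e2 : 0 ≤ 2 * (P.G * P.D) * A * √(A * V) := by positivity
    have e3 : (2 * (P.G * P.D)) ^ 2 * A ≤ (2 * (P.G * P.D)) ^ 2 * A ^ 2 := by
      gcongr; nlinarith
    rw [Real.sqrt_le_left (by positivity), add_sq, e1]
    linarith
  have h2 : 13 / 4 * √(A * V) ≤ 169 / 32 * A / β + β / 2 * V := by
    rw [Real.sqrt_mul (by linarith)]
    have e1 : √A ^ 2 = A := Real.sq_sqrt (by linarith)
    have e2 : √V ^ 2 = V := Real.sq_sqrt hV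
    have e3 : 169 / 32 * A / β + β / 2 * V - 13 / 4 * (√A * √V) =
        1 / (2 * β) * (13 / 4 * √A - β * √V) ^ 2 := by
      rw [← e1, ← e2, Real.sqrt_sq (Real.sqrt_nonneg _), Real.sqrt_sq (Real.sqrt_nonneg _)]
      field_simp
      ring
    have e4 : 0 ≤ 1 / (2 * β) * (13 / 4 * √A - β * √V) ^ 2 := by positivity
    linarith
  have h3 : (P.G * P.D + 1 / (2 * β)) * (16 * A) = 16 * (P.G * P.D) * A + 8 * A / β := by
    field_simp
    ring
  -- `169 / 32 = (13 / 4)² / 2` comes from completing the square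
  have h4 : 169 / 32 * A / β ≤ 8 * A / β := by gcongr; norm_num
  have h5 : 0 < P.G * P.D * A := by positivity
  linarith

/-- Without curvature the squared advantages are bounded by the length of the interval. -/
theorem meta_regret_le_sqrt (hP : P.Admissible)
    (hgrad : ∀ t ∈ Finset.Icc 1 T, ∀ x ∈ P.Ω, ‖grad t x‖ ≤ P.G) (hJ : 1 ≤ J.2)
    (hJq : gcEnd J ≤ q) (hqT : q ≤ T) :
    ∑ t ∈ Finset.Icc (gcStart J) (gcEnd J),
      inner ℝ (grad t (decision P grad t)) (decision P grad t - expertDecision P grad J t) ≤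
      P.G * P.D * (c q + √(c q) * √(gcLen J)) := by
  have hGD := mul_pos hP.G_pos hP.D_pos
  have hs := gcStart_pos hJ
  have h := meta_regret_le hP hgrad hJ (hJq.trans hqT)
  have hA1 := one_le_log_four_mul_sq (one_le_gcEnd hJ)
  have hAc := log_four_mul_sq_le (one_le_gcEnd hJ) hJq
  set A := Real.log (4 * (gcEnd J : ℝ) ^ 2)
  set V := ∑ t ∈ Finset.Icc (gcStart J) (gcEnd J), inner ℝ (grad t (decision P grad t))
    (decision P grad t - expertDecision P grad J t) ^ 2
  have hV : V ≤ (P.G * P.D) ^ 2 * gcLen J := by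
    have h1 : V ≤ ∑ t ∈ Finset.Icc (gcStart J) (gcEnd J), (P.G * P.D) ^ 2 := by
      refine Finset.sum_le_sum fun t ht => ?_
      have ht' : t ∈ Finset.Icc 1 T := by
        rw [Finset.mem_Icc] at ht ⊢
        omega
      have hw := decision_mem hP hgrad ht'
      have := abs_le.1 (hP.abs_inner_le (hgrad t ht' _ hw) hw (expertDecision_mem hP hgrad J ht'))
      exact sq_le_sq' this.1 this.2
    rw [sum_Icc_gc] at h1
    simpa [mul_comm] using h1
  have hcA : A ≤ c q / 16 := by linarith
  have hsA : √A ≤ √(c q) / 4 := by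
    have : c q / 16 = c q / 4 ^ 2 := by norm_num
    rw [this] at hcA
    refine (Real.sqrt_le_sqrt hcA).trans (le_of_eq ?_)
    rw [Real.sqrt_div' _ (by norm_num), Real.sqrt_sq (by norm_num)]
  have hsA1 : √A ≤ A := by
    rw [Real.sqrt_le_left (by linarith)]; nlinarith
  have h1 : √(A * ((2 * (P.G * P.D)) ^ 2 + V)) ≤
      √A * (2 * (P.G * P.D) + P.G * P.D * √(gcLen J)) := by
    rw [Real.sqrt_mul (by linarith)]
    gcongr
    rw [Real.sqrt_le_left (by positivity)]
    have e1 : √(gcLen J : ℝ) ^ 2 = gcLen J := Real.sq_sqrt (by positivity)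
    have e2 : 0 ≤ 2 * (P.G * P.D) * (P.G * P.D * √(gcLen J)) := by positivity
    calc (2 * (P.G * P.D)) ^ 2 + V ≤ (2 * (P.G * P.D)) ^ 2 + (P.G * P.D) ^ 2 * gcLen J := by
          gcongr
      _ = (2 * (P.G * P.D)) ^ 2 + (P.G * P.D * √(gcLen J)) ^ 2 := by
          rw [mul_pow (P.G * P.D) √(gcLen J : ℝ), e1]
      _ ≤ _ := by linarith [add_sq (2 * (P.G * P.D)) (P.G * P.D * √(gcLen J))]
  have h2 : P.G * P.D * √A ≤ P.G * P.D * A := by gcongr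
  have h3 : P.G * P.D * A ≤ P.G * P.D * (c q / 16) := by gcongr
  have h4 : P.G * P.D * √(gcLen J) * √A ≤ P.G * P.D * √(gcLen J) * (√(c q) / 4) := by gcongr
  have h5 : 0 ≤ P.G * P.D * √(gcLen J) * √(c q) := by positivity
  have h6 : 0 < P.G * P.D * A := by positivity
  linarith

theorem sum_expertDecision (hJ : 1 ≤ J.2) (F : Vec d → Vec d → ℝ) :
    ∑ t ∈ Finset.Icc (gcStart J) (gcEnd J),
      F (grad t (expertDecision P grad J t)) (expertDecision P grad J t) =
    ∑ i ∈ Finset.range (gcLen J),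
      F (malerGrad P (gcLen J) (fun i => grad (gcStart J + i)) i)
        (malerPt P (gcLen J) (fun i => grad (gcStart J + i)) i) := by
  rw [sum_Icc_gc]
  refine Finset.sum_congr rfl fun i hi => ?_
  rw [expertDecision_eq hJ (Finset.mem_range.1 hi)]
  rfl

theorem norm_grad_gc_le
    (hgrad : ∀ t ∈ Finset.Icc 1 T, ∀ x ∈ P.Ω, ‖grad t x‖ ≤ P.G) (hJ : 1 ≤ J.2)
    (hJT : gcEnd J ≤ T) : ∀ i < gcLen J, ∀ x ∈ P.Ω, ‖grad (gcStart J + i) x‖ ≤ P.G := by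
  intro i hi
  have := gcStart_pos hJ
  have := gcEnd_add_one J
  exact hgrad _ (Finset.mem_Icc.2 ⟨by omega, by omega⟩)

end Interval

section Losses

variable {d : ℕ} {Ω : Set (Vec d)} {D G : ℝ} {x₁ : Vec d} {T : ℕ} {f : ℕ → Vec d → ℝ}
  {grad : ℕ → Vec d → Vec d} {p q : ℕ} {J : ℕ × ℕ} {w : Vec d}

theorem gcLen_le (hJp : p ≤ gcStart J) (hJq : gcEnd J ≤ q) : gcLen J ≤ q - p + 1 := by
  have := gcEnd_add_one J
  omega

theorem log_gcLen_le (hpq : p ≤ q) (hJp : p ≤ gcStart J) (hJq : gcEnd J ≤ q) :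
    Real.log (gcLen J) ≤ Real.log ((q : ℝ) - p + 1) := by
  have h0 : (0 : ℝ) < gcLen J := by exact_mod_cast one_le_gcLen J
  apply Real.log_le_log h0
  have : (gcLen J : ℝ) ≤ ((q - p + 1 : ℕ) : ℝ) := by exact_mod_cast gcLen_le hJp hJq
  rwa [Nat.cast_add, Nat.cast_sub hpq, Nat.cast_one] at this

theorem Xi_nonneg (hpq : p ≤ q) : 0 ≤ Xi p q := by
  have h1 := two_mul_log_malerK_le_Xi (n := 1) le_rfl hpq (by omega)
  have h2 := one_le_two_mul_log_malerK 1
  linarith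

theorem log_range_nonneg (hpq : p ≤ q) : 0 ≤ Real.log ((q : ℝ) - p + 1) := by
  have : (p : ℝ) ≤ q := by exact_mod_cast hpq
  exact Real.log_nonneg (by linarith)

theorem beta_pos (hG : 0 < G) (hD : 0 < D) {α : ℝ} (hα : 0 < α) : 0 < beta G D α := by
  have : 0 < min (1 / (4 * G * D)) α := lt_min (by positivity) hα
  unfold beta
  positivity

/-- The regret over one interval splits at the decisions of its expert; exp-concavity is used once
at the decision and once at the output of the expert. -/
theorem sum_expConcave_le (hS : Setting Ω D G x₁ T f grad) (hG : 0 < G) (hD : 0 < D)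
    (hp : 1 ≤ p) (hpq : p ≤ q) (hqT : q ≤ T) (hw : w ∈ Ω) {α : ℝ} (hα : 0 < α)
    (hf : ∀ t ∈ Finset.Icc p q, ExpConcaveOn Ω α (f t)) (hJ : 1 ≤ J.2) (hJp : p ≤ gcStart J)
    (hJq : gcEnd J ≤ q) :
    ∑ t ∈ Finset.Icc (gcStart J) (gcEnd J), (f t (decision ⟨Ω, D, G, x₁⟩ grad t) - f t w) ≤
      (10 * G * D + 9 / (2 * beta G D α)) *
        (c q + Xi p q + 10 * d * Real.log ((q : ℝ) - p + 1)) := by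
  set P : Params d := ⟨Ω, D, G, x₁⟩ with hPdef
  have hP : P.Admissible := hS.admissible hG hD
  have hgrad : ∀ t ∈ Finset.Icc 1 T, ∀ x ∈ P.Ω, ‖grad t x‖ ≤ P.G := hS.grad_le
  have hβ := beta_pos hG hD hα
  have hβ1 : 2 * beta G D α ≤ α := by
    rw [beta]; linarith [min_le_right (1 / (4 * G * D)) α]
  have hβ2 : 2 * beta G D α * (G * D) ≤ 1 / 4 := by
    have : 2 * beta G D α ≤ 1 / (4 * G * D) := by
      rw [beta]; linarith [min_le_left (1 / (4 * G * D)) α]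
    refine (mul_le_mul_of_nonneg_right this (by positivity)).trans (le_of_eq ?_)
    field_simp
  set β := beta G D α
  have hGD : 0 < G * D := mul_pos hG hD
  have hc := sixteen_le_c (hp.trans hpq)
  have hXi := Xi_nonneg hpq
  have hlog := log_range_nonneg hpq
  -- in dimension zero there is only one point, hence no regret
  rcases Nat.eq_zero_or_pos d with rfl | hd
  · rw [Finset.sum_eq_zero fun t _ => by rw [Subsingleton.elim (decision P grad t) w, sub_self]]
    positivity
  set y := expertDecision P grad J
  have hterm : ∀ t ∈ Finset.Icc (gcStart J) (gcEnd J), f t (decision P grad t) - f t w ≤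
      (inner ℝ (grad t (decision P grad t)) (decision P grad t - y t) -
        β / 2 * inner ℝ (grad t (decision P grad t)) (decision P grad t - y t) ^ 2) +
      (inner ℝ (grad t (y t)) (y t - w) - β / 2 * inner ℝ (grad t (y t)) (y t - w) ^ 2) := by
    intro t ht
    rw [Finset.mem_Icc] at ht
    have htT : t ∈ Finset.Icc 1 T := Finset.mem_Icc.2 ⟨by omega, by omega⟩
    have htf := hf t (Finset.mem_Icc.2 ⟨by omega, by omega⟩)
    have hlow : ∀ x ∈ Ω, ∀ z ∈ Ω, f t x - f t z ≤
        inner ℝ (grad t x) (x - z) - β / 2 * inner ℝ (grad t x) (x - z) ^ 2 := by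
      intro x hx z hz
      have := htf.add_inner_add_sq_le hα hβ hβ1 hβ2 hx hz (hS.hasGradient t htT x hx)
        (hP.abs_inner_le (hgrad t htT x hx) hz hx)
      rw [← neg_sub x z, inner_neg_right, neg_sq] at this
      linarith
    have h1 := hlow _ (decision_mem hP hgrad htT) _ (expertDecision_mem hP hgrad J htT)
    have h2 := hlow _ (expertDecision_mem hP hgrad J htT) _ hw
    linarith
  refine (Finset.sum_le_sum hterm).trans ?_
  rw [Finset.sum_add_distrib]
  have hmeta := meta_regret_sub_sq_le hP hgrad hJ hJq hqT hβ
  have hexp := maler_regret_sub_inner_le hd hP (one_le_gcLen J)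
    (norm_grad_gc_le hgrad hJ (hJq.trans hqT)) hw hβ
  rw [Finset.mul_sum, ← Finset.sum_sub_distrib] at hexp
  rw [← sum_expertDecision hJ fun g x =>
    inner ℝ g (x - w) - β / 2 * inner ℝ g (x - w) ^ 2] at hexp
  have hK := two_mul_log_malerK_le_Xi (one_le_gcLen J) hpq (gcLen_le hJp hJq)
  have hlogd := mul_log_one_add_div_le hd (one_le_gcLen J)
  have hl : (d : ℝ) * Real.log (gcLen J) ≤ d * Real.log ((q : ℝ) - p + 1) :=
    mul_le_mul_of_nonneg_left (log_gcLen_le hpq hJp hJq) (by positivity)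
  have hdl : 0 ≤ (d : ℝ) * Real.log ((q : ℝ) - p + 1) := by positivity
  have hM : 2 * Real.log (√3 * (malerK (gcLen J) + 1)) +
      28 / 25 * (1 + d * Real.log (1 + gcLen J / (64 * d))) ≤
      Xi p q + 2 + 10 * d * Real.log ((q : ℝ) - p + 1) := by linarith
  have hexp2 := hexp.trans (mul_le_mul_of_nonneg_left hM
    (by positivity : 0 ≤ 5 * P.G * P.D + 9 / (2 * β)))
  refine (add_le_add hmeta hexp2).trans ?_
  change (G * D + 1 / (2 * β)) * c q + (5 * G * D + 9 / (2 * β)) * _ ≤ _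
  rw [show 9 / (2 * β) = 9 * (1 / (2 * β)) by ring]
  have hb0 : 0 < 1 / (2 * β) := by positivity
  set B := 1 / (2 * β)
  set X := Xi p q
  set Y := 10 * d * Real.log ((q : ℝ) - p + 1) with hY
  have hY0 : 0 ≤ Y := by positivity
  have e1 : 0 ≤ G * D * (X + Y) := by positivity
  have e2 : 16 * (G * D) ≤ G * D * c q := by nlinarith
  have e3 : 16 * B ≤ B * c q := by nlinarith
  linarith

/-- As `sum_expConcave_le`, with the expert "s" of Maler in place of the expert "l". -/
theorem sum_stronglyConvex_le (hS : Setting Ω D G x₁ T f grad) (hG : 0 < G) (hD : 0 < D)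
    (hp : 1 ≤ p) (hpq : p ≤ q) (hqT : q ≤ T) (hw : w ∈ Ω) {lam : ℝ} (hlam : 0 < lam)
    (hf : ∀ t ∈ Finset.Icc p q, StronglyConvexOn Ω lam (f t) (grad t)) (hJ : 1 ≤ J.2)
    (hJp : p ≤ gcStart J) (hJq : gcEnd J ≤ q) :
    ∑ t ∈ Finset.Icc (gcStart J) (gcEnd J), (f t (decision ⟨Ω, D, G, x₁⟩ grad t) - f t w) ≤
      (10 * G * D + 9 * G ^ 2 / (2 * lam)) *
        (c q + Xi p q + Real.log ((q : ℝ) - p + 1)) := by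
  set P : Params d := ⟨Ω, D, G, x₁⟩ with hPdef
  have hP : P.Admissible := hS.admissible hG hD
  have hgrad : ∀ t ∈ Finset.Icc 1 T, ∀ x ∈ P.Ω, ‖grad t x‖ ≤ P.G := hS.grad_le
  have hGD : 0 < G * D := mul_pos hG hD
  have hc := sixteen_le_c (hp.trans hpq)
  have hXi := Xi_nonneg hpq
  have hlog := log_range_nonneg hpq
  -- strong convexity `lam` gives the curvature `lam / G²` along the gradient
  obtain ⟨β, hβ, hlamβ⟩ : ∃ β, 0 < β ∧ lam = β * G ^ 2 :=
    ⟨lam / G ^ 2, by positivity, by field_simp⟩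
  set y := expertDecision P grad J
  have hterm : ∀ t ∈ Finset.Icc (gcStart J) (gcEnd J), f t (decision P grad t) - f t w ≤
      (inner ℝ (grad t (decision P grad t)) (decision P grad t - y t) -
        β / 2 * inner ℝ (grad t (decision P grad t)) (decision P grad t - y t) ^ 2) +
      (inner ℝ (grad t (y t)) (y t - w) - β / 2 * (G ^ 2 * ‖y t - w‖ ^ 2)) := by
    intro t ht
    rw [Finset.mem_Icc] at ht
    have htT : t ∈ Finset.Icc 1 T := Finset.mem_Icc.2 ⟨by omega, by omega⟩
    have htf := hf t (Finset.mem_Icc.2 ⟨by omega, by omega⟩)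
    have hlow : ∀ x ∈ Ω, ∀ z ∈ Ω, f t x - f t z ≤
        inner ℝ (grad t x) (x - z) - β / 2 * (G ^ 2 * ‖x - z‖ ^ 2) := by
      intro x hx z hz
      have := htf x hx z hz
      rw [← neg_sub x z, inner_neg_right, norm_neg, hlamβ] at this
      linarith
    have hdec := decision_mem hP hgrad htT
    have h1 := hlow _ hdec _ (expertDecision_mem hP hgrad J htT)
    have h2 := hlow _ (expertDecision_mem hP hgrad J htT) _ hw
    have h3 : inner ℝ (grad t (decision P grad t)) (decision P grad t - y t) ^ 2 ≤
        G ^ 2 * ‖decision P grad t - y t‖ ^ 2 := by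
      rw [← mul_pow, ← sq_abs]
      exact pow_le_pow_left₀ (abs_nonneg _) ((abs_real_inner_le_norm _ _).trans
        (mul_le_mul_of_nonneg_right (hgrad t htT _ hdec) (norm_nonneg _))) 2
    have h4 := mul_le_mul_of_nonneg_left h3 (by positivity : 0 ≤ β / 2)
    linarith
  refine (Finset.sum_le_sum hterm).trans ?_
  rw [Finset.sum_add_distrib]
  have hmeta := meta_regret_sub_sq_le hP hgrad hJ hJq hqT hβ
  have hexp := maler_regret_sub_norm_le hP (one_le_gcLen J)
    (norm_grad_gc_le hgrad hJ (hJq.trans hqT)) hw hβ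
  rw [Finset.mul_sum, Finset.mul_sum, ← Finset.sum_sub_distrib] at hexp
  rw [← sum_expertDecision hJ fun g x =>
    inner ℝ g (x - w) - β / 2 * (P.G ^ 2 * ‖x - w‖ ^ 2)] at hexp
  have hK := two_mul_log_malerK_le_Xi (one_le_gcLen J) hpq (gcLen_le hJp hJq)
  have hl := log_gcLen_le hpq hJp hJq
  have hM : 2 * Real.log (√3 * (malerK (gcLen J) + 1)) + 1 / 2 * (1 + Real.log (gcLen J)) ≤
      Xi p q + 1 + Real.log ((q : ℝ) - p + 1) := by linarith
  have hexp2 := hexp.trans (mul_le_mul_of_nonneg_left hM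
    (by positivity : 0 ≤ 5 * P.G * P.D + 9 / (2 * β)))
  refine (add_le_add hmeta hexp2).trans ?_
  change (G * D + 1 / (2 * β)) * c q + (5 * G * D + 9 / (2 * β)) * _ ≤ _
  rw [hlamβ, show 9 * G ^ 2 / (2 * (β * G ^ 2)) = 9 * (1 / (2 * β)) by field_simp,
    show 9 / (2 * β) = 9 * (1 / (2 * β)) by ring]
  have hb0 : 0 < 1 / (2 * β) := by positivity
  set B := 1 / (2 * β)
  set X := Xi p q
  set Y := Real.log ((q : ℝ) - p + 1) with hY
  have e1 : 0 ≤ G * D * (X + Y) := by positivity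
  have e2 : 16 * (G * D) ≤ G * D * c q := by nlinarith
  have e3 : 16 * B ≤ B * c q := by nlinarith
  linarith

theorem sub_le_inner_of_convexOn (hS : Setting Ω D G x₁ T f grad) {t : ℕ}
    (ht : t ∈ Finset.Icc 1 T) (hf : ConvexOn ℝ Ω (f t)) {x y : Vec d} (hx : x ∈ Ω) (hy : y ∈ Ω) :
    f t x - f t y ≤ inner ℝ (grad t x) (x - y) := by
  have := convexOn_add_inner_le hf hx hy (hS.hasGradient t ht x hx)
  rw [← neg_sub x y, inner_neg_right] at this
  linarith

/-- As `sum_expConcave_le`, with the convex expert of Maler. -/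
theorem sum_convex_le (hS : Setting Ω D G x₁ T f grad) (hG : 0 < G) (hD : 0 < D)
    (hp : 1 ≤ p) (hqT : q ≤ T) (hw : w ∈ Ω)
    (hf : ∀ t ∈ Finset.Icc p q, ConvexOn ℝ Ω (f t)) (hJ : 1 ≤ J.2) (hJp : p ≤ gcStart J)
    (hJq : gcEnd J ≤ q) :
    ∑ t ∈ Finset.Icc (gcStart J) (gcEnd J), (f t (decision ⟨Ω, D, G, x₁⟩ grad t) - f t w) ≤
      G * D * c q + G * D * (√(c q) + 2 * Real.log 3 + 2) * √(gcLen J) := by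
  set P : Params d := ⟨Ω, D, G, x₁⟩ with hPdef
  have hP : P.Admissible := hS.admissible hG hD
  have hgrad : ∀ t ∈ Finset.Icc 1 T, ∀ x ∈ P.Ω, ‖grad t x‖ ≤ P.G := hS.grad_le
  set y := expertDecision P grad J
  have hterm : ∀ t ∈ Finset.Icc (gcStart J) (gcEnd J), f t (decision P grad t) - f t w ≤
      inner ℝ (grad t (decision P grad t)) (decision P grad t - y t) +
      inner ℝ (grad t (y t)) (y t - w) := by
    intro t ht
    rw [Finset.mem_Icc] at ht
    have htT : t ∈ Finset.Icc 1 T := Finset.mem_Icc.2 ⟨by omega, by omega⟩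
    have htf := hf t (Finset.mem_Icc.2 ⟨by omega, by omega⟩)
    have hy := expertDecision_mem hP hgrad J htT
    have h1 := sub_le_inner_of_convexOn hS htT htf (decision_mem hP hgrad htT) hy
    have h2 := sub_le_inner_of_convexOn hS htT htf hy hw
    linarith
  refine (Finset.sum_le_sum hterm).trans ?_
  rw [Finset.sum_add_distrib]
  have hmeta := meta_regret_le_sqrt hP hgrad hJ hJq hqT
  have hexp := maler_convex_regret_le hP (one_le_gcLen J)
    (norm_grad_gc_le hgrad hJ (hJq.trans hqT)) hw
  rw [← sum_expertDecision hJ fun g x => inner ℝ g (x - w)] at hexp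
  refine (add_le_add hmeta hexp).trans (le_of_eq ?_)
  ring

theorem sum_convex_le_len (hS : Setting Ω D G x₁ T f grad) (hG : 0 < G) (hD : 0 < D)
    (hp : 1 ≤ p) (hqT : q ≤ T) (hw : w ∈ Ω)
    (hf : ∀ t ∈ Finset.Icc p q, ConvexOn ℝ Ω (f t)) (hJp : p ≤ gcStart J)
    (hJq : gcEnd J ≤ q) :
    ∑ t ∈ Finset.Icc (gcStart J) (gcEnd J), (f t (decision ⟨Ω, D, G, x₁⟩ grad t) - f t w) ≤
      G * D * gcLen J := by
  have hP := hS.admissible hG hD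
  have hterm : ∀ t ∈ Finset.Icc (gcStart J) (gcEnd J),
      f t (decision ⟨Ω, D, G, x₁⟩ grad t) - f t w ≤ G * D := by
    intro t ht
    rw [Finset.mem_Icc] at ht
    have htT : t ∈ Finset.Icc 1 T := Finset.mem_Icc.2 ⟨by omega, by omega⟩
    have htf := hf t (Finset.mem_Icc.2 ⟨by omega, by omega⟩)
    have hdec := decision_mem hP hS.grad_le htT
    exact (sub_le_inner_of_convexOn hS htT htf hdec hw).trans
      ((le_abs_self _).trans (hP.abs_inner_le (hS.grad_le t htT _ hdec) hdec hw))
  refine (Finset.sum_le_sum hterm).trans (le_of_eq ?_)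
  rw [sum_Icc_gc]
  simp [mul_comm]

/-- For small intervals the trivial bound is the better one; together they lose no logarithm. -/
theorem sum_convex_le_sqrt_log (hS : Setting Ω D G x₁ T f grad) (hG : 0 < G) (hD : 0 < D)
    (hp : 1 ≤ p) (hq : 2 ≤ q) (hqT : q ≤ T) (hw : w ∈ Ω)
    (hf : ∀ t ∈ Finset.Icc p q, ConvexOn ℝ Ω (f t)) (hJ : 1 ≤ J.2) (hJp : p ≤ gcStart J)
    (hJq : gcEnd J ≤ q) :
    ∑ t ∈ Finset.Icc (gcStart J) (gcEnd J), (f t (decision ⟨Ω, D, G, x₁⟩ grad t) - f t w) ≤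
      84 * (G * D) * √(Real.log q) * √(gcLen J) := by
  have hGD : 0 < G * D := mul_pos hG hD
  have hq' : (2 : ℝ) ≤ q := by exact_mod_cast hq
  have hl0 : 1 / 4 ≤ Real.log q := by
    have := Real.log_le_log (by norm_num) hq'
    linarith [Real.log_two_gt_d9]
  set l := Real.log q with hl
  set n : ℝ := (gcLen J : ℝ) with hn
  have hn0 : 0 ≤ n := by positivity
  have hl2 : √l ^ 2 = l := Real.sq_sqrt (by linarith)
  have hn2 : √n ^ 2 = n := Real.sq_sqrt hn0
  have hsl : 1 / 2 ≤ √l := by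
    rw [Real.le_sqrt' (by norm_num)]; norm_num; linarith
  have hsn : 0 ≤ √n := Real.sqrt_nonneg _
  -- the trivial bound `G D n` is used up to `n = log q`
  rcases le_total n l with h | h
  · refine (sum_convex_le_len hS hG hD hp hqT hw hf hJp hJq).trans ?_
    have h1 : √n ≤ √l := Real.sqrt_le_sqrt h
    have h2 : n ≤ √l * √n := by nlinarith
    have h3 : G * D * n ≤ G * D * (√l * √n) := by gcongr
    have h4 : 0 ≤ G * D * (√l * √n) := by positivity
    rw [← hn]
    linarith
  · refine (sum_convex_le hS hG hD hp hqT hw hf hJ hJp hJq).trans ?_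
    have h1 : √l ≤ √n := Real.sqrt_le_sqrt h
    have hc : c q ≤ 64 * l := c_le_log hq
    have hsc : √(c q) ≤ 8 * √l := by
      rw [Real.sqrt_le_left (by positivity), mul_pow, hl2]
      linarith
    have hl3 : Real.log 3 ≤ 2 := by
      have := Real.log_le_sub_one_of_pos (x := 3) (by norm_num)
      linarith
    have h2 : l ≤ √l * √n := by nlinarith
    have h3 : √(c q) + 2 * Real.log 3 + 2 ≤ 20 * √l := by linarith
    calc G * D * c q + G * D * (√(c q) + 2 * Real.log 3 + 2) * √n
        ≤ G * D * (64 * (√l * √n)) + G * D * (20 * √l) * √n := by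
          gcongr
          linarith
      _ = _ := by ring

/-! ### Regret over an arbitrary interval -/

theorem regret_eq_sum (w : ℕ → Vec d) (u : Vec d) {s : List (ℕ × ℕ)}
    (hs : IsGCPartition p (q + 1) s) :
    regret f w p q u =
      (s.map fun J => ∑ t ∈ Finset.Icc (gcStart J) (gcEnd J), (f t (w t) - f t u)).sum := by
  rw [← hs.sum_eq fun t => f t (w t) - f t u, Finset.sum_sub_distrib]
  rfl

/-- A uniform bound over the intervals of the partition. -/
theorem regret_le_of_forall_gc (hp : 1 ≤ p) (hpq : p ≤ q) {v : ℕ → Vec d} {u : Vec d} {B : ℝ}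
    (hB : 0 ≤ B)
    (h : ∀ J : ℕ × ℕ, 1 ≤ J.2 → p ≤ gcStart J → gcEnd J ≤ q →
      ∑ t ∈ Finset.Icc (gcStart J) (gcEnd J), (f t (v t) - f t u) ≤ B) :
    regret f v p q u ≤ b p q * B := by
  obtain ⟨s, hs, hlen, -⟩ := exists_gcPartition hp hpq
  rw [regret_eq_sum v u hs]
  have h1 := List.sum_le_card_nsmul
    (s.map fun J => ∑ t ∈ Finset.Icc (gcStart J) (gcEnd J), (f t (v t) - f t u)) B (by
      intro x hx
      obtain ⟨J, hJ, rfl⟩ := List.mem_map.1 hx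
      obtain ⟨h1, h2, h3⟩ := hs.mem J hJ
      exact h J h1 h2 (by omega))
  rw [List.length_map, nsmul_eq_mul] at h1
  exact h1.trans (mul_le_mul_of_nonneg_right hlen hB)

/-- A bound over the intervals of the partition that grows with the root of the length. -/
theorem regret_le_of_forall_gc_sqrt (hp : 1 ≤ p) (hpq : p ≤ q) {v : ℕ → Vec d} {u : Vec d}
    {B E : ℝ} (hB : 0 ≤ B) (hE : 0 ≤ E)
    (h : ∀ J : ℕ × ℕ, 1 ≤ J.2 → p ≤ gcStart J → gcEnd J ≤ q →
      ∑ t ∈ Finset.Icc (gcStart J) (gcEnd J), (f t (v t) - f t u) ≤ B + E * √(gcLen J)) :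
    regret f v p q u ≤ b p q * B + E * (7 / 2 * √((q : ℝ) - p + 1)) := by
  obtain ⟨s, hs, hlen, hsqrt⟩ := exists_gcPartition hp hpq
  rw [regret_eq_sum v u hs]
  have h1 : (s.map fun J => ∑ t ∈ Finset.Icc (gcStart J) (gcEnd J), (f t (v t) - f t u)).sum ≤
      (s.map fun J => B + E * √(gcLen J : ℝ)).sum := by
    refine List.sum_le_sum fun J hJ => ?_
    obtain ⟨h1, h2, h3⟩ := hs.mem J hJ
    exact h J h1 h2 (by omega)
  refine h1.trans ?_
  rw [List.sum_map_add, List.sum_map_mul_left]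
  simp only [List.map_const', List.sum_replicate, nsmul_eq_mul]
  have h2 := mul_le_mul_of_nonneg_right hlen hB
  have h3 := mul_le_mul_of_nonneg_left hsqrt hE
  exact add_le_add h2 h3

theorem regret_expConcave_le (hS : Setting Ω D G x₁ T f grad) (hG : 0 < G) (hD : 0 < D)
    (hp : 1 ≤ p) (hpq : p ≤ q) (hqT : q ≤ T) (hw : w ∈ Ω) {α : ℝ} (hα : 0 < α)
    (hf : ∀ t ∈ Finset.Icc p q, ExpConcaveOn Ω α (f t)) :
    regret f (decision ⟨Ω, D, G, x₁⟩ grad) p q w ≤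
      (10 * G * D + 9 / (2 * beta G D α)) * b p q *
        (c q + Xi p q + 10 * d * Real.log ((q : ℝ) - p + 1)) := by
  have hβ := beta_pos hG hD hα
  have hc := sixteen_le_c (hp.trans hpq)
  have hXi := Xi_nonneg hpq
  have hlog := log_range_nonneg hpq
  refine (regret_le_of_forall_gc hp hpq (by positivity) fun J hJ hJp hJq =>
    sum_expConcave_le hS hG hD hp hpq hqT hw hα hf hJ hJp hJq).trans (le_of_eq ?_)
  ring

theorem regret_stronglyConvex_le (hS : Setting Ω D G x₁ T f grad) (hG : 0 < G) (hD : 0 < D)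
    (hp : 1 ≤ p) (hpq : p ≤ q) (hqT : q ≤ T) (hw : w ∈ Ω) {lam : ℝ} (hlam : 0 < lam)
    (hf : ∀ t ∈ Finset.Icc p q, StronglyConvexOn Ω lam (f t) (grad t)) :
    regret f (decision ⟨Ω, D, G, x₁⟩ grad) p q w ≤
      (10 * G * D + 9 * G ^ 2 / (2 * lam)) * b p q *
        (c q + Xi p q + Real.log ((q : ℝ) - p + 1)) := by
  have hc := sixteen_le_c (hp.trans hpq)
  have hXi := Xi_nonneg hpq
  have hlog := log_range_nonneg hpq
  refine (regret_le_of_forall_gc hp hpq (by positivity) fun J hJ hJp hJq =>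
    sum_stronglyConvex_le hS hG hD hp hpq hqT hw hlam hf hJ hJp hJq).trans (le_of_eq ?_)
  ring

theorem b_nonneg (hpq : p ≤ q) : 0 ≤ b p q := by
  have h : (p : ℝ) ≤ q := by exact_mod_cast hpq
  have : 0 ≤ Real.logb 2 ((q : ℝ) - p + 2) := Real.logb_nonneg (by norm_num) (by linarith)
  have h2 : (0 : ℝ) ≤ (⌈Real.logb 2 ((q : ℝ) - p + 2)⌉ : ℝ) := this.trans (Int.le_ceil _)
  unfold b
  positivity

theorem regret_convex_le (hS : Setting Ω D G x₁ T f grad) (hG : 0 < G) (hD : 0 < D)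
    (hp : 1 ≤ p) (hpq : p ≤ q) (hqT : q ≤ T) (hw : w ∈ Ω)
    (hf : ∀ t ∈ Finset.Icc p q, ConvexOn ℝ Ω (f t)) :
    regret f (decision ⟨Ω, D, G, x₁⟩ grad) p q w ≤
      2 * G * D * c q * b p q +
        7 * G * D * (√(c q) + 2 * Real.log 3 + 3 / 2) * √((q : ℝ) - p + 1) := by
  have hGD : 0 < G * D := mul_pos hG hD
  have hc := sixteen_le_c (hp.trans hpq)
  have hl3 : 0 ≤ Real.log 3 := Real.log_nonneg (by norm_num)
  refine (regret_le_of_forall_gc_sqrt hp hpq (by positivity) (by positivity) fun J hJ hJp hJq =>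
    sum_convex_le hS hG hD hp hqT hw hf hJ hJp hJq).trans ?_
  have h1 : 0 ≤ G * D * c q * b p q :=
    mul_nonneg (mul_nonneg hGD.le (by linarith)) (b_nonneg hpq)
  have h2 : 0 ≤ G * D * √((q : ℝ) - p + 1) := by positivity
  have h3 : 0 ≤ G * D * √((q : ℝ) - p + 1) * √(c q) := by positivity
  have h4 : 0 ≤ G * D * √((q : ℝ) - p + 1) * Real.log 3 := by positivity
  linarith

/-! ### Rates -/

theorem b_le_log (hpq : p + 2 ≤ q) : b p q ≤ 9 * Real.log ((q : ℝ) - p) := by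
  have h : (p : ℝ) + 2 ≤ q := by exact_mod_cast hpq
  set m := (q : ℝ) - p with hm
  have hm2 : 2 ≤ m := by linarith
  have h1 : Real.log (m + 2) ≤ 2 * Real.log m := by
    have : Real.log (m + 2) ≤ Real.log (m ^ 2) := Real.log_le_log (by linarith) (by nlinarith)
    rwa [Real.log_pow, Nat.cast_ofNat] at this
  have h2 : Real.log 2 ≤ Real.log m := Real.log_le_log (by norm_num) hm2
  have hl2 := Real.log_two_gt_d9
  have h3 : Real.logb 2 (m + 2) + 1 ≤ 9 / 2 * Real.log m := by
    rw [Real.logb, div_add_one (by linarith), div_le_iff₀ (by linarith)]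
    nlinarith
  have h4 := Int.ceil_lt_add_one (Real.logb 2 (m + 2))
  rw [b, ← hm]
  linarith

theorem Xi_le_log (hp : 1 ≤ p) (hpq : p + 2 ≤ q) : Xi p q ≤ 6 * Real.log q := by
  have hp' : (1 : ℝ) ≤ p := by exact_mod_cast hp
  have h : (p : ℝ) + 2 ≤ q := by exact_mod_cast hpq
  have h3 : √3 ≤ (2 : ℝ) := by rw [Real.sqrt_le_left (by norm_num)]; norm_num
  have h1 : Real.logb 2 ((q : ℝ) - p + 1) ≤ q := by
    have h2 : (q : ℝ) - p + 1 ≤ 2 ^ (q : ℝ) := by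
      have : (q : ℝ) ≤ 2 ^ q := by exact_mod_cast (Nat.lt_two_pow_self (n := q)).le
      rw [Real.rpow_natCast]
      linarith
    rwa [Real.logb_le_iff_le_rpow (by norm_num) (by linarith)]
  have h0 : 0 ≤ Real.logb 2 ((q : ℝ) - p + 1) := Real.logb_nonneg (by norm_num) (by linarith)
  have h4 : √3 / 2 * Real.logb 2 ((q : ℝ) - p + 1) + 3 * √3 ≤ (q : ℝ) ^ 3 := by
    have h5 : √3 / 2 * Real.logb 2 ((q : ℝ) - p + 1) ≤ 1 * q := by
      gcongr
      linarith
    have hq3 : (3 : ℝ) ≤ q := by linarith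
    nlinarith [mul_nonneg (by linarith : (0 : ℝ) ≤ q - 3) (by linarith : (0 : ℝ) ≤ q),
      mul_nonneg (mul_nonneg (by linarith : (0 : ℝ) ≤ q - 3) (by linarith : (0 : ℝ) ≤ q))
        (by linarith : (0 : ℝ) ≤ q)]
  have h5 : 0 < √3 / 2 * Real.logb 2 ((q : ℝ) - p + 1) + 3 * √3 := by positivity
  have h6 := Real.log_le_log h5 h4
  rw [Real.log_pow] at h6
  push_cast at h6
  rw [Xi]
  linarith

theorem log_range_le_log (hp : 1 ≤ p) (hpq : p + 2 ≤ q) :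
    Real.log ((q : ℝ) - p + 1) ≤ Real.log q := by
  have hp' : (1 : ℝ) ≤ p := by exact_mod_cast hp
  have h : (p : ℝ) + 2 ≤ q := by exact_mod_cast hpq
  exact Real.log_le_log (by linarith) (by linarith)

theorem regret_expConcave_rate (hS : Setting Ω D G x₁ T f grad) (hG : 0 < G) (hD : 0 < D)
    (hp : 1 ≤ p) (hpq : p + 2 ≤ q) (hqT : q ≤ T) (hw : w ∈ Ω) {α M : ℝ} (hα : 0 < α)
    (hαM : α ≤ M) (hf : ∀ t ∈ Finset.Icc p q, ExpConcaveOn Ω α (f t)) :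
    regret f (decision ⟨Ω, D, G, x₁⟩ grad) p q w ≤
      720 * (46 * (G * D) * M + 9) * (d * Real.log q * Real.log ((q : ℝ) - p) / α) := by
  have hGD : 0 < G * D := mul_pos hG hD
  rcases Nat.eq_zero_or_pos d with rfl | hd
  · have : regret f (decision ⟨Ω, D, G, x₁⟩ grad) p q w = 0 := by
      rw [regret, sub_eq_zero]
      exact Finset.sum_congr rfl fun t _ => by
        rw [Subsingleton.elim (decision _ grad t) w]
    rw [this]
    simp
  have hd' : (1 : ℝ) ≤ d := by exact_mod_cast hd
  refine (regret_expConcave_le hS hG hD hp (by omega) hqT hw hα hf).trans ?_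
  have hβ := beta_pos hG hD hα
  have hcoef : 10 * G * D + 9 / (2 * beta G D α) ≤ (46 * (G * D) * M + 9) / α := by
    have h1 : 9 / (2 * beta G D α) ≤ 36 * (G * D) + 9 / α := by
      rw [beta, ← mul_assoc, mul_one_div_cancel two_ne_zero, one_mul]
      -- `1 / min {1 / (4 G D), α}` is `4 G D` or `1 / α`
      rcases min_choice (1 / (4 * G * D)) α with h | h
      · rw [h, div_div_eq_mul_div, div_one]
        have : 0 < 9 / α := by positivity
        linarith
      · rw [h]; linarith
    have h2 : 46 * (G * D) ≤ 46 * (G * D) * M / α := by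
      rw [le_div_iff₀ hα]; gcongr
    rw [add_div]
    linarith
  have hb := b_le_log hpq
  have hb0 := b_nonneg (by omega : p ≤ q)
  have hl0 : 0 ≤ Real.log q := Real.log_natCast_nonneg q
  have hbr : c q + Xi p q + 10 * d * Real.log ((q : ℝ) - p + 1) ≤ 80 * (d * Real.log q) := by
    have h1 := c_le_log (by omega : 2 ≤ q)
    have h2 := Xi_le_log hp hpq
    have h3 : 10 * d * Real.log ((q : ℝ) - p + 1) ≤ 10 * d * Real.log q := by
      exact mul_le_mul_of_nonneg_left (log_range_le_log hp hpq) (by positivity)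
    have h4 : Real.log q ≤ d * Real.log q := by nlinarith
    linarith
  have hbr0 : 0 ≤ c q + Xi p q + 10 * d * Real.log ((q : ℝ) - p + 1) := by
    have := sixteen_le_c (by omega : 1 ≤ q)
    have := Xi_nonneg (by omega : p ≤ q)
    have := log_range_nonneg (by omega : p ≤ q)
    positivity
  calc (10 * G * D + 9 / (2 * beta G D α)) * b p q *
        (c q + Xi p q + 10 * d * Real.log ((q : ℝ) - p + 1))
      ≤ ((46 * (G * D) * M + 9) / α) * (9 * Real.log ((q : ℝ) - p)) *
        (80 * (d * Real.log q)) := by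
        have h0 : 0 ≤ (46 * (G * D) * M + 9) / α := le_trans (by positivity) hcoef
        exact mul_le_mul (mul_le_mul hcoef hb hb0 h0) hbr hbr0
          (mul_nonneg h0 (hb0.trans hb))
    _ = _ := by ring

theorem regret_stronglyConvex_rate (hS : Setting Ω D G x₁ T f grad) (hG : 0 < G) (hD : 0 < D)
    (hp : 1 ≤ p) (hpq : p + 2 ≤ q) (hqT : q ≤ T) (hw : w ∈ Ω) {lam M : ℝ} (hlam : 0 < lam)
    (hlamM : lam ≤ M) (hf : ∀ t ∈ Finset.Icc p q, StronglyConvexOn Ω lam (f t) (grad t)) :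
    regret f (decision ⟨Ω, D, G, x₁⟩ grad) p q w ≤
      639 * (10 * (G * D) * M + 9 * G ^ 2 / 2) *
        (Real.log q * Real.log ((q : ℝ) - p) / lam) := by
  have hGD : 0 < G * D := mul_pos hG hD
  refine (regret_stronglyConvex_le hS hG hD hp (by omega) hqT hw hlam hf).trans ?_
  have hcoef : 10 * G * D + 9 * G ^ 2 / (2 * lam) ≤
      (10 * (G * D) * M + 9 * G ^ 2 / 2) / lam := by
    have h2 : 10 * (G * D) ≤ 10 * (G * D) * M / lam := by
      rw [le_div_iff₀ hlam]; gcongr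
    rw [add_div, div_div (9 * G ^ 2)]
    linarith
  have hb := b_le_log hpq
  have hb0 := b_nonneg (by omega : p ≤ q)
  have hbr : c q + Xi p q + Real.log ((q : ℝ) - p + 1) ≤ 71 * Real.log q := by
    have h1 := c_le_log (by omega : 2 ≤ q)
    have h2 := Xi_le_log hp hpq
    have h3 := log_range_le_log hp hpq
    linarith
  have hbr0 : 0 ≤ c q + Xi p q + Real.log ((q : ℝ) - p + 1) := by
    have := sixteen_le_c (by omega : 1 ≤ q)
    have := Xi_nonneg (by omega : p ≤ q)
    have := log_range_nonneg (by omega : p ≤ q)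
    positivity
  calc (10 * G * D + 9 * G ^ 2 / (2 * lam)) * b p q *
        (c q + Xi p q + Real.log ((q : ℝ) - p + 1))
      ≤ ((10 * (G * D) * M + 9 * G ^ 2 / 2) / lam) * (9 * Real.log ((q : ℝ) - p)) *
        (71 * Real.log q) := by
        have h0 : 0 ≤ (10 * (G * D) * M + 9 * G ^ 2 / 2) / lam := le_trans (by positivity) hcoef
        exact mul_le_mul (mul_le_mul hcoef hb hb0 h0) hbr hbr0
          (mul_nonneg h0 (hb0.trans hb))
    _ = _ := by ring

theorem regret_convex_rate (hS : Setting Ω D G x₁ T f grad) (hG : 0 < G) (hD : 0 < D)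
    (hp : 1 ≤ p) (hpq : p + 1 ≤ q) (hqT : q ≤ T) (hw : w ∈ Ω)
    (hf : ∀ t ∈ Finset.Icc p q, ConvexOn ℝ Ω (f t)) :
    regret f (decision ⟨Ω, D, G, x₁⟩ grad) p q w ≤
      588 * (G * D) * √(((q : ℝ) - p) * Real.log q) := by
  have hGD : 0 < G * D := mul_pos hG hD
  have h : (p : ℝ) + 1 ≤ q := by exact_mod_cast hpq
  refine (regret_le_of_forall_gc_sqrt hp (by omega) le_rfl
    (by positivity : 0 ≤ 84 * (G * D) * √(Real.log q)) fun J hJ hJp hJq => by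
      rw [zero_add]
      exact sum_convex_le_sqrt_log hS hG hD hp (by omega) hqT hw hf hJ hJp hJq).trans ?_
  have h1 : √((q : ℝ) - p + 1) ≤ 2 * √((q : ℝ) - p) := by
    rw [Real.sqrt_le_left (by positivity), mul_pow, Real.sq_sqrt (by linarith)]
    linarith
  rw [Real.sqrt_mul (by linarith), mul_zero, zero_add]
  calc 84 * (G * D) * √(Real.log q) * (7 / 2 * √((q : ℝ) - p + 1))
      ≤ 84 * (G * D) * √(Real.log q) * (7 / 2 * (2 * √((q : ℝ) - p))) := by gcongr
    _ = _ := by ring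

end Losses

end UMA

theorem mainTheorem3 (G D : ℝ) (hG : 0 < G) (hD : 0 < D) :
    -- feasibility, and the explicit bounds for the three types of loss functions
    (∀ (d : ℕ) (Ω : Set (UMA.Vec d)) (x₁ : UMA.Vec d) (T : ℕ) (f : ℕ → UMA.Vec d → ℝ)
        (grad : ℕ → UMA.Vec d → UMA.Vec d), UMA.Setting Ω D G x₁ T f grad →
      (∀ t ∈ Finset.Icc 1 T, UMA.decision ⟨Ω, D, G, x₁⟩ grad t ∈ Ω) ∧
      ∀ p q : ℕ, 1 ≤ p → p ≤ q → q ≤ T → ∀ w ∈ Ω,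
        (∀ α : ℝ, 0 < α → (∀ t ∈ Finset.Icc p q, UMA.ExpConcaveOn Ω α (f t)) →
          UMA.regret f (UMA.decision ⟨Ω, D, G, x₁⟩ grad) p q w ≤
            (10 * G * D + 9 / (2 * UMA.beta G D α)) * UMA.b p q *
              (UMA.c q + UMA.Xi p q + 10 * d * Real.log ((q : ℝ) - p + 1))) ∧
        (∀ lam : ℝ, 0 < lam →
          (∀ t ∈ Finset.Icc p q, UMA.StronglyConvexOn Ω lam (f t) (grad t)) →
          UMA.regret f (UMA.decision ⟨Ω, D, G, x₁⟩ grad) p q w ≤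
            (10 * G * D + 9 * G ^ 2 / (2 * lam)) * UMA.b p q *
              (UMA.c q + UMA.Xi p q + Real.log ((q : ℝ) - p + 1))) ∧
        ((∀ t ∈ Finset.Icc p q, ConvexOn ℝ Ω (f t)) →
          UMA.regret f (UMA.decision ⟨Ω, D, G, x₁⟩ grad) p q w ≤
            2 * G * D * UMA.c q * UMA.b p q +
              7 * G * D * (√(UMA.c q) + 2 * Real.log 3 + 3 / 2) * √((q : ℝ) - p + 1))) ∧
    -- the rate for exp-concave functions
    (∀ M : ℝ, ∃ C : ℝ, ∀ (d : ℕ) (Ω : Set (UMA.Vec d)) (x₁ : UMA.Vec d) (T : ℕ)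
        (f : ℕ → UMA.Vec d → ℝ) (grad : ℕ → UMA.Vec d → UMA.Vec d),
        UMA.Setting Ω D G x₁ T f grad →
      ∀ p q : ℕ, 1 ≤ p → p + 2 ≤ q → q ≤ T → ∀ w ∈ Ω, ∀ α : ℝ, 0 < α → α ≤ M →
        (∀ t ∈ Finset.Icc p q, UMA.ExpConcaveOn Ω α (f t)) →
        UMA.regret f (UMA.decision ⟨Ω, D, G, x₁⟩ grad) p q w ≤
          C * (d * Real.log q * Real.log ((q : ℝ) - p) / α)) ∧
    -- the rate for strongly convex functions
    (∀ M : ℝ, ∃ C : ℝ, ∀ (d : ℕ) (Ω : Set (UMA.Vec d)) (x₁ : UMA.Vec d) (T : ℕ)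
        (f : ℕ → UMA.Vec d → ℝ) (grad : ℕ → UMA.Vec d → UMA.Vec d),
        UMA.Setting Ω D G x₁ T f grad →
      ∀ p q : ℕ, 1 ≤ p → p + 2 ≤ q → q ≤ T → ∀ w ∈ Ω, ∀ lam : ℝ, 0 < lam → lam ≤ M →
        (∀ t ∈ Finset.Icc p q, UMA.StronglyConvexOn Ω lam (f t) (grad t)) →
        UMA.regret f (UMA.decision ⟨Ω, D, G, x₁⟩ grad) p q w ≤
          C * (Real.log q * Real.log ((q : ℝ) - p) / lam)) ∧
    -- the rate for general convex functions
    (∃ C : ℝ, ∀ (d : ℕ) (Ω : Set (UMA.Vec d)) (x₁ : UMA.Vec d) (T : ℕ)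
        (f : ℕ → UMA.Vec d → ℝ) (grad : ℕ → UMA.Vec d → UMA.Vec d),
        UMA.Setting Ω D G x₁ T f grad →
      ∀ p q : ℕ, 1 ≤ p → p + 1 ≤ q → q ≤ T → ∀ w ∈ Ω,
        (∀ t ∈ Finset.Icc p q, ConvexOn ℝ Ω (f t)) →
        UMA.regret f (UMA.decision ⟨Ω, D, G, x₁⟩ grad) p q w ≤
          C * √(((q : ℝ) - p) * Real.log q)) := by
  refine ⟨?_, ?_, ?_, ?_⟩
  · intro d Ω x₁ T f grad hS
    refine ⟨fun t ht => UMA.decision_mem (hS.admissible hG hD) hS.grad_le ht, ?_⟩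
    intro p q hp hpq hqT w hw
    exact ⟨fun α hα hf => UMA.regret_expConcave_le hS hG hD hp hpq hqT hw hα hf,
      fun lam hlam hf => UMA.regret_stronglyConvex_le hS hG hD hp hpq hqT hw hlam hf,
      fun hf => UMA.regret_convex_le hS hG hD hp hpq hqT hw hf⟩
  · intro M
    exact ⟨_, fun d Ω x₁ T f grad hS p q hp hpq hqT w hw α hα hαM hf =>
      UMA.regret_expConcave_rate hS hG hD hp hpq hqT hw hα hαM hf⟩
  · intro M
    exact ⟨_, fun d Ω x₁ T f grad hS p q hp hpq hqT w hw lam hlam hlamM hf =>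
      UMA.regret_stronglyConvex_rate hS hG hD hp hpq hqT hw hlam hlamM hf⟩
  · exact ⟨_, fun d Ω x₁ T f grad hS p q hp hpq hqT w hw hf =>
      UMA.regret_convex_rate hS hG hD hp hpq hqT hw hf⟩
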